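/- Let $M\vDash\mathrm{ZFCA}$ (set theory with atoms and choice), with set of atoms $A$. In $M$, let $\mathcal G$ be a group of permutations of $A$ and let $\mathcal F$ be a normal filter of subgroups of $\mathcal G$, i.e. a set of subgroups of $\mathcal G$ that contains $\mathcal G$, is closed under larger subgroups of $\mathcal G$ and under pairwise intersections, and is closed under conjugation by elements of $\mathcal G$. Permutations act on $M$ by extending their action on atoms through $\pi x=\{\pi y : y\in x\}$ for sets $x$. Put $\mathrm{sym}_{\mathcal G}(x)=\{\pi\in\mathcal G : \pi x=x\}$ and $\mathrm{Orb}(y,K)=\{\pi y : \pi\in K\}$. Let $N=M(A,\mathcal G,\mathcal F)$ be the permutation model consisting of all hereditarily $\mathcal F$-symmetric $x\in M$: those for which $\mathrm{sym}_{\mathcal G}(z)\in\mathcal F$ for $z=x$ and for every element $z$ of the transitive closure of $x$. A set is *infinite* if it is not in bijection with any $n\in\omega$. For a set $x$, a family $F\subseteq 2^x$ *has the FIP* if the intersection of any finitely many elements of $F$ is infinite (the empty intersection being $x$). $\mathrm{BPI}$ is the statement that every proper filter on every set extends to an ultrafilter on that set. The model $N$ has the *filter extension property* if $\mathcal F$ has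 a base $\mathcal B$ (a set $\mathcal B\subseteq\mathcal F$ such that every $H\in\mathcal F$ contains some $K\in\mathcal B$) such that for every $K\in\mathcal B$ and all $F,x,y\in N$ with $K\subseteq \mathrm{sym}_{\mathcal G}(F)\cap\mathrm{sym}_{\mathcal G}(x)$ and $$N\vDash \text{``}F\subseteq 2^x \text{ has the FIP''}\ \wedge\ y\subseteq x,$$ there is $y'\in\{y,\,x\setminus y\}$ with $$N\vDash \text{``}F\cup\mathrm{Orb}(y',K)\subseteq 2^x \text{ has the FIP''}.$$ **Theorem.** The following are equivalent: (i) $N\vDash\mathrm{BPI}$; (ii) $N$ has the filter extension property. -/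

import Mathlib

/-!
Set theory with atoms is formalized through arbitrary first-order structures, which may be
ill-founded from outside. A structure consists of a type with a membership relation and a predicate
that singles out the atoms. All set-theoretic notions below (pairs, functions, natural numbers,
finiteness, filters, permutation groups) are those *internal* to the structure: their
quantifiers range over its elements, so that one definition serves both for a model `M` of `ZFCA`
and for the permutation submodel, in which they are relativized.
-/

universe u

namespace ZFA

/-- Structures for the language of set theory with atoms. -/
class AtomStr (M : Type u) where
  /-- `mem x y`: `x` is an element of `y`. -/
  mem : M → M → Prop
  /-- `isAtom x`: `x` is an atom. -/
  isAtom : M → Prop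

infix:50 " ∈ₐ " => AtomStr.mem

/-- The relation symbols of the language of set theory with atoms. -/
inductive AtomRel : ℕ → Type
  | mem : AtomRel 2
  | atom : AtomRel 1

/-- The first-order language of set theory with atoms. The constants for the empty set and the set
of atoms are definable, and schemas below allow arbitrary parameters, so no constants are needed. -/
def setLang : FirstOrder.Language.{0, 0} := ⟨fun _ => Empty, AtomRel⟩

instance setLangStructure (M : Type u) [AtomStr M] : setLang.Structure M where
  funMap := fun f => nomatch f
  RelMap
    | .mem => fun v => v 0 ∈ₐ v 1
    | .atom => fun v => AtomStr.isAtom (v 0)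

section Basic

variable {M : Type u} [AtomStr M]

/-- First-order definable classes, with parameters from the structure. -/
def DefinableClass (P : M → Prop) : Prop :=
  (Set.univ : Set M).Definable₁ setLang {x | P x}

/-- First-order definable binary relations, with parameters from the structure. -/
def DefinableRel (R : M → M → Prop) : Prop :=
  (Set.univ : Set M).Definable₂ setLang {p | R p.1 p.2}

/-- `x` is a set, that is, not an atom. -/
def IsSet (x : M) : Prop := ¬ AtomStr.isAtom x

/-- `y` is a subset of `x`. -/
def IsSubset (y x : M) : Prop := IsSet y ∧ ∀ z, z ∈ₐ y → z ∈ₐ x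

/-- `e` is the empty set. -/
def IsEmptySet (e : M) : Prop := IsSet e ∧ ∀ z, ¬ z ∈ₐ e

/-- `p = {a, b}`. -/
def IsUPair (p a b : M) : Prop := IsSet p ∧ ∀ z, z ∈ₐ p ↔ z = a ∨ z = b

/-- `p = (a, b) = {{a}, {a, b}}`. -/
def IsPair (p a b : M) : Prop := ∃ s d, IsUPair s a a ∧ IsUPair d a b ∧ IsUPair p s d

/-- `s = n ∪ {n}`. -/
def IsSucc (s n : M) : Prop := IsSet s ∧ ∀ z, z ∈ₐ s ↔ z ∈ₐ n ∨ z = n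

/-- `w` contains the empty set and is closed under successors. -/
def IsInductive (w : M) : Prop :=
  IsSet w ∧ (∃ e, IsEmptySet e ∧ e ∈ₐ w) ∧ ∀ n, n ∈ₐ w → ∃ s, IsSucc s n ∧ s ∈ₐ w

/-- `n ∈ ω`, where `ω` is the intersection of all inductive sets. -/
def IsNat (n : M) : Prop := ∀ w, IsInductive w → n ∈ₐ w

/-- `(a, b) ∈ f`; for a function `f` this says `f(a) = b`. -/
def App (f a b : M) : Prop := ∃ p, p ∈ₐ f ∧ IsPair p a b

/-- `f` is a bijection from `x` to `y`. -/
structure IsBij (f x y : M) : Prop where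
  isSet : IsSet f
  pairs : ∀ p, p ∈ₐ f → ∃ a b, a ∈ₐ x ∧ b ∈ₐ y ∧ IsPair p a b
  left : ∀ a, a ∈ₐ x → ∃! b, App f a b
  right : ∀ b, b ∈ₐ y → ∃! a, App f a b

/-- `x` is in bijection with some `n ∈ ω`. -/
def IsFinite (x : M) : Prop := ∃ n f, IsNat n ∧ IsBij f x n

/-- `d = x ∖ y`. -/
def IsDiff (d x y : M) : Prop := IsSet d ∧ ∀ z, z ∈ₐ d ↔ z ∈ₐ x ∧ ¬ z ∈ₐ y

/-- `d = x ∩ y`. -/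
def IsInter (d x y : M) : Prop := IsSet d ∧ ∀ z, z ∈ₐ d ↔ z ∈ₐ x ∧ z ∈ₐ y

/-- `t` is a transitive set. -/
def IsTransitive (t : M) : Prop := IsSet t ∧ ∀ z, z ∈ₐ t → ∀ w, w ∈ₐ z → w ∈ₐ t

/-- `M` is a model of `ZFCA` whose set of atoms is `A`. -/
structure IsModelZFCA (A : M) : Prop where
  atoms_isSet : IsSet A
  mem_atoms : ∀ x : M, x ∈ₐ A ↔ AtomStr.isAtom x
  atom_no_mem : ∀ x : M, AtomStr.isAtom x → ∀ z : M, ¬ z ∈ₐ x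
  empty : ∃ e : M, IsEmptySet e
  ext : ∀ x y : M, IsSet x → IsSet y → (∀ z, z ∈ₐ x ↔ z ∈ₐ y) → x = y
  pairing : ∀ a b : M, ∃ p, IsUPair p a b
  union : ∀ x : M, ∃ y : M, IsSet y ∧ ∀ z, z ∈ₐ y ↔ ∃ w, w ∈ₐ x ∧ z ∈ₐ w
  powerset : ∀ x : M, ∃ y : M, IsSet y ∧ ∀ z, z ∈ₐ y ↔ IsSubset z x
  infinity : ∃ w : M, IsInductive w
  foundation : ∀ x : M, (∃ z, z ∈ₐ x) → ∃ z, z ∈ₐ x ∧ ∀ w, w ∈ₐ z → ¬ w ∈ₐ x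
  separation : ∀ P : M → Prop, DefinableClass P →
    ∀ x : M, ∃ y : M, IsSet y ∧ ∀ z, z ∈ₐ y ↔ z ∈ₐ x ∧ P z
  replacement : ∀ R : M → M → Prop, DefinableRel R → ∀ x,
    (∀ a, a ∈ₐ x → ∀ b b', R a b → R a b' → b = b') →
    ∃ y, IsSet y ∧ ∀ b, b ∈ₐ y ↔ ∃ a, a ∈ₐ x ∧ R a b
  choice : ∀ x : M, (∀ y, y ∈ₐ x → ∃ z, z ∈ₐ y) →
    (∀ y y', y ∈ₐ x → y' ∈ₐ x → (∃ z, z ∈ₐ y ∧ z ∈ₐ y') → y = y') →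
    ∃ c, IsSet c ∧ ∀ y, y ∈ₐ x → ∃! z, z ∈ₐ y ∧ z ∈ₐ c

/-! ### Filters, the finite intersection property and BPI inside a structure -/

/-- `F` is a (proper) filter on the set `x`. -/
structure IsFilterOn (F x : M) : Prop where
  isSet : IsSet F
  subset : ∀ u, u ∈ₐ F → IsSubset u x
  univ_mem : x ∈ₐ F
  nonempty : ∀ u, u ∈ₐ F → ∃ z, z ∈ₐ u
  inter_mem : ∀ u v, u ∈ₐ F → v ∈ₐ F → ∃ w, IsInter w u v ∧ w ∈ₐ F
  upward : ∀ u v, u ∈ₐ F → IsSubset v x → (∀ z, z ∈ₐ u → z ∈ₐ v) → v ∈ₐ F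

/-- `U` is an ultrafilter on the set `x`. -/
structure IsUltrafilterOn (U x : M) : Prop extends IsFilterOn U x where
  mem_or_diff_mem : ∀ y, IsSubset y x → y ∈ₐ U ∨ ∃ d, IsDiff d x y ∧ d ∈ₐ U

/-- `F ⊆ 2^x` has the finite intersection property: the intersection of any finitely many elements
of `F` is infinite. Intersections are taken within `x`, so that the empty one is `x`. -/
structure HasFIP (F x : M) : Prop where
  isSet_base : IsSet x
  isSet : IsSet F
  subset : ∀ u, u ∈ₐ F → IsSubset u x
  inter : ∀ s, IsSubset s F → IsFinite s →
    ∃ i, IsSet i ∧ (∀ z, z ∈ₐ i ↔ z ∈ₐ x ∧ ∀ u, u ∈ₐ s → z ∈ₐ u) ∧ ¬ IsFinite i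

variable (M) in
/-- The structure `M` satisfies `BPI`, in the form of the ultrafilter lemma: every filter on every
set extends to an ultrafilter. -/
def BPI : Prop :=
  ∀ x F : M, IsSet x → IsFilterOn F x → ∃ U, IsUltrafilterOn U x ∧ ∀ u, u ∈ₐ F → u ∈ₐ U

/-! ### Permutation groups inside a structure -/

/-- `τ = ρ ∘ σ`, as relations. -/
def IsComp (τ ρ σ : M) : Prop := ∀ a c, App τ a c ↔ ∃ b, App σ a b ∧ App ρ b c

/-- `H` is a group of permutations of `A`, i.e. a subgroup of `Aut(A)`. -/
structure IsPermGroup (A H : M) : Prop where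
  isSet : IsSet H
  perm : ∀ π, π ∈ₐ H → IsBij π A A
  one_mem : ∃ e, e ∈ₐ H ∧ ∀ a, a ∈ₐ A → App e a a
  mul_mem : ∀ ρ σ, ρ ∈ₐ H → σ ∈ₐ H → ∃ τ, τ ∈ₐ H ∧ IsComp τ ρ σ
  inv_mem : ∀ ρ, ρ ∈ₐ H → ∃ σ, σ ∈ₐ H ∧ ∀ a b, App σ a b ↔ App ρ b a

/-- `H` is a subgroup of the group `G` of permutations of `A`. -/
def IsSubgroup (A H G : M) : Prop := IsPermGroup A H ∧ IsSubset H G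

/-- `F` is a normal filter of subgroups of `G`. -/
structure IsNormalFilter (A G F : M) : Prop where
  isSet : IsSet F
  subgroup : ∀ K, K ∈ₐ F → IsSubgroup A K G
  top_mem : G ∈ₐ F
  upward : ∀ K H, K ∈ₐ F → IsSubgroup A H G → IsSubset K H → H ∈ₐ F
  inter_mem : ∀ K H, K ∈ₐ F → H ∈ₐ F → ∃ L, IsInter L K H ∧ L ∈ₐ F
  /-- The group `L` is `π K π⁻¹`, the set of the `τ ∈ G` with `τ π = π σ` for some `σ ∈ K`. -/
  conj_mem : ∀ π K, π ∈ₐ G → K ∈ₐ F → ∃ L, L ∈ₐ F ∧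
    ∀ τ, τ ∈ₐ L ↔ τ ∈ₐ G ∧ ∃ σ, σ ∈ₐ K ∧ ∃ ρ, IsComp ρ τ π ∧ IsComp ρ π σ

/-! ### The action on the universe, and permutation models -/

/-- `f` is a function on the transitive set `t` that agrees with `π` on atoms and satisfies
`f(z) = {f(w) | w ∈ z}` for sets `z`. -/
structure IsActionFun (π t f : M) : Prop where
  transitive : IsTransitive t
  total : ∀ z, z ∈ₐ t → ∃! v, App f z v
  atom : ∀ z v, z ∈ₐ t → AtomStr.isAtom z → App f z v → App π z v
  set : ∀ z v, z ∈ₐ t → IsSet z → App f z v →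
    IsSet v ∧ ∀ u, u ∈ₐ v ↔ ∃ w, w ∈ₐ z ∧ App f w u

/-- `π x = y`, for the action of permutations of the atoms on the universe that is given by the
recursion `π x = {π y | y ∈ x}`. -/
def ActsTo (π x y : M) : Prop := ∃ t f, IsActionFun π t f ∧ x ∈ₐ t ∧ App f x y

/-- `x` is `F`-symmetric: the group `sym_G(x) = {π ∈ G | π x = x}` belongs to `F`. -/
def IsSymmetric (G F x : M) : Prop := ∃ H, H ∈ₐ F ∧ ∀ π, π ∈ₐ H ↔ π ∈ₐ G ∧ ActsTo π x x

/-- `x` is hereditarily `F`-symmetric: it belongs to a transitive set all of whose elements are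
`F`-symmetric; that is, `x` and all elements of its transitive closure are `F`-symmetric. -/
def IsHereditarilySymmetric (G F x : M) : Prop :=
  ∃ t, IsTransitive t ∧ x ∈ₐ t ∧ ∀ z, z ∈ₐ t → IsSymmetric G F z

/-- The permutation model given by `G` and `F`: the hereditarily `F`-symmetric elements of `M`. -/
def PermModel (G F : M) : Type u := {x : M // IsHereditarilySymmetric G F x}

instance permModelStr (G F : M) : AtomStr (PermModel G F) where
  mem x y := x.1 ∈ₐ y.1
  isAtom x := AtomStr.isAtom x.1

/-- The filter extension property of the permutation model given by `G` and `F`: there is a base `B`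
of `F` such that whenever `K ∈ B`, and `Φ, x, y` in the permutation model are such that `K` is
contained in `sym_G(Φ) ∩ sym_G(x)`, and in the permutation model `Φ ⊆ 2^x` has the FIP and `y ⊆ x`,
there are `y' ∈ {y, x ∖ y}` and `w = Φ ∪ Orb(y', K)` in the permutation model such that it satisfies
"`w ⊆ 2^x` has the FIP". -/
def FilterExtensionProperty (G F : M) : Prop :=
  ∃ B : M, IsSubset B F ∧ (∀ H, H ∈ₐ F → ∃ K, K ∈ₐ B ∧ IsSubset K H) ∧
    ∀ K, K ∈ₐ B → ∀ Φ x y : PermModel G F,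
      (∀ π, π ∈ₐ K → π ∈ₐ G ∧ ActsTo π Φ.1 Φ.1 ∧ ActsTo π x.1 x.1) →
      HasFIP Φ x → IsSubset y x →
      ∃ y' : PermModel G F, (y' = y ∨ IsDiff y' x y) ∧
        ∃ w : PermModel G F,
          (∀ z : M, z ∈ₐ w.1 ↔ z ∈ₐ Φ.1 ∨ ∃ π, π ∈ₐ K ∧ ActsTo π y'.1 z) ∧ HasFIP w x

end Basic

end ZFA

/-!
The filter extension property of a permutation model `N` of a model `M` of `ZFCA` is equivalent to
`N ⊨ BPI`.

Suppose the filter extension property, and let a filter on `x` be given in `N`. If it has a finite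
element, then it is included in a principal ultrafilter. Otherwise it has the finite intersection
property, and is fixed by a member `K` of the base. Zorn's lemma in `M` gives a maximal `K`-fixed
family in `N` above it with the finite intersection property. By the filter extension property, such
a family contains `y` or `x ∖ y` for each `y ⊆ x` in `N`, hence is an ultrafilter
(`bpi_of_filterExtensionProperty`).

Suppose `N ⊨ BPI`. Call a group `K` in the normal filter good if all `K`-fixed filters in `N` extend
to `K`-fixed ultrafilters in `N` (`IsGood`). Good groups satisfy the condition in the filter extension
property, since one may extend the filter generated by `Φ` and the cofinite sets
(`IsGood.extension`). They form a base (`exists_isGood_subset`): collection gives a set `T` of filters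
that contains counterexamples for all groups that are not good. It may be taken to be invariant under
the whole group, and so belongs to `N`. On the set of finite partial functions `p` that choose points
`p(Φ)` for `Φ ∈ T`, consider in `N` an ultrafilter `V` that contains `{p | p(Φ) ∈ u}` whenever
`u ∈ Φ ∈ T`. The sets `u` with `{p | p(Φ) ∈ u} ∈ V` form an ultrafilter above `Φ`, which is fixed by
every group that fixes `V` and `Φ`. Hence all subgroups of the stabilizer of `V` are good.

As `M` is an arbitrary first-order structure, possibly ill-founded, all of this takes place inside
`M`: induction, recursion, finiteness, Zorn's lemma and collection are developed from the axioms, for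
definable classes only. Definability is proved by instance search (`Dfn`, `DF`). The same instances
show that what is definable from elements fixed by an automorphism is fixed (`Aut.fixed`). Since the
group and the normal filter are themselves fixed by the action of the group, this gives most of the
symmetry statements.
-/

set_option linter.unusedSectionVars false
set_option synthInstance.maxHeartbeats 400000
set_option synthInstance.maxSize 4000

namespace ZFA

/-! ### Definability by instance inference -/

/-- Contexts: types of finite tuples of elements of `M`. -/
class Ctx (M : outParam (Type u)) (Γ : Type u) where
  /-- The index type of the tuples. -/
  ι : Type
  finite : Finite ι
  /-- The components of a tuple. -/
  get : Γ → ι → M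

/-- The empty context. -/
inductive Nil (M : Type u) : Type u
  | nil : Nil M

instance (M : Type u) : Ctx M (Nil M) := ⟨Empty, inferInstance, fun _ i => i.elim⟩

instance (M Γ : Type u) [c : Ctx M Γ] : Ctx M (Γ × M) :=
  ⟨Option c.ι, have := c.finite; inferInstance, fun p i => i.elim p.2 (c.get p.1)⟩

section Definability

variable {M : Type u} [AtomStr M] {Γ Δ : Type u} [c : Ctx M Γ] [Ctx M Δ] {A : Set M}

/-- `P` is first-order definable with parameters in `A`, as a predicate on the context `Γ`.
Quantifiers extend the context: `fun p => ∃ a, Q p a` is reduced to `fun q : Γ × M => Q q.1 q.2`, and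
instance search takes a predicate apart in this way. The parameter set matters, since definability
from all of `M` gives separation and replacement, and definability from the elements fixed by an
automorphism gives invariance under it. -/
class Dfn (A : Set M) (P : Γ → Prop) : Prop where
  out : ∃ S : Set (c.ι → M), A.Definable setLang S ∧ ∀ p, P p ↔ c.get p ∈ S

/-- The function `t` on the context `Γ` has a definable graph. -/
class DF (A : Set M) (t : Γ → M) : Prop where
  out : Dfn A fun q : Γ × M => t q.1 = q.2

/-- `a` is one of the parameters in `A`. -/
class InPar (A : Set M) (a : M) : Prop where
  out : a ∈ A

instance inPar_univ (a : M) : InPar Set.univ a := ⟨trivial⟩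

/-- `f` forgets some of the last components of a tuple. -/
class Proj {Θ : Type u} (f : Γ → Θ) [d : Ctx M Θ] : Prop where
  out : ∃ e : d.ι → c.ι, ∀ p i, d.get (f p) i = c.get p (e i)

instance proj_id : Proj (fun p : Γ => p) := ⟨id, fun _ _ => rfl⟩

instance proj_fst (f : Γ → Δ × M) [h : Proj f] : Proj (fun p => (f p).1) := by
  obtain ⟨e, he⟩ := h.out
  exact ⟨fun i => e (some i), fun p i => he p (some i)⟩

theorem Dfn.congr {P Q : Γ → Prop} (h : Dfn A P) (e : ∀ p, Q p ↔ P p) : Dfn A Q := by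
  have : Q = P := funext fun p => propext (e p)
  rwa [this]

theorem Dfn.proj {P : Δ → Prop} (h : Dfn A P) (f : Γ → Δ) [hf : Proj f] :
    Dfn A fun p => P (f p) := by
  obtain ⟨S, hS, hP⟩ := h.out
  obtain ⟨e, he⟩ := hf.out
  refine ⟨_, hS.preimage_comp e, fun p => ?_⟩
  rw [hP]
  have : Ctx.get (f p) = c.get p ∘ e := funext fun i => he p i
  rw [this]; rfl

instance dfn_and (P Q : Γ → Prop) [hP : Dfn A P] [hQ : Dfn A Q] : Dfn A fun p => P p ∧ Q p := by
  obtain ⟨S, hS, h⟩ := hP.out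
  obtain ⟨T, hT, h'⟩ := hQ.out
  exact ⟨_, hS.inter hT, fun p => by rw [h, h']; rfl⟩

instance dfn_not (P : Γ → Prop) [hP : Dfn A P] : Dfn A fun p => ¬ P p := by
  obtain ⟨S, hS, h⟩ := hP.out
  exact ⟨_, hS.compl, fun p => by rw [h]; rfl⟩

instance dfn_or (P Q : Γ → Prop) [Dfn A P] [Dfn A Q] : Dfn A fun p => P p ∨ Q p :=
  (inferInstance : Dfn A fun p => ¬ (¬ P p ∧ ¬ Q p)).congr fun _ => by tauto

instance dfn_imp (P Q : Γ → Prop) [Dfn A P] [Dfn A Q] : Dfn A fun p => P p → Q p :=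
  (inferInstance : Dfn A fun p => ¬ P p ∨ Q p).congr fun _ => by tauto

instance dfn_iff (P Q : Γ → Prop) [Dfn A P] [Dfn A Q] : Dfn A fun p => (P p ↔ Q p) :=
  (inferInstance : Dfn A fun p => (P p → Q p) ∧ (Q p → P p)).congr fun _ => iff_def

instance dfn_exists (P : Γ → M → Prop) [hP : Dfn A fun q : Γ × M => P q.1 q.2] :
    Dfn A fun p => ∃ a, P p a := by
  obtain ⟨S, hS, h⟩ := hP.out
  have := c.finite
  have : Finite (Ctx.ι (Γ × M)) := inferInstanceAs (Finite (Option c.ι))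
  refine ⟨_, hS.image_comp (some : c.ι → Option c.ι), fun p => ⟨?_, ?_⟩⟩
  · rintro ⟨a, ha⟩
    exact ⟨_, (h (p, a)).1 ha, rfl⟩
  · rintro ⟨v, hv, e⟩
    refine ⟨v none, (h (p, v none)).2 ?_⟩
    convert hv using 1
    funext i
    cases i with
    | none => rfl
    | some i => exact (congrFun e i).symm

instance dfn_forall (P : Γ → M → Prop) [Dfn A fun q : Γ × M => P q.1 q.2] :
    Dfn A fun p => ∀ a, P p a :=
  (inferInstance : Dfn A fun p => ¬ ∃ a, ¬ P p a).congr fun _ => by simp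


/-- A map of contexts, applied below a quantifier. -/
theorem proj_lift (f : Γ → Δ) [hf : Proj f] : Proj fun q : Γ × M => (f q.1, q.2) := by
  obtain ⟨e, he⟩ := hf.out
  refine ⟨fun i => i.map e, fun p i => ?_⟩
  cases i with
  | none => rfl
  | some i => exact he p.1 i

/-- Substitution of a definable function for the last variable of a definable predicate. -/
theorem Dfn.subst {P : Γ → M → Prop} (h : Dfn A fun q : Γ × M => P q.1 q.2) (f : Δ → Γ) [Proj f]
    (t : Δ → M) [ht : DF A t] : Dfn A fun p => P (f p) (t p) := by
  have := proj_lift f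
  have h1 : Dfn A fun q : Δ × M => P (f q.1) q.2 := h.proj fun q : Δ × M => (f q.1, q.2)
  have h2 := ht.out
  exact (inferInstance : Dfn A fun p => ∃ a, t p = a ∧ P (f p) a).congr fun p => by simp

theorem definable_coord {α : Type} (A : Set M) (φ : setLang.Formula α) :
    A.Definable setLang {v : α → M | φ.Realize v} :=
  (Set.empty_definable_iff.2 ⟨φ, rfl⟩).mono (Set.empty_subset A)

open FirstOrder in
theorem dfn_mem_coord (i j : c.ι) : Dfn A fun p => c.get p i ∈ₐ c.get p j := by
  refine ⟨_, definable_coord A (Language.Relations.formula₂ (L := setLang) AtomRel.mem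
    (Language.Term.var i) (Language.Term.var j)), fun p => ?_⟩
  rfl

open FirstOrder in
theorem dfn_atom_coord (i : c.ι) : Dfn A fun p => AtomStr.isAtom (c.get p i) := by
  refine ⟨_, definable_coord A (Language.Relations.formula₁ (L := setLang) AtomRel.atom
    (Language.Term.var i)), fun p => ?_⟩
  rfl

open FirstOrder in
theorem dfn_eq_coord (i j : c.ι) : Dfn A fun p => c.get p i = c.get p j := by
  refine ⟨_, definable_coord A (Language.Term.equal (L := setLang)
    (Language.Term.var i) (Language.Term.var j)), fun p => ?_⟩
  simp

open FirstOrder in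
theorem dfn_eq_const (i : c.ι) (a : M) [h : InPar A a] : Dfn A fun p => a = c.get p i := by
  refine ⟨{v | a = v i}, ⟨Language.Term.equal ((setLang.con (⟨a, h.out⟩ : A)).term)
    (Language.Term.var i), ?_⟩, fun p => Iff.rfl⟩
  ext v
  simp

instance (priority := high) df_const (a : M) [InPar A a] : DF A fun _ : Γ => a :=
  ⟨dfn_eq_const (Γ := Γ × M) none a⟩

instance df_var (f : Γ → Δ × M) [hf : Proj f] : DF A fun p => (f p).2 := by
  obtain ⟨e, he⟩ := hf.out
  refine ⟨(dfn_eq_coord (Γ := Γ × M) (some (e none)) none).congr fun q => ?_⟩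
  have := he q.1 none
  exact (congrArg (· = q.2) this).to_iff

theorem dfn_subst₁ {R : M → Prop} (s : Γ → M) [hs : DF A s]
    (h : Dfn A fun q : Γ × M => R q.2) : Dfn A fun p => R (s p) :=
  h.subst (P := fun _ a => R a) (fun p => p) s

theorem DF.lift {s : Γ → M} (h : DF A s) : DF A fun q : Γ × M => s q.1 := by
  have := proj_lift fun q : Γ × M => q.1
  exact ⟨h.out.proj fun q : (Γ × M) × M => (q.1.1, q.2)⟩

theorem dfn_subst₂ {R : M → M → Prop} (s t : Γ → M) [hs : DF A s] [ht : DF A t]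
    (h : Dfn A fun q : (Γ × M) × M => R q.1.2 q.2) : Dfn A fun p => R (s p) (t p) := by
  have := ht.lift
  have h1 : Dfn A fun q : Γ × M => R q.2 (t q.1) :=
    h.subst (Γ := Γ × M) (P := fun q a => R q.2 a) (fun p => p) fun q => t q.1
  exact h1.subst (P := fun p a => R a (t p)) (fun p => p) s

theorem dfn_subst₃ {R : M → M → M → Prop} (s t r : Γ → M) [hs : DF A s] [ht : DF A t]
    [hr : DF A r] (h : Dfn A fun q : ((Γ × M) × M) × M => R q.1.1.2 q.1.2 q.2) :
    Dfn A fun p => R (s p) (t p) (r p) := by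
  have := hr.lift.lift
  have h1 : Dfn A fun q : (Γ × M) × M => R q.1.2 q.2 (r q.1.1) :=
    h.subst (Γ := (Γ × M) × M) (P := fun q a => R q.1.2 q.2 a) (fun p => p) fun q => r q.1.1
  have := ht.lift
  have h2 : Dfn A fun q : Γ × M => R q.2 (t q.1) (r q.1) :=
    h1.subst (Γ := Γ × M) (P := fun q a => R q.2 a (r q.1)) (fun p => p) fun q => t q.1
  exact h2.subst (P := fun p a => R a (t p) (r p)) (fun p => p) s

instance dfn_mem (s t : Γ → M) [DF A s] [DF A t] : Dfn A fun p => s p ∈ₐ t p :=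
  dfn_subst₂ s t (dfn_mem_coord (Γ := (Γ × M) × M) (some none) none)

instance dfn_eq (s t : Γ → M) [DF A s] [DF A t] : Dfn A fun p => s p = t p :=
  dfn_subst₂ s t (dfn_eq_coord (Γ := (Γ × M) × M) (some none) none)

instance dfn_existsUnique (P : Γ → M → Prop) [h : Dfn A fun q : Γ × M => P q.1 q.2] :
    Dfn A fun p => ∃! a, P p a := by
  have : Dfn A fun q : (Γ × M) × M => P q.1.1 q.2 := by
    have := proj_lift fun q : Γ × M => q.1
    exact h.proj fun q : (Γ × M) × M => (q.1.1, q.2)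
  exact (inferInstance : Dfn A fun p => ∃ a, P p a ∧ ∀ b, P p b → b = a)

instance dfn_atom (s : Γ → M) [hs : DF A s] : Dfn A fun p => AtomStr.isAtom (s p) := by
  have h1 := hs.out
  have h2 := dfn_atom_coord (A := A) (Γ := Γ × M) none
  have h3 : Dfn A fun q : Γ × M => AtomStr.isAtom q.2 := h2
  exact (inferInstance : Dfn A fun p => ∃ a, s p = a ∧ AtomStr.isAtom a).congr fun p => by simp

theorem Dfn.definableClass {P : M → Prop} (h : Dfn Set.univ fun q : Nil M × M => P q.2) :
    DefinableClass P := by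
  obtain ⟨S, hS, hP⟩ := h.out
  have := hS.preimage_comp (fun _ : Option Empty => (0 : Fin 1))
  unfold DefinableClass Set.Definable₁
  convert this using 1
  ext v
  refine (hP (Nil.nil, v 0)).trans ?_
  have : Ctx.get ((Nil.nil, v 0) : Nil M × M) = v ∘ fun _ : Option Empty => (0 : Fin 1) := by
    funext i
    rcases i with _ | i
    · rfl
    · exact i.elim
  rw [this]; rfl

theorem Dfn.definableRel {R : M → M → Prop}
    (h : Dfn Set.univ fun q : (Nil M × M) × M => R q.1.2 q.2) : DefinableRel R := by
  obtain ⟨S, hS, hP⟩ := h.out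
  let e : Option (Option Empty) → Fin 2 := fun i => i.elim 1 fun _ => 0
  have := hS.preimage_comp e
  unfold DefinableRel Set.Definable₂
  convert this using 1
  ext v
  refine (hP ((Nil.nil, v 0), v 1)).trans ?_
  have : Ctx.get (((Nil.nil, v 0), v 1) : (Nil M × M) × M) = v ∘ e := by
    funext i
    rcases i with _ | _ | i
    · rfl
    · rfl
    · exact i.elim
  rw [this]; rfl

/-! ### Automorphisms -/

/-- Automorphisms of a structure for the language of set theory with atoms. -/
structure Aut (M : Type u) [AtomStr M] extends M ≃ M where
  mem_iff : ∀ x y, toFun x ∈ₐ toFun y ↔ x ∈ₐ y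
  atom_iff : ∀ x, AtomStr.isAtom (toFun x) ↔ AtomStr.isAtom x

/-- The elements that are fixed by an automorphism. -/
def Aut.fix (σ : Aut M) : Set M := {x | σ.toEquiv x = x}

open FirstOrder in
/-- Predicates that are definable with parameters fixed by `σ` are invariant under `σ`. -/
theorem Aut.definable_iff (σ : Aut M) {α : Type} {S : Set (α → M)}
    (hS : σ.fix.Definable setLang S) (v : α → M) : σ.toEquiv ∘ v ∈ S ↔ v ∈ S := by
  obtain ⟨φ, rfl⟩ := Set.definable_iff_exists_formula_sum.1 hS
  let g : M ≃[setLang] M :=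
    { σ.toEquiv with
      map_fun' := fun f => nomatch f
      map_rel' := fun r v => by
        cases r with
        | mem => exact σ.mem_iff _ _
        | atom => exact σ.atom_iff _ }
  have : (Sum.elim (fun a : σ.fix => (a : M)) (σ.toEquiv ∘ v)) = g ∘ Sum.elim (fun a : σ.fix => (a : M)) v := by
    funext i
    rcases i with i | i
    · exact i.2.symm
    · rfl
  change φ.Realize _ ↔ φ.Realize _
  rw [this]
  exact Language.StrongHomClass.realize_formula g φ

theorem Aut.dfn_iff (σ : Aut M) {P : M → Prop} [h : Dfn σ.fix fun q : Nil M × M => P q.2] (x : M) :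
    P (σ.toEquiv x) ↔ P x := by
  obtain ⟨S, hS, hP⟩ := h.out
  refine (hP (Nil.nil, σ.toEquiv x)).trans (Iff.trans ?_ (hP (Nil.nil, x)).symm)
  have : Ctx.get ((Nil.nil, σ.toEquiv x) : Nil M × M) = σ.toEquiv ∘ Ctx.get ((Nil.nil, x) : Nil M × M) := by
    funext i
    rcases i with _ | i
    · rfl
    · exact i.elim
  rw [this, σ.definable_iff hS]

/-- Elements that are definable from parameters fixed by `σ` are fixed by `σ`. -/
theorem Aut.fixed (σ : Aut M) (a : M) [h : DF σ.fix fun _ : Nil M => a] : σ.toEquiv a = a := by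
  have := h.out
  exact ((σ.dfn_iff (P := fun x => a = x) a).2 rfl).symm

end Definability

/-! ### Basic set operations -/

/-- `M` is a model of `ZFCA`. -/
class IsZFCA (M : Type u) [AtomStr M] : Prop where
  out : ∃ A : M, IsModelZFCA A

section Predicates

variable {M : Type u} [AtomStr M] {Γ : Type u} [c : Ctx M Γ] {A : Set M}
  (s t r : Γ → M) [DF A s] [DF A t] [DF A r]

instance dfn_isSet : Dfn A fun p => IsSet (s p) := by
  refine dfn_subst₁ (R := IsSet) s ?_
  unfold IsSet; infer_instance
instance dfn_isSubset : Dfn A fun p => IsSubset (s p) (t p) := by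
  refine dfn_subst₂ (R := IsSubset) s t ?_
  unfold IsSubset; infer_instance
instance dfn_isEmptySet : Dfn A fun p => IsEmptySet (s p) := by
  refine dfn_subst₁ (R := IsEmptySet) s ?_
  unfold IsEmptySet; infer_instance
instance dfn_isUPair : Dfn A fun p => IsUPair (s p) (t p) (r p) := by
  refine dfn_subst₃ (R := IsUPair) s t r ?_
  unfold IsUPair; infer_instance
instance dfn_isPair : Dfn A fun p => IsPair (s p) (t p) (r p) := by
  refine dfn_subst₃ (R := IsPair) s t r ?_
  unfold IsPair; infer_instance
instance dfn_isSucc : Dfn A fun p => IsSucc (s p) (t p) := by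
  refine dfn_subst₂ (R := IsSucc) s t ?_
  unfold IsSucc; infer_instance
instance dfn_isInductive : Dfn A fun p => IsInductive (s p) := by
  refine dfn_subst₁ (R := IsInductive) s ?_
  unfold IsInductive; infer_instance
instance dfn_isNat : Dfn A fun p => IsNat (s p) := by
  refine dfn_subst₁ (R := IsNat) s ?_
  unfold IsNat; infer_instance
instance dfn_app : Dfn A fun p => App (s p) (t p) (r p) := by
  refine dfn_subst₃ (R := App) s t r ?_
  unfold App; infer_instance

theorem isBij_iff (f x y : M) : IsBij f x y ↔ IsSet f ∧
    (∀ p, p ∈ₐ f → ∃ a b, a ∈ₐ x ∧ b ∈ₐ y ∧ IsPair p a b) ∧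
    (∀ a, a ∈ₐ x → ∃! b, App f a b) ∧ ∀ b, b ∈ₐ y → ∃! a, App f a b :=
  ⟨fun h => ⟨h.1, h.2, h.3, h.4⟩, fun h => ⟨h.1, h.2.1, h.2.2.1, h.2.2.2⟩⟩

instance dfn_isBij : Dfn A fun p => IsBij (s p) (t p) (r p) := by
  refine dfn_subst₃ (R := IsBij) s t r ?_
  simp only [isBij_iff]; infer_instance
instance dfn_isFinite : Dfn A fun p => IsFinite (s p) := by
  refine dfn_subst₁ (R := IsFinite) s ?_
  unfold IsFinite; infer_instance
instance dfn_isTransitive : Dfn A fun p => IsTransitive (s p) := by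
  refine dfn_subst₁ (R := IsTransitive) s ?_
  unfold IsTransitive; infer_instance
theorem hasFIP_iff (F x : M) : HasFIP F x ↔ IsSet x ∧ IsSet F ∧ (∀ u, u ∈ₐ F → IsSubset u x) ∧
    ∀ s, IsSubset s F → IsFinite s →
      ∃ i, IsSet i ∧ (∀ z, z ∈ₐ i ↔ z ∈ₐ x ∧ ∀ u, u ∈ₐ s → z ∈ₐ u) ∧ ¬ IsFinite i :=
  ⟨fun h => ⟨h.1, h.2, h.3, h.4⟩, fun h => ⟨h.1, h.2.1, h.2.2.1, h.2.2.2⟩⟩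

instance dfn_hasFIP : Dfn A fun p => HasFIP (s p) (t p) := by
  refine dfn_subst₂ (R := HasFIP) s t ?_
  simp only [hasFIP_iff]; infer_instance

theorem isActionFun_iff (π t f : M) : IsActionFun π t f ↔ IsTransitive t ∧
    (∀ z, z ∈ₐ t → ∃! v, App f z v) ∧
    (∀ z v, z ∈ₐ t → AtomStr.isAtom z → App f z v → App π z v) ∧
    ∀ z v, z ∈ₐ t → IsSet z → App f z v → IsSet v ∧ ∀ u, u ∈ₐ v ↔ ∃ w, w ∈ₐ z ∧ App f w u :=
  ⟨fun h => ⟨h.1, h.2, h.3, h.4⟩, fun h => ⟨h.1, h.2.1, h.2.2.1, h.2.2.2⟩⟩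

instance dfn_actsTo : Dfn A fun p => ActsTo (s p) (t p) (r p) := by
  refine dfn_subst₃ (R := ActsTo) s t r ?_
  simp only [ActsTo, isActionFun_iff]; infer_instance
instance dfn_isSymmetric : Dfn A fun p => IsSymmetric (s p) (t p) (r p) := by
  refine dfn_subst₃ (R := IsSymmetric) s t r ?_
  unfold IsSymmetric; infer_instance
instance dfn_hereditarily : Dfn A fun p => IsHereditarilySymmetric (s p) (t p) (r p) := by
  refine dfn_subst₃ (R := IsHereditarilySymmetric) s t r ?_
  unfold IsHereditarilySymmetric; infer_instance

end Predicates

variable {M : Type u} [AtomStr M] [hM : IsZFCA M]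

theorem ext_iff' {x y : M} (hx : IsSet x) (hy : IsSet y) (h : ∀ z, z ∈ₐ x ↔ z ∈ₐ y) : x = y :=
  hM.out.choose_spec.ext x y hx hy h

theorem isSet_of_mem {x z : M} (h : z ∈ₐ x) : IsSet x :=
  fun hx => hM.out.choose_spec.atom_no_mem x hx z h

theorem isEmptySet_unique {x y : M} (hx : IsEmptySet x) (hy : IsEmptySet y) : x = y :=
  ext_iff' hx.1 hy.1 fun z => iff_of_false (hx.2 z) (hy.2 z)

variable (M) in
theorem exists_empty : ∃ e : M, IsEmptySet e := hM.out.choose_spec.empty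

/-- The empty set. -/
noncomputable def emp : M := (exists_empty M).choose

theorem emp_spec : IsEmptySet (emp : M) := (exists_empty M).choose_spec

@[simp] theorem not_mem_emp (z : M) : ¬ z ∈ₐ emp := emp_spec.2 z
@[simp] theorem isSet_emp : IsSet (emp : M) := emp_spec.1

theorem eq_emp {x : M} (hx : IsSet x) (h : ∀ z, ¬ z ∈ₐ x) : x = emp :=
  isEmptySet_unique ⟨hx, h⟩ emp_spec

open Classical in
/-- The unique element that satisfies `R`; the empty set if there is no such element, or if there
are several. -/
noncomputable def theU (R : M → Prop) : M := if h : ∃! y, R y then h.choose else emp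

theorem theU_spec {R : M → Prop} (h : ∃! y, R y) : R (theU R) := by
  rw [theU, dif_pos h]; exact h.choose_spec.1

theorem theU_eq {R : M → Prop} {y : M} (hy : R y) (h : ∀ z, R z → z = y) : theU R = y :=
  h _ (theU_spec ⟨y, hy, h⟩)

theorem theU_eq_iff (R : M → Prop) (y : M) :
    theU R = y ↔ (R y ∧ ∀ z, R z → z = y) ∨ ((¬ ∃! z, R z) ∧ IsEmptySet y) := by
  constructor
  · rintro rfl
    by_cases h : ∃! z, R z
    · exact Or.inl ⟨theU_spec h, fun z hz => h.unique hz (theU_spec h)⟩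
    · refine Or.inr ⟨h, ?_⟩
      rw [theU, dif_neg h]; exact emp_spec
  · rintro (⟨h, h'⟩ | ⟨h, h'⟩)
    · exact theU_eq h h'
    · rw [theU, dif_neg h]; exact isEmptySet_unique emp_spec h'

section Inst

variable {Γ Δ : Type u} [c : Ctx M Γ] [Ctx M Δ] {A : Set M}

theorem DF.proj {s : Δ → M} (h : DF A s) (f : Γ → Δ) [Proj f] : DF A fun p => s (f p) := by
  have := proj_lift (M := M) f
  exact ⟨h.out.proj fun q : Γ × M => (f q.1, q.2)⟩

theorem DF.subst {f : Γ → M → M} (h : DF A fun q : Γ × M => f q.1 q.2)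
    (t : Γ → M) [ht : DF A t] : DF A fun p => f p (t p) := by
  have h1 : Dfn A fun q : (Γ × M) × M => f q.1.1 q.1.2 = q.2 := h.out
  have : Proj fun q : (Γ × M) × M => ((q.1.1, q.2), q.1.2) := by
    refine ⟨fun i => match i with
      | none => some none
      | some none => none
      | some (some j) => some (some j), fun p i => ?_⟩
    match i with
    | none => rfl
    | some none => rfl
    | some (some j) => rfl
  have h2 := h1.proj fun q : (Γ × M) × M => ((q.1.1, q.2), q.1.2)
  have := ht.lift
  exact ⟨h2.subst (Γ := Γ × M) (P := fun q a => f q.1 a = q.2) (fun p => p) fun q => t q.1⟩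

theorem df_subst₁ {f : M → M} (s : Γ → M) [DF A s]
    (h : DF A fun q : Γ × M => f q.2) : DF A fun p => f (s p) :=
  h.subst (f := fun _ a => f a) s

theorem df_subst₂ {f : M → M → M} (s t : Γ → M) [hs : DF A s] [ht : DF A t]
    (h : DF A fun q : (Γ × M) × M => f q.1.2 q.2) : DF A fun p => f (s p) (t p) := by
  have := ht.lift
  have h1 : DF A fun q : Γ × M => f q.2 (t q.1) :=
    h.subst (Γ := Γ × M) (f := fun q a => f q.2 a) fun q => t q.1
  exact h1.subst (f := fun p a => f a (t p)) s

instance proj_nil : Proj fun _ : Γ => (Nil.nil : Nil M) := ⟨fun i => i.elim, fun _ i => i.elim⟩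

theorem Dfn.comp₁ {P : M → Prop} (h : Dfn A fun q : Nil M × M => P q.2) (s : Γ → M) [DF A s] :
    Dfn A fun p => P (s p) :=
  h.subst (P := fun _ a => P a) (fun _ => Nil.nil) s

theorem Dfn.comp₂ {R : M → M → Prop} (h : Dfn A fun q : (Nil M × M) × M => R q.1.2 q.2)
    (s t : Γ → M) [DF A s] [DF A t] : Dfn A fun p => R (s p) (t p) := by
  refine dfn_subst₂ s t ?_
  have := proj_lift (M := M) fun _ : Γ => (Nil.nil : Nil M)
  have := proj_lift (M := M) fun q : Γ × M => ((Nil.nil : Nil M), q.2)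
  exact h.proj fun q : (Γ × M) × M => ((Nil.nil, q.1.2), q.2)

theorem DF.comp₁ {f : M → M} (h : DF A fun q : Nil M × M => f q.2) (s : Γ → M) [DF A s] :
    DF A fun p => f (s p) := by
  refine df_subst₁ s ?_
  have := proj_lift (M := M) fun _ : Γ => (Nil.nil : Nil M)
  exact h.proj fun q : Γ × M => (Nil.nil, q.2)

theorem DF.comp₂ {f : M → M → M} (h : DF A fun q : (Nil M × M) × M => f q.1.2 q.2)
    (s t : Γ → M) [DF A s] [DF A t] : DF A fun p => f (s p) (t p) := by
  refine df_subst₂ s t ?_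
  have := proj_lift (M := M) fun _ : Γ => (Nil.nil : Nil M)
  have := proj_lift (M := M) fun q : Γ × M => ((Nil.nil : Nil M), q.2)
  exact h.proj fun q : (Γ × M) × M => ((Nil.nil, q.1.2), q.2)

instance df_emp : DF A fun _ : Γ => (emp : M) :=
  ⟨(inferInstance : Dfn A fun q : Γ × M => IsEmptySet q.2).congr fun _ =>
    ⟨fun h => h ▸ emp_spec, fun h => isEmptySet_unique emp_spec h⟩⟩

instance df_theU (R : Γ → M → Prop) [h : Dfn A fun q : Γ × M => R q.1 q.2] :
    DF A fun p => theU (R p) := by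
  have h1 : Dfn A fun q : (Γ × M) × M => R q.1.1 q.2 := by
    have := proj_lift fun q : Γ × M => q.1
    exact h.proj fun q : (Γ × M) × M => (q.1.1, q.2)
  exact ⟨(inferInstance : Dfn A fun q : Γ × M => (R q.1 q.2 ∧ ∀ z, R q.1 z → z = q.2) ∨
    ((¬ ∃! z, R q.1 z) ∧ IsEmptySet q.2)).congr fun q => theU_eq_iff _ _⟩

end Inst

theorem theU_set {Q : M → Prop} (h : ∃ y, IsSet y ∧ ∀ z, z ∈ₐ y ↔ Q z) :
    IsSet (theU fun y => IsSet y ∧ ∀ z, z ∈ₐ y ↔ Q z) ∧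
      ∀ z, z ∈ₐ (theU fun y => IsSet y ∧ ∀ z, z ∈ₐ y ↔ Q z) ↔ Q z := by
  obtain ⟨y, hy⟩ := h
  exact theU_spec (R := fun y => IsSet y ∧ ∀ z, z ∈ₐ y ↔ Q z)
    ⟨y, hy, fun z hz => ext_iff' hz.1 hy.1 fun w => (hz.2 w).trans (hy.2 w).symm⟩

/-- `{z ∈ x | P z}`. -/
noncomputable def sep (x : M) (P : M → Prop) : M :=
  theU fun y => IsSet y ∧ ∀ z, z ∈ₐ y ↔ z ∈ₐ x ∧ P z

section
variable (x : M) (P : M → Prop) [h : Dfn Set.univ fun q : Nil M × M => P q.2]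
include h
theorem sep_spec : IsSet (sep x P) ∧ ∀ z, z ∈ₐ sep x P ↔ z ∈ₐ x ∧ P z :=
  theU_set (hM.out.choose_spec.separation P h.definableClass x)
@[simp] theorem isSet_sep : IsSet (sep x P) := (sep_spec x P).1
@[simp] theorem mem_sep {z : M} : z ∈ₐ sep x P ↔ z ∈ₐ x ∧ P z := (sep_spec x P).2 z
end

/-- `⋃ x`. -/
noncomputable def sUn (x : M) : M := theU fun y => IsSet y ∧ ∀ z, z ∈ₐ y ↔ ∃ w, w ∈ₐ x ∧ z ∈ₐ w

@[simp] theorem isSet_sUn (x : M) : IsSet (sUn x) := (theU_set (hM.out.choose_spec.union x)).1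
@[simp] theorem mem_sUn {x z : M} : z ∈ₐ sUn x ↔ ∃ w, w ∈ₐ x ∧ z ∈ₐ w :=
  (theU_set (hM.out.choose_spec.union x)).2 z

/-- The power set of `x`. -/
noncomputable def pow (x : M) : M := theU fun y => IsSet y ∧ ∀ z, z ∈ₐ y ↔ IsSubset z x

@[simp] theorem mem_pow {x z : M} : z ∈ₐ pow x ↔ IsSubset z x :=
  (theU_set (hM.out.choose_spec.powerset x)).2 z

/-- `{a, b}`. -/
noncomputable def upair (a b : M) : M := theU fun y => IsSet y ∧ ∀ z, z ∈ₐ y ↔ z = a ∨ z = b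

@[simp] theorem isSet_upair (a b : M) : IsSet (upair a b) :=
  (theU_set (hM.out.choose_spec.pairing a b)).1
@[simp] theorem mem_upair {a b z : M} : z ∈ₐ upair a b ↔ z = a ∨ z = b :=
  (theU_set (hM.out.choose_spec.pairing a b)).2 z

theorem isUPair_iff {p a b : M} : IsUPair p a b ↔ p = upair a b :=
  ⟨fun h => ext_iff' h.1 (isSet_upair a b) fun z => (h.2 z).trans mem_upair.symm,
    fun h => h ▸ ⟨isSet_upair a b, fun _ => mem_upair⟩⟩

/-- `(a, b)`. -/
noncomputable def pair (a b : M) : M := upair (upair a a) (upair a b)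

theorem isPair_iff {p a b : M} : IsPair p a b ↔ p = pair a b := by
  simp only [IsPair, isUPair_iff, pair]
  exact ⟨fun ⟨s, d, hs, hd, h⟩ => by rw [h, hs, hd], fun h => ⟨_, _, rfl, rfl, h⟩⟩

theorem upair_inj_right {a b c : M} (h : upair a b = upair a c) : b = c := by
  have h1 : b ∈ₐ upair a c := h ▸ mem_upair.2 (Or.inr rfl)
  have h2 : c ∈ₐ upair a b := h ▸ mem_upair.2 (Or.inr rfl)
  rw [mem_upair] at h1 h2
  rcases h1 with h1 | h1
  · rcases h2 with h2 | h2
    · rw [h1, h2]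
    · exact h2.symm
  · exact h1

@[simp] theorem pair_inj {a b c d : M} : pair a b = pair c d ↔ a = c ∧ b = d := by
  constructor
  · intro h
    have hac : a = c := by
      have h1 : upair c c ∈ₐ pair a b := by rw [h]; exact mem_upair.2 (Or.inl rfl)
      have h2 : a ∈ₐ upair c c := by
        rcases mem_upair.1 h1 with h1 | h1 <;> rw [h1] <;> exact mem_upair.2 (Or.inl rfl)
      rcases mem_upair.1 h2 with h2 | h2 <;> exact h2
    subst hac
    exact ⟨rfl, upair_inj_right (upair_inj_right h)⟩
  · rintro ⟨rfl, rfl⟩; rfl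

theorem app_iff {f a b : M} : App f a b ↔ pair a b ∈ₐ f := by
  simp only [App, isPair_iff]
  exact ⟨fun ⟨p, h, e⟩ => e ▸ h, fun h => ⟨_, h, rfl⟩⟩

/-- `x ∪ y`. -/
noncomputable def cup (x y : M) : M := sUn (upair x y)

@[simp] theorem isSet_cup (x y : M) : IsSet (cup x y) := isSet_sUn _
@[simp] theorem mem_cup {x y z : M} : z ∈ₐ cup x y ↔ z ∈ₐ x ∨ z ∈ₐ y := by simp [cup]

/-- `s ∪ {a}`. -/
noncomputable def ins (a s : M) : M := cup s (upair a a)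

@[simp] theorem isSet_ins (a s : M) : IsSet (ins a s) := isSet_cup _ _
@[simp] theorem mem_ins {a s z : M} : z ∈ₐ ins a s ↔ z ∈ₐ s ∨ z = a := by simp [ins]

/-- The set of all `f a` for `a ∈ x`. -/
noncomputable def img (x : M) (f : M → M) : M :=
  theU fun y => IsSet y ∧ ∀ b, b ∈ₐ y ↔ ∃ a, a ∈ₐ x ∧ f a = b

section Inst

variable {Γ : Type u} [c : Ctx M Γ] {A : Set M} (s t : Γ → M) [DF A s] [DF A t]

instance df_sep (P : Γ → M → Prop) [h : Dfn A fun q : Γ × M => P q.1 q.2] :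
    DF A fun p => sep (s p) (P p) := by
  have h1 : Dfn A fun q : ((Γ × M) × M) × M => P q.1.1.1 q.2 :=
    h.subst (fun q : ((Γ × M) × M) × M => q.1.1.1) fun q => q.2
  have h2 : DF A fun q : Γ × M => sep q.2 (P q.1) := by unfold sep; infer_instance
  exact h2.subst (f := fun p a => sep a (P p)) s

instance df_img (f : Γ → M → M) [h : DF A fun q : Γ × M => f q.1 q.2] :
    DF A fun p => img (s p) (f p) := by
  have h0 : Proj fun q : (((Γ × M) × M) × M) × M => (q.1.1.1.1, q.2) := by
    have := proj_lift (M := M) fun q : ((Γ × M) × M) × M => q.1.1.1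
    exact this
  have h1 : DF A fun q : (((Γ × M) × M) × M) × M => f q.1.1.1.1 q.2 :=
    h.proj fun q : (((Γ × M) × M) × M) × M => (q.1.1.1.1, q.2)
  have h2 : DF A fun q : Γ × M => img q.2 (f q.1) := by unfold img; infer_instance
  exact h2.subst (f := fun p a => img a (f p)) s

instance df_sUn : DF A fun p => sUn (s p) := by
  refine df_subst₁ s ?_
  unfold sUn; infer_instance

instance df_pow : DF A fun p => pow (s p) := by
  refine df_subst₁ s ?_
  unfold pow; infer_instance

instance df_upair : DF A fun p => upair (s p) (t p) := by
  refine df_subst₂ s t ?_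
  unfold upair; infer_instance

instance df_pair : DF A fun p => pair (s p) (t p) := by
  unfold pair; infer_instance

instance df_cup : DF A fun p => cup (s p) (t p) := by
  unfold cup; infer_instance

instance df_ins : DF A fun p => ins (s p) (t p) := by
  unfold ins; infer_instance

end Inst

section
variable (x : M) (f : M → M) [h : DF Set.univ fun q : Nil M × M => f q.2]
include h
theorem img_spec : IsSet (img x f) ∧ ∀ b, b ∈ₐ img x f ↔ ∃ a, a ∈ₐ x ∧ f a = b :=
  theU_set (hM.out.choose_spec.replacement (fun a b => f a = b) h.out.definableRel x
    fun _ _ _ _ h h' => h.symm.trans h')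
@[simp] theorem isSet_img : IsSet (img x f) := (img_spec x f).1
@[simp] theorem mem_img {b : M} : b ∈ₐ img x f ↔ ∃ a, a ∈ₐ x ∧ f a = b := (img_spec x f).2 b
end

/-- `f(a)`, for a function `f`. -/
noncomputable def app (f a : M) : M := theU (App f a)

theorem app_eq {f a b : M} (h : App f a b) (h' : ∃! b, App f a b) : app f a = b :=
  theU_eq h fun _ hz => h'.unique hz h

/-- The set of atoms. -/
noncomputable def atoms : M := theU fun y => IsSet y ∧ ∀ z, z ∈ₐ y ↔ AtomStr.isAtom z

@[simp] theorem isSet_atoms : IsSet (atoms : M) :=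
  (theU_set ⟨_, hM.out.choose_spec.atoms_isSet, hM.out.choose_spec.mem_atoms⟩).1
@[simp] theorem mem_atoms {z : M} : z ∈ₐ atoms ↔ AtomStr.isAtom z :=
  (theU_set ⟨_, hM.out.choose_spec.atoms_isSet, hM.out.choose_spec.mem_atoms⟩).2 z

/-- `x × y`. -/
noncomputable def prod (x y : M) : M :=
  sep (pow (pow (cup x y))) fun p => ∃ a, ∃ b, a ∈ₐ x ∧ b ∈ₐ y ∧ p = pair a b

theorem mem_prod {x y p : M} : p ∈ₐ prod x y ↔ ∃ a, ∃ b, a ∈ₐ x ∧ b ∈ₐ y ∧ p = pair a b := by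
  rw [prod, mem_sep, and_iff_right_iff_imp]
  rintro ⟨a, b, ha, hb, rfl⟩
  simp only [mem_pow, pair]
  refine ⟨isSet_upair _ _, fun z hz => ?_⟩
  rw [mem_pow]
  rcases mem_upair.1 hz with rfl | rfl
  · refine ⟨isSet_upair _ _, fun z hz => ?_⟩
    rcases mem_upair.1 hz with rfl | rfl <;> simp [ha]
  · refine ⟨isSet_upair _ _, fun z hz => ?_⟩
    rcases mem_upair.1 hz with rfl | rfl <;> simp [ha, hb]

@[simp] theorem pair_mem_prod {x y a b : M} : pair a b ∈ₐ prod x y ↔ a ∈ₐ x ∧ b ∈ₐ y := by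
  rw [mem_prod]
  constructor
  · rintro ⟨c, d, hc, hd, h⟩
    obtain ⟨rfl, rfl⟩ := pair_inj.1 h
    exact ⟨hc, hd⟩
  · rintro ⟨ha, hb⟩
    exact ⟨a, b, ha, hb, rfl⟩

section Inst
variable {Γ : Type u} [c : Ctx M Γ] {A : Set M} (s t : Γ → M) [DF A s] [DF A t]

instance df_app : DF A fun p => app (s p) (t p) := by
  refine df_subst₂ s t ?_
  unfold app; infer_instance

instance df_prod : DF A fun p => prod (s p) (t p) := by
  refine df_subst₂ s t ?_
  unfold prod; infer_instance
end Inst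

theorem isSubset_refl {x : M} (h : IsSet x) : IsSubset x x := ⟨h, fun _ h => h⟩

theorem IsSubset.trans {x y z : M} (h : IsSubset x y) (h' : IsSubset y z) : IsSubset x z :=
  ⟨h.1, fun w hw => h'.2 w (h.2 w hw)⟩

theorem IsSubset.antisymm {x y : M} (h : IsSubset x y) (h' : IsSubset y x) : x = y :=
  ext_iff' h.1 h'.1 fun z => ⟨h.2 z, h'.2 z⟩

theorem foundation' {x : M} (h : ∃ z, z ∈ₐ x) : ∃ z, z ∈ₐ x ∧ ∀ w, w ∈ₐ z → ¬ w ∈ₐ x :=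
  hM.out.choose_spec.foundation x h

theorem mem_irrefl (x : M) : ¬ x ∈ₐ x := by
  intro h
  obtain ⟨z, hz, h'⟩ := foundation' (x := upair x x) ⟨x, by simp⟩
  obtain rfl : z = x := by simpa using hz
  exact h' z h (by simp)

theorem mem_asymm {x y : M} (h : x ∈ₐ y) : ¬ y ∈ₐ x := by
  intro h2
  obtain ⟨z, hz, h'⟩ := foundation' (x := upair x y) ⟨x, by simp⟩
  rcases mem_upair.1 hz with rfl | rfl
  · exact h' y h2 (by simp)
  · exact h' x h (by simp)

/-! ### Natural numbers -/

section Nat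
variable {M : Type u} [AtomStr M] [hM : IsZFCA M]

theorem isEmptySet_iff {x : M} : IsEmptySet x ↔ x = emp :=
  ⟨fun h => isEmptySet_unique h emp_spec, fun h => h ▸ emp_spec⟩

theorem isSucc_iff {s n : M} : IsSucc s n ↔ s = ins n n :=
  ⟨fun h => ext_iff' h.1 (isSet_ins n n) fun z => (h.2 z).trans mem_ins.symm,
    fun h => h ▸ ⟨isSet_ins n n, fun _ => mem_ins⟩⟩

theorem isInductive_iff {w : M} :
    IsInductive w ↔ IsSet w ∧ emp ∈ₐ w ∧ ∀ n, n ∈ₐ w → ins n n ∈ₐ w := by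
  simp only [IsInductive, isEmptySet_iff, isSucc_iff, exists_eq_left]

theorem isNat_emp : IsNat (emp : M) := fun _ hw => (isInductive_iff.1 hw).2.1

theorem IsNat.succ {n : M} (h : IsNat n) : IsNat (ins n n) :=
  fun w hw => (isInductive_iff.1 hw).2.2 n (h w hw)

/-- The set `ω` of natural numbers. -/
noncomputable def omega : M := theU fun y => IsSet y ∧ ∀ z, z ∈ₐ y ↔ IsNat z

theorem omega_spec : IsSet (omega : M) ∧ ∀ z : M, z ∈ₐ omega ↔ IsNat z := by
  refine theU_set ?_
  obtain ⟨w, hw⟩ := hM.out.choose_spec.infinity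
  refine ⟨sep w IsNat, isSet_sep _ _, fun z => ?_⟩
  rw [mem_sep, and_iff_right_iff_imp]
  exact fun h => h w hw

@[simp] theorem isSet_omega : IsSet (omega : M) := omega_spec.1
@[simp] theorem mem_omega {z : M} : z ∈ₐ omega ↔ IsNat z := omega_spec.2 z

instance df_omega {Γ : Type u} [Ctx M Γ] {A : Set M} : DF A fun _ : Γ => (omega : M) := by
  unfold omega; infer_instance

/-- Induction on natural numbers. As `M` may have nonstandard natural numbers, it holds for definable
predicates only. -/
theorem nat_induction {P : M → Prop} [Dfn Set.univ fun q : Nil M × M => P q.2] (h0 : P emp)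
    (hs : ∀ n, IsNat n → P n → P (ins n n)) {n : M} (hn : IsNat n) : P n := by
  have hw : IsInductive (sep omega P) := by
    rw [isInductive_iff]
    refine ⟨isSet_sep _ _, ?_, fun k hk => ?_⟩
    · rw [mem_sep, mem_omega]
      exact ⟨isNat_emp, h0⟩
    · rw [mem_sep, mem_omega] at hk ⊢
      exact ⟨hk.1.succ, hs k hk.1 hk.2⟩
  exact ((mem_sep _ _).1 (hn _ hw)).2

theorem succ_ne_emp (n : M) : ins n n ≠ emp := fun h => not_mem_emp n (h ▸ mem_ins.2 (Or.inr rfl))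

theorem succ_inj {n k : M} (h : ins n n = ins k k) : n = k := by
  have h1 : n ∈ₐ ins k k := h ▸ mem_ins.2 (Or.inr rfl)
  have h2 : k ∈ₐ ins n n := h ▸ mem_ins.2 (Or.inr rfl)
  rcases mem_ins.1 h1 with h1 | h1
  · rcases mem_ins.1 h2 with h2 | h2
    · exact absurd h2 (mem_asymm h1)
    · exact h2.symm
  · exact h1

/-! ### Transitive closures and `∈`-induction -/

/-- `y` is the result of applying `⋃` to `x` as often as `n` says, as witnessed by a computation. -/
def IterUnion (x n y : M) : Prop := ∃ f, pair n y ∈ₐ f ∧ ∀ p, p ∈ₐ f →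
  p = pair emp x ∨ ∃ k z, pair k z ∈ₐ f ∧ p = pair (ins k k) (sUn z)

instance dfn_iterUnion {Γ : Type u} [Ctx M Γ] {A : Set M} (s t r : Γ → M) [DF A s] [DF A t]
    [DF A r] : Dfn A fun p => IterUnion (s p) (t p) (r p) := by
  refine dfn_subst₃ s t r ?_
  unfold IterUnion; infer_instance

theorem IterUnion.zero (x : M) : IterUnion x emp x :=
  ⟨upair (pair emp x) (pair emp x), by simp, fun p hp => by simp_all⟩

theorem IterUnion.succ {x n y : M} (h : IterUnion x n y) : IterUnion x (ins n n) (sUn y) := by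
  obtain ⟨f, hy, hf⟩ := h
  refine ⟨ins (pair (ins n n) (sUn y)) f, by simp, fun p hp => ?_⟩
  rcases mem_ins.1 hp with hp | rfl
  · rcases hf p hp with h | ⟨k, z, h, h'⟩
    · exact Or.inl h
    · exact Or.inr ⟨k, z, mem_ins.2 (Or.inl h), h'⟩
  · exact Or.inr ⟨n, y, mem_ins.2 (Or.inl hy), rfl⟩

theorem IterUnion.eq_of_zero {x y : M} (h : IterUnion x emp y) : y = x := by
  obtain ⟨f, hy, hf⟩ := h
  rcases hf _ hy with h | ⟨k, z, -, h⟩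
  · exact (pair_inj.1 h).2
  · exact absurd (pair_inj.1 h).1.symm (succ_ne_emp k)

theorem IterUnion.of_succ {x n y : M} (h : IterUnion x (ins n n) y) :
    ∃ z, IterUnion x n z ∧ y = sUn z := by
  obtain ⟨f, hy, hf⟩ := h
  rcases hf _ hy with h | ⟨k, z, h', h⟩
  · exact absurd (pair_inj.1 h).1 (succ_ne_emp n)
  · obtain ⟨h1, h2⟩ := pair_inj.1 h
    obtain rfl := succ_inj h1
    exact ⟨z, ⟨f, h', hf⟩, h2⟩

theorem iterUnion_existsUnique (x : M) {n : M} (hn : IsNat n) : ∃! y, IterUnion x n y := by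
  refine nat_induction (P := fun n => ∃! y, IterUnion x n y) ?_ ?_ hn
  · exact ⟨x, IterUnion.zero x, fun _ => IterUnion.eq_of_zero⟩
  · rintro n - ⟨y, hy, hu⟩
    refine ⟨sUn y, hy.succ, fun y' hy' => ?_⟩
    obtain ⟨z, hz, rfl⟩ := hy'.of_succ
    rw [hu z hz]

/-- Every element belongs to a transitive set. This comes before `∈`-induction, which needs it. -/
theorem exists_transitive (x : M) : ∃ t, IsTransitive t ∧ x ∈ₐ t := by
  refine ⟨sUn (img omega fun n => theU (IterUnion (upair x x) n)), ⟨isSet_sUn _, ?_⟩, ?_⟩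
  · simp only [mem_sUn, mem_img, mem_omega]
    rintro z ⟨_, ⟨n, hn, rfl⟩, hz⟩ w hw
    refine ⟨_, ⟨ins n n, hn.succ, rfl⟩, ?_⟩
    have h1 := theU_spec (iterUnion_existsUnique (upair x x) hn)
    rw [(iterUnion_existsUnique (upair x x) hn.succ).unique
      (theU_spec (iterUnion_existsUnique (upair x x) hn.succ)) h1.succ]
    exact mem_sUn.2 ⟨z, hz, hw⟩
  · simp only [mem_sUn, mem_img, mem_omega]
    refine ⟨_, ⟨emp, isNat_emp, rfl⟩, ?_⟩
    rw [(IterUnion.eq_of_zero (theU_spec (iterUnion_existsUnique (upair x x) isNat_emp)))]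
    simp

/-- `∈`-induction for definable predicates: foundation is applied to the counterexamples in a
transitive set. -/
theorem mem_induction {P : M → Prop} [Dfn Set.univ fun q : Nil M × M => P q.2]
    (h : ∀ x, (∀ z, z ∈ₐ x → P z) → P x) (x : M) : P x := by
  by_contra hx
  obtain ⟨t, ht, hxt⟩ := exists_transitive x
  obtain ⟨z, hz, hz'⟩ := foundation' (x := sep t fun z => ¬ P z) ⟨x, (mem_sep _ _).2 ⟨hxt, hx⟩⟩
  rw [mem_sep] at hz
  refine hz.2 (h z fun w hw => ?_)
  by_contra hPw
  exact hz' w hw ((mem_sep _ _).2 ⟨ht.2 z hz.1 w hw, hPw⟩)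

/-! ### `∈`-recursion -/

/-- The set of the values of `f` on elements of `z`. -/
noncomputable def fimg (f z : M) : M := sep (sUn (sUn f)) fun u => ∃ w, w ∈ₐ z ∧ App f w u

instance df_fimg {Γ : Type u} [Ctx M Γ] {A : Set M} (s t : Γ → M) [DF A s] [DF A t] :
    DF A fun p => fimg (s p) (t p) := by
  refine df_subst₂ s t ?_
  unfold fimg; infer_instance

theorem mem_fimg {f z u : M} : u ∈ₐ fimg f z ↔ ∃ w, w ∈ₐ z ∧ App f w u := by
  rw [fimg, mem_sep, and_iff_right_iff_imp]
  rintro ⟨w, -, h⟩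
  rw [app_iff] at h
  exact mem_sUn.2 ⟨upair w u, mem_sUn.2 ⟨_, h, by simp [pair]⟩, by simp⟩

/-- `f` satisfies on the transitive set `t` the recursion `f z = E z {f w | w ∈ z}`. -/
def IsRec (E : M → M → M) (t f : M) : Prop :=
  IsTransitive t ∧ (∀ z, z ∈ₐ t → ∃! v, App f z v) ∧
    ∀ z v, z ∈ₐ t → App f z v → v = E z (fimg f z)

/-- `v` is the value at `z` of the function defined by the recursion `f z = E z {f w | w ∈ z}`. -/
def RecRel (E : M → M → M) (z v : M) : Prop := ∃ t f, IsRec E t f ∧ z ∈ₐ t ∧ App f z v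

/-- The function defined by the recursion `f z = E z {f w | w ∈ z}`. -/
noncomputable def recFn (E : M → M → M) (z : M) : M := theU (RecRel E z)

section Rec
variable (E : M → M → M) [hE : DF Set.univ fun q : (Nil M × M) × M => E q.1.2 q.2]
include hE

theorem dfn_recRel {Γ : Type u} [Ctx M Γ] (s t : Γ → M) [DF Set.univ s] [DF Set.univ t] :
    Dfn Set.univ fun p => RecRel E (s p) (t p) := by
  have h : ∀ {Γ : Type u} [Ctx M Γ] (s t : Γ → M) [DF Set.univ s] [DF Set.univ t],
    DF Set.univ fun p => E (s p) (t p) := fun s t => hE.comp₂ s t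
  refine dfn_subst₂ s t ?_
  unfold RecRel IsRec
  infer_instance

theorem df_recFn {Γ : Type u} [Ctx M Γ] (s : Γ → M) [DF Set.univ s] :
    DF Set.univ fun p => recFn E (s p) := by
  refine df_subst₁ s ?_
  have := dfn_recRel E (Γ := (Γ × M) × M) (fun q => q.1.2) fun q => q.2
  unfold recFn
  infer_instance

theorem recRel_unique {z v v' : M} (h : RecRel E z v) (h' : RecRel E z v') : v = v' := by
  obtain ⟨t, f, hf, hz, hv⟩ := h
  obtain ⟨t', f', hf', hz', hv'⟩ := h'
  refine mem_induction (P := fun z => z ∈ₐ t → z ∈ₐ t' → ∀ v, App f z v → ∀ v', App f' z v' →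
    v = v') ?_ z hz hz' v hv v' hv'
  intro z ih hz hz' v hv v' hv'
  have key : fimg f z = fimg f' z := by
    refine ext_iff' (isSet_sep _ _) (isSet_sep _ _) fun u => ?_
    simp only [mem_fimg]
    constructor
    · rintro ⟨w, hw, hu⟩
      obtain ⟨u', hu', -⟩ := hf'.2.1 w (hf'.1.2 z hz' w hw)
      exact ⟨w, hw, ih w hw (hf.1.2 z hz w hw) (hf'.1.2 z hz' w hw) u hu u' hu' ▸ hu'⟩
    · rintro ⟨w, hw, hu⟩
      obtain ⟨u', hu', -⟩ := hf.2.1 w (hf.1.2 z hz w hw)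
      exact ⟨w, hw, ih w hw (hf.1.2 z hz w hw) (hf'.1.2 z hz' w hw) u' hu' u hu ▸ hu'⟩
  rw [hf.2.2 z v hz hv, hf'.2.2 z v' hz' hv', key]

theorem recFn_eq_of_recRel {z v : M} (h : RecRel E z v) : recFn E z = v :=
  theU_eq h fun _ h' => recRel_unique E h' h

/-- The recursion theorem. The set of those elements of a transitive set at which the recursion has
no value has no `∈`-minimal element. -/
theorem recRel_recFn (x : M) : RecRel E x (recFn E x) := by
  have hd := @dfn_recRel M _ _ E _
  have hr := @df_recFn M _ _ E _
  have hE2 : ∀ {Γ : Type u} [Ctx M Γ] (s t : Γ → M) [DF Set.univ s] [DF Set.univ t],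
    DF Set.univ fun p => E (s p) (t p) := fun s t => hE.comp₂ s t
  suffices ∃ v, RecRel E x v by
    obtain ⟨v, hv⟩ := this
    rwa [recFn_eq_of_recRel E hv]
  obtain ⟨T, hT, hxT⟩ := exists_transitive x
  by_contra hx
  obtain ⟨z, hz, hmin⟩ := foundation' (x := sep T fun z => ¬ ∃ v, RecRel E z v)
    ⟨x, (mem_sep _ _).2 ⟨hxT, hx⟩⟩
  rw [mem_sep] at hz
  have hgood : ∀ w, w ∈ₐ z → ∃ v, RecRel E w v := by
    intro w hw
    by_contra h
    exact hmin w hw ((mem_sep _ _).2 ⟨hT.2 z hz.1 w hw, h⟩)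
  have hdown : ∀ y, (∃ v, RecRel E y v) → ∀ w, w ∈ₐ y → ∃ v, RecRel E w v := by
    rintro y ⟨v, t, f, hf, hy, -⟩ w hw
    obtain ⟨u, hu, -⟩ := hf.2.1 w (hf.1.2 y hy w hw)
    exact ⟨u, t, f, hf, hf.1.2 y hy w hw, hu⟩
  -- The function `y ↦ E y {recFn E w | w ∈ y}` solves the recursion on `t`, which contains `z`.
  let t := sep T fun y => y = z ∨ ∃ v, RecRel E y v
  have mem_t : ∀ y, y ∈ₐ t ↔ y ∈ₐ T ∧ (y = z ∨ ∃ v, RecRel E y v) := fun y => mem_sep _ _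
  have hel : ∀ y, y ∈ₐ t → ∀ w, w ∈ₐ y → ∃ v, RecRel E w v := by
    intro y hy w hw
    rcases ((mem_t y).1 hy).2 with rfl | hy
    · exact hgood w hw
    · exact hdown y hy w hw
  have hval : ∀ y, (∃ v, RecRel E y v) → recFn E y = E y (img y (recFn E)) := by
    rintro y ⟨v, hv⟩
    rw [recFn_eq_of_recRel E hv]
    obtain ⟨t, f, hf, hy, hfv⟩ := hv
    rw [hf.2.2 y v hy hfv]
    congr 1
    refine ext_iff' (isSet_sep _ _) (isSet_img _ _) fun u => ?_
    rw [mem_fimg, mem_img]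
    constructor
    · rintro ⟨w, hw, hu⟩
      exact ⟨w, hw, recFn_eq_of_recRel E ⟨t, f, hf, hf.1.2 y hy w hw, hu⟩⟩
    · rintro ⟨w, hw, rfl⟩
      obtain ⟨u, hu, -⟩ := hf.2.1 w (hf.1.2 y hy w hw)
      exact ⟨w, hw, by rwa [recFn_eq_of_recRel E ⟨t, f, hf, hf.1.2 y hy w hw, hu⟩]⟩
  let f := img t fun y => pair y (E y (img y (recFn E)))
  have happ : ∀ y v, App f y v ↔ y ∈ₐ t ∧ v = E y (img y (recFn E)) := by
    intro y v
    rw [app_iff, mem_img]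
    constructor
    · rintro ⟨a, ha, h⟩
      obtain ⟨rfl, rfl⟩ := pair_inj.1 h
      exact ⟨ha, rfl⟩
    · rintro ⟨hy, rfl⟩
      exact ⟨y, hy, rfl⟩
  refine hz.2 ⟨E z (img z (recFn E)), t, f, ⟨⟨isSet_sep _ _, ?_⟩, ?_, ?_⟩,
    (mem_t z).2 ⟨hz.1, Or.inl rfl⟩, (happ _ _).2 ⟨(mem_t z).2 ⟨hz.1, Or.inl rfl⟩, rfl⟩⟩
  · intro y hy w hw
    exact (mem_t w).2 ⟨hT.2 y ((mem_t y).1 hy).1 w hw, Or.inr (hel y hy w hw)⟩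
  · intro y hy
    exact ⟨_, (happ _ _).2 ⟨hy, rfl⟩, fun v hv => ((happ _ _).1 hv).2⟩
  · intro y v hy hv
    rw [((happ _ _).1 hv).2]
    congr 1
    refine ext_iff' (isSet_img _ _) (isSet_sep _ _) fun u => ?_
    rw [mem_fimg, mem_img]
    constructor
    · rintro ⟨w, hw, rfl⟩
      exact ⟨w, hw, (happ _ _).2 ⟨(mem_t w).2 ⟨hT.2 y ((mem_t y).1 hy).1 w hw,
        Or.inr (hel y hy w hw)⟩, hval w (hel y hy w hw)⟩⟩
    · rintro ⟨w, hw, hu⟩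
      exact ⟨w, hw, by rw [((happ _ _).1 hu).2, hval w (hel y hy w hw)]⟩

theorem recFn_eq (x : M) : ∃ s, IsSet s ∧ (∀ u, u ∈ₐ s ↔ ∃ w, w ∈ₐ x ∧ recFn E w = u) ∧
    recFn E x = E x s := by
  obtain ⟨t, f, hf, hx, hv⟩ := recRel_recFn E x
  refine ⟨fimg f x, isSet_sep _ _, fun u => ?_, hf.2.2 x _ hx hv⟩
  rw [mem_fimg]
  constructor
  · rintro ⟨w, hw, hu⟩
    exact ⟨w, hw, recFn_eq_of_recRel E ⟨t, f, hf, hf.1.2 x hx w hw, hu⟩⟩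
  · rintro ⟨w, hw, rfl⟩
    obtain ⟨u, hu, -⟩ := hf.2.1 w (hf.1.2 x hx w hw)
    exact ⟨w, hw, by rwa [recFn_eq_of_recRel E ⟨t, f, hf, hf.1.2 x hx w hw, hu⟩]⟩

end Rec
end Nat

/-! ### Finite sets -/

section Finite
variable {M : Type u} [AtomStr M] [hM : IsZFCA M]

theorem IsBij.mem {f x y a b : M} (h : IsBij f x y) (hab : App f a b) : a ∈ₐ x ∧ b ∈ₐ y := by
  obtain ⟨c, d, hc, hd, hp⟩ := h.pairs _ (app_iff.1 hab)
  obtain ⟨rfl, rfl⟩ := pair_inj.1 (isPair_iff.1 hp)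
  exact ⟨hc, hd⟩

theorem isBij_of {f x y : M} (hf : IsSet f) (h : ∀ p, p ∈ₐ f → ∃ a b, p = pair a b)
    (hm : ∀ a b, App f a b → a ∈ₐ x ∧ b ∈ₐ y) (hl : ∀ a, a ∈ₐ x → ∃! b, App f a b)
    (hr : ∀ b, b ∈ₐ y → ∃! a, App f a b) : IsBij f x y := by
  refine ⟨hf, fun p hp => ?_, hl, hr⟩
  obtain ⟨a, b, rfl⟩ := h p hp
  have := hm a b (app_iff.2 hp)
  exact ⟨a, b, this.1, this.2, isPair_iff.2 rfl⟩

theorem isFinite_emp : IsFinite (emp : M) :=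
  ⟨emp, emp, isNat_emp, isSet_emp, by simp, by simp, by simp⟩

theorem IsFinite.ins {s : M} (hs : IsFinite s) (a : M) : IsFinite (ins a s) := by
  by_cases ha : a ∈ₐ s
  · have : ZFA.ins a s = s := ext_iff' (isSet_ins _ _) (isSet_of_mem ha) fun z => by
      rw [mem_ins, or_iff_left_iff_imp]
      rintro rfl
      exact ha
    rwa [this]
  obtain ⟨n, f, hn, hf⟩ := hs
  have happ : ∀ x y, App (ZFA.ins (pair a n) f) x y ↔ App f x y ∨ x = a ∧ y = n := fun x y => by
    simp [app_iff]
  refine ⟨ZFA.ins n n, ZFA.ins (pair a n) f, hn.succ, isBij_of (isSet_ins _ _) ?_ ?_ ?_ ?_⟩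
  · intro p hp
    rcases mem_ins.1 hp with hp | rfl
    · obtain ⟨a, b, -, -, h⟩ := hf.pairs p hp
      exact ⟨a, b, isPair_iff.1 h⟩
    · exact ⟨_, _, rfl⟩
  · intro x y h
    simp only [mem_ins]
    rcases (happ x y).1 h with h | ⟨rfl, rfl⟩
    · exact ⟨Or.inl (hf.mem h).1, Or.inl (hf.mem h).2⟩
    · exact ⟨Or.inr rfl, Or.inr rfl⟩
  · intro x hx
    simp only [happ]
    rcases mem_ins.1 hx with hx | rfl
    · have hxa : x ≠ a := fun h => ha (h ▸ hx)
      simpa [hxa] using hf.left x hx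
    · exact ⟨n, Or.inr ⟨rfl, rfl⟩, fun y hy =>
        hy.elim (fun h => absurd (hf.mem h).1 ha) fun h => h.2⟩
  · intro y hy
    simp only [happ]
    rcases mem_ins.1 hy with hy | rfl
    · have hyn : y ≠ n := fun h => mem_irrefl n (h ▸ hy)
      simpa [hyn] using hf.right y hy
    · exact ⟨a, Or.inr ⟨rfl, rfl⟩, fun x hx =>
        hx.elim (fun h => absurd (hf.mem h).2 (mem_irrefl _)) fun h => h.1⟩

/-- Induction on the finite sets of `M`, for definable predicates, by induction on the natural number
that is in bijection with the set. -/
theorem finite_induction {P : M → Prop} [h : Dfn Set.univ fun q : Nil M × M => P q.2] (h0 : P emp)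
    (hi : ∀ s a, IsSet s → IsFinite s → ¬ a ∈ₐ s → P s → P (ins a s)) {s : M} (hs : IsSet s)
    (hf : IsFinite s) : P s := by
  have hP : ∀ {Γ : Type u} [Ctx M Γ] (t : Γ → M) [DF Set.univ t], Dfn Set.univ fun p => P (t p) :=
    fun t => h.comp₁ t
  obtain ⟨n, f, hn, hf⟩ := hf
  refine nat_induction (P := fun n => IsNat n → ∀ s f, IsSet s → IsBij f s n → P s) ?_ ?_ hn hn
    s f hs hf
  · intro _ s f hs hf
    rwa [eq_emp hs fun a ha => ?_]
    obtain ⟨b, hb, -⟩ := hf.left a ha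
    exact not_mem_emp b (hf.mem hb).2
  · intro n hn ih _ s f hs hf
    obtain ⟨a, ha, hau⟩ := hf.right n (mem_ins.2 (Or.inr rfl))
    have has := (hf.mem ha).1
    have hms : ∀ z, z ∈ₐ sep s (fun z => z ≠ a) ↔ z ∈ₐ s ∧ z ≠ a := fun z => mem_sep _ _
    have happ : ∀ x y, App (sep f fun p => p ≠ pair a n) x y ↔ App f x y ∧ ¬ (x = a ∧ y = n) :=
      fun x y => by rw [app_iff, app_iff, mem_sep, Ne, pair_inj]
    have hbij : IsBij (sep f fun p => p ≠ pair a n) (sep s fun z => z ≠ a) n := by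
      refine isBij_of (isSet_sep _ _) ?_ ?_ ?_ ?_
      · intro p hp
        obtain ⟨a, b, -, -, h⟩ := hf.pairs p ((mem_sep _ _).1 hp).1
        exact ⟨a, b, isPair_iff.1 h⟩
      · intro x y hxy
        rw [happ] at hxy
        have h1 := hf.mem hxy.1
        have h2 : x ≠ a := by
          rintro rfl
          exact hxy.2 ⟨rfl, (hf.left x has).unique hxy.1 ha⟩
        refine ⟨(hms x).2 ⟨h1.1, h2⟩, (mem_ins.1 h1.2).resolve_right ?_⟩
        rintro rfl
        exact h2 (hau x hxy.1)
      · intro x hx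
        rw [hms] at hx
        simpa [happ, hx.2] using hf.left x hx.1
      · intro y hy
        have hyn : y ≠ n := fun h => mem_irrefl n (h ▸ hy)
        simpa [happ, hyn] using hf.right y (mem_ins.2 (Or.inl hy))
    have := hi _ a (isSet_sep s fun z => z ≠ a) ⟨n, _, hn, hbij⟩ (by simp)
      (ih hn _ _ (isSet_sep _ _) hbij)
    rwa [ext_iff' (isSet_ins _ _) hs fun z => ?_] at this
    rw [mem_ins, hms]
    by_cases hz : z = a
    · simp [hz, has]
    · simp [hz]

theorem IsFinite.subset {s t : M} (hs : IsFinite s) (hss : IsSet s) (ht : IsSubset t s) :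
    IsFinite t := by
  refine finite_induction (P := fun s => ∀ t, IsSubset t s → IsFinite t) ?_ ?_ hss hs t ht
  · intro t ht
    rw [eq_emp ht.1 fun z hz => not_mem_emp z (ht.2 z hz)]
    exact isFinite_emp
  · intro s a _ _ ha ih t ht
    have h1 : IsFinite (sep t fun z => z ≠ a) := by
      refine ih _ ⟨isSet_sep _ _, fun z hz => ?_⟩
      rw [mem_sep] at hz
      exact (mem_ins.1 (ht.2 z hz.1)).resolve_right hz.2
    by_cases hat : a ∈ₐ t
    · have := h1.ins a
      rwa [ext_iff' (isSet_ins _ _) ht.1 fun z => ?_] at this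
      rw [mem_ins, mem_sep]
      by_cases hz : z = a
      · simp [hz, hat]
      · simp [hz]
    · rwa [ext_iff' (isSet_sep _ _) ht.1 fun z => ?_] at h1
      rw [mem_sep, and_iff_left_iff_imp]
      rintro hz rfl
      exact hat hz

theorem IsFinite.cup {s t : M} (hs : IsFinite s) (ht : IsFinite t) (hss : IsSet s)
    (hst : IsSet t) : IsFinite (cup s t) := by
  refine finite_induction (P := fun s => IsFinite (ZFA.cup s t)) ?_ ?_ hss hs
  · rwa [ext_iff' (isSet_cup _ _) hst fun z => by simp]
  · intro s a _ _ _ ih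
    have := ih.ins a
    rwa [ext_iff' (isSet_ins _ _) (isSet_cup (ZFA.ins a s) t) fun z => by simp; tauto] at this

theorem IsFinite.img {s : M} (hs : IsFinite s) (hss : IsSet s) (f : M → M)
    [h : DF Set.univ fun q : Nil M × M => f q.2] : IsFinite (img s f) := by
  have hf : ∀ {Γ : Type u} [Ctx M Γ] (t : Γ → M) [DF Set.univ t], DF Set.univ fun p => f (t p) :=
    fun t => h.comp₁ t
  refine finite_induction (P := fun s => IsFinite (ZFA.img s f)) ?_ ?_ hss hs
  · rw [eq_emp (isSet_img _ _) fun z => by simp]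
    exact isFinite_emp
  · intro s a _ _ _ ih
    have := ih.ins (f a)
    rwa [ext_iff' (isSet_ins _ _) (isSet_img (ZFA.ins a s) f) fun z => ?_] at this
    simp only [mem_ins, mem_img]
    constructor
    · rintro (⟨b, hb, rfl⟩ | rfl)
      · exact ⟨b, Or.inl hb, rfl⟩
      · exact ⟨a, Or.inr rfl, rfl⟩
    · rintro ⟨b, hb | rfl, rfl⟩
      · exact Or.inl ⟨b, hb, rfl⟩
      · exact Or.inr rfl

end Finite

/-! ### The action of permutations of the atoms on the universe -/

section Act
variable {M : Type u} [AtomStr M] [hM : IsZFCA M]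

/-- The step of the recursion that defines the action of `π`: atoms are mapped by `π`, and a set `z`
is mapped to the set `s` of the images of its elements. -/
noncomputable def actStep (π z s : M) : M :=
  theU fun v => (AtomStr.isAtom z ∧ App π z v) ∨ (IsSet z ∧ v = s)

instance df_actStep (π : M) : DF Set.univ fun q : (Nil M × M) × M => actStep π q.1.2 q.2 := by
  unfold actStep; infer_instance

theorem actStep_set {π z s : M} (hz : IsSet z) : actStep π z s = s :=
  theU_eq (Or.inr ⟨hz, rfl⟩) fun _ h => h.elim (fun h => absurd h.1 hz) fun h => h.2

theorem actStep_atom {π z s : M} (hπ : IsBij π atoms atoms) (hz : AtomStr.isAtom z) :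
    App π z (actStep π z s) := by
  obtain ⟨v, hv, hu⟩ := hπ.left z (mem_atoms.2 hz)
  have : actStep π z s = v := theU_eq (Or.inl ⟨hz, hv⟩) fun w h =>
    h.elim (fun h => hu w h.2) fun h => absurd hz h.1
  rwa [this]

/-- The functions that witness `ActsTo` are the solutions of the recursion with step `actStep`. -/
theorem isActionFun_iff_isRec {π t f : M} (hπ : IsBij π atoms atoms) :
    IsActionFun π t f ↔ IsRec (actStep π) t f := by
  constructor
  · intro h
    refine ⟨h.transitive, h.total, fun z v hz hv => ?_⟩
    by_cases ha : AtomStr.isAtom z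
    · exact (hπ.left z (mem_atoms.2 ha)).unique (h.atom z v hz ha hv) (actStep_atom hπ ha)
    · rw [actStep_set ha]
      exact ext_iff' (h.set z v hz ha hv).1 (isSet_sep _ _) fun u =>
        ((h.set z v hz ha hv).2 u).trans mem_fimg.symm
  · intro h
    refine ⟨h.1, h.2.1, fun z v hz ha hv => ?_, fun z v hz ha hv => ?_⟩
    · rw [h.2.2 z v hz hv]
      exact actStep_atom hπ ha
    · rw [h.2.2 z v hz hv, actStep_set ha]
      exact ⟨isSet_sep _ _, fun u => mem_fimg⟩

/-- `π x`, for a permutation `π` of the atoms. -/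
noncomputable def act (π x : M) : M := theU (ActsTo π x)

instance df_act {Γ : Type u} [Ctx M Γ] {A : Set M} (s t : Γ → M) [DF A s] [DF A t] :
    DF A fun p => act (s p) (t p) := by
  refine df_subst₂ s t ?_
  unfold act; infer_instance

variable {π : M} (hπ : IsBij π atoms atoms)
include hπ

theorem actsTo_iff_recRel {x y : M} : ActsTo π x y ↔ RecRel (actStep π) x y := by
  simp only [ActsTo, RecRel, isActionFun_iff_isRec hπ]

theorem act_eq_recFn (x : M) : act π x = recFn (actStep π) x := by
  unfold act recFn
  congr 1
  funext y
  exact propext (actsTo_iff_recRel hπ)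

theorem actsTo_iff {x y : M} : ActsTo π x y ↔ act π x = y := by
  rw [actsTo_iff_recRel hπ, act_eq_recFn hπ]
  exact ⟨recFn_eq_of_recRel _, fun h => h ▸ recRel_recFn _ x⟩

theorem app_act {x : M} (hx : AtomStr.isAtom x) : App π x (act π x) := by
  obtain ⟨s, -, -, h⟩ := recFn_eq (actStep π) x
  rw [act_eq_recFn hπ, h]
  exact actStep_atom hπ hx

theorem app_iff_act {x y : M} : App π x y ↔ AtomStr.isAtom x ∧ act π x = y := by
  constructor
  · intro h
    have hx := mem_atoms.1 (hπ.mem h).1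
    exact ⟨hx, (hπ.left x (hπ.mem h).1).unique (app_act hπ hx) h⟩
  · rintro ⟨hx, rfl⟩
    exact app_act hπ hx

theorem isAtom_act_of_isAtom {x : M} (hx : AtomStr.isAtom x) : AtomStr.isAtom (act π x) :=
  mem_atoms.1 (hπ.mem (app_act hπ hx)).2

theorem isSet_act {x : M} (hx : IsSet x) : IsSet (act π x) := by
  obtain ⟨s, hs, -, h⟩ := recFn_eq (actStep π) x
  rwa [act_eq_recFn hπ, h, actStep_set hx]

theorem mem_act {x u : M} : u ∈ₐ act π x ↔ ∃ w, w ∈ₐ x ∧ act π w = u := by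
  by_cases hx : AtomStr.isAtom x
  · exact iff_of_false (fun h => isSet_of_mem h (isAtom_act_of_isAtom hπ hx))
      fun ⟨w, hw, _⟩ => isSet_of_mem hw hx
  · obtain ⟨s, -, hm, h⟩ := recFn_eq (actStep π) x
    simp only [act_eq_recFn hπ, h]
    rw [actStep_set hx, hm]

theorem act_eq_of_forall {x y : M} (hx : IsSet x) (hy : IsSet y)
    (h : ∀ u, u ∈ₐ y ↔ ∃ w, w ∈ₐ x ∧ act π w = u) : act π x = y :=
  ext_iff' (isSet_act hπ hx) hy fun u => (mem_act hπ).trans (h u).symm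

theorem act_inv {ρ : M} (hρ : IsBij ρ atoms atoms) (h : ∀ a b, App ρ a b ↔ App π b a) (x : M) :
    act ρ (act π x) = x := by
  refine mem_induction (P := fun x => act ρ (act π x) = x) ?_ x
  intro x ih
  by_cases hx : AtomStr.isAtom x
  · exact ((app_iff_act hρ).1 ((h _ _).2 (app_act hπ hx))).2
  · refine act_eq_of_forall hρ (isSet_act hπ hx) hx fun u => ?_
    constructor
    · exact fun hu => ⟨act π u, (mem_act hπ).2 ⟨u, hu, rfl⟩, ih u hu⟩
    · rintro ⟨w, hw, rfl⟩
      obtain ⟨v, hv, rfl⟩ := (mem_act hπ).1 hw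
      rwa [ih v hv]

theorem act_comp {ρ τ : M} (hρ : IsBij ρ atoms atoms) (hτ : IsBij τ atoms atoms)
    (h : IsComp τ ρ π) (x : M) : act τ x = act ρ (act π x) := by
  refine mem_induction (P := fun x => act τ x = act ρ (act π x)) ?_ x
  intro x ih
  by_cases hx : AtomStr.isAtom x
  · exact ((app_iff_act hτ).1 ((h _ _).2 ⟨_, app_act hπ hx,
      app_act hρ (isAtom_act_of_isAtom hπ hx)⟩)).2
  · refine act_eq_of_forall hτ hx (isSet_act hρ (isSet_act hπ hx)) fun u => ?_
    constructor
    · intro hu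
      obtain ⟨w, hw, rfl⟩ := (mem_act hρ).1 hu
      obtain ⟨v, hv, rfl⟩ := (mem_act hπ).1 hw
      exact ⟨v, hv, ih v hv⟩
    · rintro ⟨w, hw, rfl⟩
      rw [ih w hw]
      exact (mem_act hρ).2 ⟨_, (mem_act hπ).2 ⟨w, hw, rfl⟩, rfl⟩

theorem act_one (h : ∀ a, a ∈ₐ atoms → App π a a) (x : M) : act π x = x := by
  refine mem_induction (P := fun x => act π x = x) ?_ x
  intro x ih
  by_cases hx : AtomStr.isAtom x
  · exact ((app_iff_act hπ).1 (h x (mem_atoms.2 hx))).2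
  · refine act_eq_of_forall hπ hx hx fun u =>
      ⟨fun hu => ⟨u, hu, ih u hu⟩, ?_⟩
    rintro ⟨w, hw, rfl⟩
    rwa [ih w hw]

theorem mem_perm {p : M} : p ∈ₐ π ↔ ∃ a, AtomStr.isAtom a ∧ p = pair a (act π a) := by
  constructor
  · intro hp
    obtain ⟨a, b, -, -, h⟩ := hπ.pairs p hp
    rw [isPair_iff] at h
    subst h
    obtain ⟨ha, rfl⟩ := (app_iff_act hπ).1 (app_iff.2 hp)
    exact ⟨a, ha, rfl⟩
  · rintro ⟨a, ha, rfl⟩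
    exact app_iff.1 (app_act hπ ha)

omit hπ

variable {H : M} (hH : IsPermGroup atoms H)
include hH

theorem exists_act_inv {π : M} (hπ : π ∈ₐ H) :
    ∃ ρ, ρ ∈ₐ H ∧ (∀ x, act ρ (act π x) = x) ∧ ∀ x, act π (act ρ x) = x := by
  obtain ⟨ρ, hρ, h⟩ := hH.inv_mem π hπ
  exact ⟨ρ, hρ, act_inv (hH.perm π hπ) (hH.perm ρ hρ) h,
    act_inv (hH.perm ρ hρ) (hH.perm π hπ) fun a b => (h b a).symm⟩

theorem exists_act_mul {ρ π : M} (hρ : ρ ∈ₐ H) (hπ : π ∈ₐ H) :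
    ∃ τ, τ ∈ₐ H ∧ ∀ x, act τ x = act ρ (act π x) := by
  obtain ⟨τ, hτ, h⟩ := hH.mul_mem ρ π hρ hπ
  exact ⟨τ, hτ, act_comp (hH.perm π hπ) (hH.perm ρ hρ) (hH.perm τ hτ) h⟩

theorem exists_act_one : ∃ e, e ∈ₐ H ∧ ∀ x, act e x = x := by
  obtain ⟨e, he, h⟩ := hH.one_mem
  exact ⟨e, he, act_one (hH.perm e he) h⟩

/-- The automorphism of the universe given by an element of a group of permutations. -/
noncomputable def actAut {π : M} (hπ : π ∈ₐ H) : Aut M where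
  toFun := act π
  invFun := act (exists_act_inv hH hπ).choose
  left_inv := (exists_act_inv hH hπ).choose_spec.2.1
  right_inv := (exists_act_inv hH hπ).choose_spec.2.2
  mem_iff x y := by
    rw [mem_act (hH.perm π hπ)]
    constructor
    · rintro ⟨w, hw, h⟩
      have := congrArg (act (exists_act_inv hH hπ).choose) h
      rw [(exists_act_inv hH hπ).choose_spec.2.1, (exists_act_inv hH hπ).choose_spec.2.1] at this
      rwa [← this]
    · exact fun h => ⟨x, h, rfl⟩
  atom_iff x :=
    ⟨fun h => by_contra fun hx => isSet_act (hH.perm π hπ) hx h,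
      isAtom_act_of_isAtom (hH.perm π hπ)⟩

theorem act_mem_act {π : M} (hπ : π ∈ₐ H) {x y : M} : act π x ∈ₐ act π y ↔ x ∈ₐ y :=
  (actAut hH hπ).mem_iff x y

theorem act_injective {π : M} (hπ : π ∈ₐ H) {x y : M} (h : act π x = act π y) : x = y :=
  (actAut hH hπ).toEquiv.injective h

/-- A set is fixed by all elements of a group once they map its elements to elements. -/
theorem act_eq_self_of_forall_mem {x : M} (hx : IsSet x)
    (h : ∀ π, π ∈ₐ H → ∀ z, z ∈ₐ x → act π z ∈ₐ x) {π : M} (hπ : π ∈ₐ H) : act π x = x := by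
  refine act_eq_of_forall (hH.perm π hπ) hx hx fun u => ⟨fun hu => ?_, ?_⟩
  · obtain ⟨ρ, hρ, -, h2⟩ := exists_act_inv hH hπ
    exact ⟨act ρ u, h ρ hρ u hu, h2 u⟩
  · rintro ⟨w, hw, rfl⟩
    exact h π hπ w hw

theorem act_upair {π : M} (hπ : π ∈ₐ H) (a b : M) :
    act π (upair a b) = upair (act π a) (act π b) := by
  refine act_eq_of_forall (hH.perm π hπ) (isSet_upair _ _) (isSet_upair _ _) fun u => ?_
  simp only [mem_upair]
  constructor
  · rintro (rfl | rfl)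
    · exact ⟨a, Or.inl rfl, rfl⟩
    · exact ⟨b, Or.inr rfl, rfl⟩
  · rintro ⟨w, rfl | rfl, rfl⟩
    · exact Or.inl rfl
    · exact Or.inr rfl

theorem act_pair {π : M} (hπ : π ∈ₐ H) (a b : M) :
    act π (pair a b) = pair (act π a) (act π b) := by
  simp only [pair, act_upair hH hπ]

/-- `π σ` is `π σ π⁻¹`, for the action of `π` on the universe. -/
theorem act_perm_eq_iff {π σ τ : M} (hπ : π ∈ₐ H) (hσ : IsBij σ atoms atoms)
    (hτ : IsBij τ atoms atoms) :
    act π σ = τ ↔ ∀ a, AtomStr.isAtom a → act τ (act π a) = act π (act σ a) := by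
  have key : ∀ p, p ∈ₐ act π σ ↔ ∃ a, AtomStr.isAtom a ∧ p = pair (act π a) (act π (act σ a)) := by
    intro p
    rw [mem_act (hH.perm π hπ)]
    simp only [mem_perm hσ]
    constructor
    · rintro ⟨_, ⟨a, ha, rfl⟩, rfl⟩
      exact ⟨a, ha, act_pair hH hπ _ _⟩
    · rintro ⟨a, ha, rfl⟩
      exact ⟨_, ⟨a, ha, rfl⟩, act_pair hH hπ _ _⟩
  have hπa := @isAtom_act_of_isAtom M _ _ π (hH.perm π hπ)
  constructor
  · intro h a ha
    have h1 : pair (act π a) (act τ (act π a)) ∈ₐ act π σ := by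
      rw [h, mem_perm hτ]
      exact ⟨_, hπa ha, rfl⟩
    obtain ⟨b, -, hb⟩ := (key _).1 h1
    obtain ⟨h2, h3⟩ := pair_inj.1 hb
    rw [h3, act_injective hH hπ h2]
  · intro h
    refine ext_iff' (isSet_act (hH.perm π hπ) hσ.isSet) hτ.isSet fun p => ?_
    rw [key, mem_perm hτ]
    constructor
    · rintro ⟨a, ha, rfl⟩
      exact ⟨_, hπa ha, by rw [h a ha]⟩
    · rintro ⟨b, hb, rfl⟩
      obtain ⟨ρ, hρ, -, h2⟩ := exists_act_inv hH hπ
      have ha := isAtom_act_of_isAtom (hH.perm ρ hρ) hb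
      exact ⟨_, ha, by rw [← h _ ha, h2]⟩

theorem act_perm_mem {π σ : M} (hπ : π ∈ₐ H) (hσ : σ ∈ₐ H) : act π σ ∈ₐ H := by
  obtain ⟨ρ, hρ, h1, h2⟩ := exists_act_inv hH hπ
  obtain ⟨α, hα, hα'⟩ := exists_act_mul hH hσ hρ
  obtain ⟨τ, hτ, hτ'⟩ := exists_act_mul hH hπ hα
  rw [(act_perm_eq_iff hH hπ (hH.perm σ hσ) (hH.perm τ hτ)).2 fun a _ => by rw [hτ', hα', h1]]
  exact hτ

/-- Conjugation by its elements maps a group to itself. -/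
theorem act_group {π : M} (hπ : π ∈ₐ H) : act π H = H :=
  act_eq_self_of_forall_mem hH hH.isSet (fun _ hπ _ hσ => act_perm_mem hH hπ hσ) hπ

end Act

/-- The data of a permutation model: a group `G` of permutations of the atoms, and a normal filter
`F` of subgroups of `G`. -/
class PermSetting {M : Type u} [AtomStr M] [IsZFCA M] (G F : M) : Prop where
  group : IsPermGroup atoms G
  filter : IsNormalFilter atoms G F

section Setting

variable {M : Type u} [AtomStr M] [hM : IsZFCA M] {G F : M} [hS : PermSetting G F]

variable (G) in
include hS in
theorem group_of_mem {K : M} (hK : K ∈ₐ F) : IsPermGroup atoms K := (hS.filter.subgroup K hK).1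

theorem mem_of_mem_filter {K π : M} (hK : K ∈ₐ F) (hπ : π ∈ₐ K) : π ∈ₐ G :=
  (hS.filter.subgroup K hK).2.2 π hπ

variable (F)

/-- Normality of the filter says that it is fixed by the action of the group on the universe. -/
theorem act_filter {π : M} (hπ : π ∈ₐ G) : act π F = F := by
  refine act_eq_self_of_forall_mem hS.group hS.filter.isSet (fun π hπ K hK => ?_) hπ
  have hg := hS.group
  obtain ⟨L, hL, h⟩ := hS.filter.conj_mem π K hπ hK
  rwa [act_eq_of_forall (hg.perm π hπ) (group_of_mem G hK).isSet (group_of_mem G hL).isSet fun τ => ?_]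
  rw [h]
  constructor
  · rintro ⟨hτ, σ, hσ, ρ, h1, h2⟩
    have hσG : σ ∈ₐ G := mem_of_mem_filter hK hσ
    refine ⟨σ, hσ, (act_perm_eq_iff hg hπ (hg.perm σ hσG) (hg.perm τ hτ)).2 fun a ha => ?_⟩
    have h3 : App ρ a (act π (act σ a)) := (h2 _ _).2 ⟨_, app_act (hg.perm σ hσG) ha,
      app_act (hg.perm π hπ) (isAtom_act_of_isAtom (hg.perm σ hσG) ha)⟩
    obtain ⟨b, hb, hb'⟩ := (h1 _ _).1 h3
    rw [app_iff_act (hg.perm π hπ)] at hb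
    rw [app_iff_act (hg.perm τ hτ), ← hb.2] at hb'
    exact hb'.2
  · rintro ⟨σ, hσ, rfl⟩
    have hσG : σ ∈ₐ G := mem_of_mem_filter hK hσ
    have hτ := act_perm_mem hg hπ hσG
    have key := (act_perm_eq_iff hg hπ (hg.perm σ hσG) (hg.perm _ hτ)).1 rfl
    obtain ⟨ρ, hρ, hc⟩ := hg.mul_mem π σ hπ hσG
    refine ⟨hτ, σ, hσ, ρ, fun a c => ?_, hc⟩
    rw [hc a c]
    simp only [app_iff_act (hg.perm σ hσG), app_iff_act (hg.perm π hπ),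
      app_iff_act (hg.perm _ hτ)]
    constructor
    · rintro ⟨b, ⟨ha, rfl⟩, hb, rfl⟩
      exact ⟨_, ⟨ha, rfl⟩, isAtom_act_of_isAtom (hg.perm π hπ) ha, key a ha⟩
    · rintro ⟨b, ⟨ha, rfl⟩, hb, rfl⟩
      exact ⟨_, ⟨ha, rfl⟩, isAtom_act_of_isAtom (hg.perm σ hσG) ha, (key a ha).symm⟩

instance inPar_group {π : M} (hG : IsPermGroup atoms G) (hπ : π ∈ₐ G) :
    InPar (actAut hG hπ).fix G := ⟨act_group hG hπ⟩

instance inPar_filter {π : M} (hG : IsPermGroup atoms G) (hπ : π ∈ₐ G) :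
    InPar (actAut hG hπ).fix F := ⟨act_filter F hπ⟩

end Setting

/-! ### Hereditarily symmetric elements -/

section HS
variable {M : Type u} [AtomStr M] [hM : IsZFCA M]

/-- `x ∩ y`. -/
noncomputable def inter (x y : M) : M := sep x fun z => z ∈ₐ y

/-- `x ∖ y`. -/
noncomputable def diff (x y : M) : M := sep x fun z => ¬ z ∈ₐ y

@[simp] theorem isSet_inter (x y : M) : IsSet (inter x y) := isSet_sep _ _
@[simp] theorem mem_inter {x y z : M} : z ∈ₐ inter x y ↔ z ∈ₐ x ∧ z ∈ₐ y := mem_sep _ _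
@[simp] theorem isSet_diff (x y : M) : IsSet (diff x y) := isSet_sep _ _
@[simp] theorem mem_diff {x y z : M} : z ∈ₐ diff x y ↔ z ∈ₐ x ∧ ¬ z ∈ₐ y := mem_sep _ _

theorem isInter_iff {d x y : M} : IsInter d x y ↔ d = inter x y :=
  ⟨fun h => ext_iff' h.1 (isSet_inter _ _) fun z => (h.2 z).trans mem_inter.symm,
    fun h => h ▸ ⟨isSet_inter _ _, fun _ => mem_inter⟩⟩

theorem isDiff_iff {d x y : M} : IsDiff d x y ↔ d = diff x y :=
  ⟨fun h => ext_iff' h.1 (isSet_diff _ _) fun z => (h.2 z).trans mem_diff.symm,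
    fun h => h ▸ ⟨isSet_diff _ _, fun _ => mem_diff⟩⟩

theorem inter_subset_left (x y : M) : IsSubset (inter x y) x :=
  ⟨isSet_inter _ _, fun _ h => (mem_inter.1 h).1⟩

theorem diff_subset (x y : M) : IsSubset (diff x y) x :=
  ⟨isSet_diff _ _, fun _ h => (mem_diff.1 h).1⟩

/-- `x` is fixed by all elements of `K`. -/
class Fixes (K x : M) : Prop where
  out : ∀ π, π ∈ₐ K → act π x = x

theorem fixes_iff {K x : M} : Fixes K x ↔ ∀ π, π ∈ₐ K → act π x = x := ⟨fun h => h.1, fun h => ⟨h⟩⟩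

section Inst
variable {Γ : Type u} [c : Ctx M Γ] {A : Set M} (s t : Γ → M) [DF A s] [DF A t]

instance df_inter : DF A fun p => inter (s p) (t p) := by
  refine df_subst₂ s t ?_
  unfold inter; infer_instance

instance df_diff : DF A fun p => diff (s p) (t p) := by
  refine df_subst₂ s t ?_
  unfold diff; infer_instance

instance dfn_fixes : Dfn A fun p => Fixes (s p) (t p) := by
  refine dfn_subst₂ s t ?_
  simp only [fixes_iff]; infer_instance
end Inst

variable {G F : M} [hS : PermSetting G F]

/-- The automorphism of the universe given by an element of a member of the normal filter. -/
noncomputable def filterAut {K π : M} (hK : K ∈ₐ F) (hπ : π ∈ₐ K) : Aut M :=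
  actAut hS.group (mem_of_mem_filter (G := G) hK hπ)

instance inPar_filterAut_group {K π : M} (hK : K ∈ₐ F) (hπ : π ∈ₐ K) :
    InPar (filterAut (G := G) hK hπ).fix G := inPar_group _ _

instance inPar_filterAut_filter {K π : M} (hK : K ∈ₐ F) (hπ : π ∈ₐ K) :
    InPar (filterAut (G := G) hK hπ).fix F := inPar_filter _ _ _

instance inPar_filterAut {K π x : M} [h : Fixes K x] (hK : K ∈ₐ F) (hπ : π ∈ₐ K) :
    InPar (filterAut (G := G) hK hπ).fix x := ⟨h.out π hπ⟩

variable (G) in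
/-- A set is fixed by `K` if it is definable from parameters that are fixed by `K`. -/
theorem Fixes.of_df {K x : M} (hK : K ∈ₐ F)
    (h : ∀ π, ∀ hπ : π ∈ₐ K, DF (filterAut (G := G) hK hπ).fix fun _ : Nil M => x) : Fixes K x :=
  ⟨fun π hπ => have := h π hπ; (filterAut (G := G) hK hπ).fixed x⟩

theorem Fixes.mono {K L x : M} (h : Fixes L x) (hKL : IsSubset K L) : Fixes K x :=
  ⟨fun π hπ => h.out π (hKL.2 π hπ)⟩

include hS in
variable (G) in
theorem exists_mem_filter_subset {K L : M} (hK : K ∈ₐ F) (hL : L ∈ₐ F) :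
    ∃ J, J ∈ₐ F ∧ IsSubset J K ∧ IsSubset J L := by
  obtain ⟨J, hJ, h⟩ := hS.filter.inter_mem K L hK hL
  exact ⟨J, h, ⟨hJ.1, fun z hz => ((hJ.2 z).1 hz).1⟩, ⟨hJ.1, fun z hz => ((hJ.2 z).1 hz).2⟩⟩

variable (F) in
include hS in
theorem actsTo_iff_of_mem {π x y : M} (hπ : π ∈ₐ G) : ActsTo π x y ↔ act π x = y :=
  actsTo_iff ((hS.group).perm π hπ)

/-- By upward closure of the filter, it suffices that some member of it fixes `x`. -/
theorem isSymmetric_iff {x : M} : IsSymmetric G F x ↔ ∃ K, K ∈ₐ F ∧ Fixes K x := by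
  constructor
  · rintro ⟨H, hH, h⟩
    exact ⟨H, hH, ⟨fun π hπ => (actsTo_iff_of_mem F ((h π).1 hπ).1).1 ((h π).1 hπ).2⟩⟩
  · rintro ⟨K, hK, h⟩
    have hg := hS.group
    have hmem : ∀ π, π ∈ₐ sep G (fun π => act π x = x) ↔ π ∈ₐ G ∧ act π x = x := fun π => mem_sep _ _
    refine ⟨sep G fun π => act π x = x, ?_, fun π => ?_⟩
    · refine hS.filter.upward K _ hK ⟨⟨isSet_sep _ _, ?_, ?_, ?_, ?_⟩, isSet_sep _ _, ?_⟩
        ⟨(group_of_mem G hK).isSet, ?_⟩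
      · exact fun π hπ => hg.perm π ((hmem π).1 hπ).1
      · obtain ⟨e, he, h1⟩ := hg.one_mem
        exact ⟨e, (hmem e).2 ⟨he, act_one (hg.perm e he) h1 x⟩, h1⟩
      · intro ρ σ hρ hσ
        rw [hmem] at hρ hσ
        obtain ⟨τ, hτ, h1⟩ := hg.mul_mem ρ σ hρ.1 hσ.1
        refine ⟨τ, (hmem τ).2 ⟨hτ, ?_⟩, h1⟩
        rw [act_comp (hg.perm σ hσ.1) (hg.perm ρ hρ.1) (hg.perm τ hτ) h1, hσ.2, hρ.2]
      · intro ρ hρ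
        rw [hmem] at hρ
        obtain ⟨σ, hσ, h1⟩ := hg.inv_mem ρ hρ.1
        refine ⟨σ, (hmem σ).2 ⟨hσ, ?_⟩, h1⟩
        conv_lhs => rw [← hρ.2]
        exact act_inv (hg.perm ρ hρ.1) (hg.perm σ hσ) h1 x
      · exact fun π hπ => ((hmem π).1 hπ).1
      · exact fun π hπ => (hmem π).2 ⟨mem_of_mem_filter hK hπ, h.out π hπ⟩
    · rw [hmem]
      exact and_congr_right fun hπ => (actsTo_iff_of_mem F hπ).symm

variable (G F) in
/-- `x` is hereditarily symmetric, i.e. it belongs to the permutation model. -/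
abbrev HS (x : M) : Prop := IsHereditarilySymmetric G F x

theorem HS.mem {x z : M} (h : HS G F x) (hz : z ∈ₐ x) : HS G F z := by
  obtain ⟨t, ht, hx, hs⟩ := h
  exact ⟨t, ht, ht.2 x hx z hz, hs⟩

theorem HS.fixes {x : M} (h : HS G F x) : ∃ K, K ∈ₐ F ∧ Fixes K x := by
  obtain ⟨t, ht, hx, hs⟩ := h
  exact isSymmetric_iff.1 (hs x hx)

theorem hs_of_fixes {K x : M} (hK : K ∈ₐ F) (h : Fixes K x) (hx : ∀ z, z ∈ₐ x → HS G F z) :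
    HS G F x := by
  obtain ⟨t, ht, hxt⟩ := exists_transitive x
  have hmem : ∀ z, z ∈ₐ sep t (fun z => z = x ∨ HS G F z) ↔ z ∈ₐ t ∧ (z = x ∨ HS G F z) :=
    fun z => mem_sep _ _
  refine ⟨sep t fun z => z = x ∨ HS G F z, ⟨isSet_sep _ _, ?_⟩, (hmem x).2 ⟨hxt, Or.inl rfl⟩, ?_⟩
  · intro z hz w hw
    rw [hmem] at hz ⊢
    refine ⟨ht.2 z hz.1 w hw, Or.inr ?_⟩
    rcases hz.2 with rfl | h
    · exact hx w hw
    · exact h.mem hw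
  · intro z hz
    rcases ((hmem z).1 hz).2 with rfl | h'
    · exact isSymmetric_iff.2 ⟨K, hK, h⟩
    · exact isSymmetric_iff.2 h'.fixes

/-- Sets of hereditarily symmetric elements that are definable from parameters fixed by a member
of the filter are hereditarily symmetric. -/
theorem hs_of_df {K x : M} (hK : K ∈ₐ F)
    (h : ∀ π, ∀ hπ : π ∈ₐ K, DF (filterAut (G := G) hK hπ).fix fun _ : Nil M => x)
    (hx : ∀ z, z ∈ₐ x → HS G F z) : HS G F x :=
  hs_of_fixes hK (Fixes.of_df G hK h) hx

theorem exists_fixes₂ {x y : M} (hx : HS G F x) (hy : HS G F y) :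
    ∃ K, K ∈ₐ F ∧ Fixes K x ∧ Fixes K y := by
  obtain ⟨K, hK, h1⟩ := hx.fixes
  obtain ⟨L, hL, h2⟩ := hy.fixes
  obtain ⟨J, hJ, hJK, hJL⟩ := exists_mem_filter_subset G hK hL
  exact ⟨J, hJ, h1.mono hJK, h2.mono hJL⟩

theorem hs_emp : HS G F (emp : M) :=
  hs_of_df hS.filter.top_mem (fun _ _ => inferInstance) fun z hz => absurd hz (not_mem_emp z)

theorem HS.upair {x y : M} (hx : HS G F x) (hy : HS G F y) : HS G F (upair x y) := by
  obtain ⟨K, hK, h1, h2⟩ := exists_fixes₂ hx hy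
  refine hs_of_df hK (fun _ _ => inferInstance) fun z hz => ?_
  rcases mem_upair.1 hz with rfl | rfl
  · exact hx
  · exact hy

theorem HS.pair {x y : M} (hx : HS G F x) (hy : HS G F y) : HS G F (pair x y) :=
  (hx.upair hx).upair (hx.upair hy)

theorem HS.of_pair {x y : M} (h : HS G F (ZFA.pair x y)) : HS G F x ∧ HS G F y := by
  have h1 : HS G F (ZFA.upair x y) := h.mem (mem_upair.2 (Or.inr rfl))
  exact ⟨h1.mem (mem_upair.2 (Or.inl rfl)), h1.mem (mem_upair.2 (Or.inr rfl))⟩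

theorem HS.ins {a s : M} (ha : HS G F a) (hs : HS G F s) : HS G F (ins a s) := by
  obtain ⟨K, hK, h1, h2⟩ := exists_fixes₂ ha hs
  refine hs_of_df hK (fun _ _ => inferInstance) fun z hz => ?_
  rcases mem_ins.1 hz with hz | rfl
  · exact hs.mem hz
  · exact ha

theorem HS.inter {x y : M} (hx : HS G F x) (hy : HS G F y) : HS G F (inter x y) := by
  obtain ⟨K, hK, h1, h2⟩ := exists_fixes₂ hx hy
  exact hs_of_df hK (fun _ _ => inferInstance) fun z hz => hx.mem (mem_inter.1 hz).1

theorem HS.diff {x y : M} (hx : HS G F x) (hy : HS G F y) : HS G F (diff x y) := by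
  obtain ⟨K, hK, h1, h2⟩ := exists_fixes₂ hx hy
  exact hs_of_df hK (fun _ _ => inferInstance) fun z hz => hx.mem (mem_diff.1 hz).1

theorem hs_nat {n : M} (hn : IsNat n) : HS G F n :=
  nat_induction (P := fun n => HS G F n) hs_emp (fun _ _ h => h.ins h) hn

theorem hs_omega : HS G F (omega : M) :=
  hs_of_df hS.filter.top_mem (fun _ _ => inferInstance) fun _ hz => hs_nat (mem_omega.1 hz)

/-- Finite subsets of the permutation model belong to it. -/
theorem hs_finite {s : M} (hs : IsSet s) (hf : IsFinite s) (h : ∀ z, z ∈ₐ s → HS G F z) :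
    HS G F s := by
  refine finite_induction (P := fun s => (∀ z, z ∈ₐ s → HS G F z) → HS G F s) (fun _ => hs_emp)
    ?_ hs hf h
  intro s a _ _ _ ih h
  exact (h a (mem_ins.2 (Or.inr rfl))).ins (ih fun z hz => h z (mem_ins.2 (Or.inl hz)))

end HS

/-! ### Absoluteness between the permutation model and the universe -/

section Abs
variable {M : Type u} [AtomStr M] [hM : IsZFCA M] {G F : M} [hS : PermSetting G F]

namespace PermModel

/-- An element of the permutation model, as an element of the universe. -/
def val (x : PermModel G F) : M := x.1

theorem hs (x : PermModel G F) : HS G F x.val := x.2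

theorem val_inj {x y : PermModel G F} : x.val = y.val ↔ x = y :=
  ⟨fun h => Subtype.ext h, fun h => h ▸ rfl⟩

/-- Quantifiers over the elements of `x` are the same in the permutation model. -/
theorem forall_mem {x : PermModel G F} {P : M → Prop} :
    (∀ z : PermModel G F, z ∈ₐ x → P z.val) ↔ ∀ z : M, z ∈ₐ x.val → P z :=
  ⟨fun h z hz => h ⟨z, HS.mem x.hs hz⟩ hz, fun h z hz => h z.val hz⟩

theorem isSubset_iff {x y : PermModel G F} : IsSubset x y ↔ IsSubset x.val y.val :=
  and_congr_right fun _ => forall_mem (P := fun z => z ∈ₐ y.val)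

/-- A set of the permutation model is determined, in the permutation model as in the universe, by a
property that characterizes its elements. -/
theorem forall_mem_iff {x : PermModel G F} {P : M → Prop} (hP : ∀ z, P z → HS G F z) :
    (∀ z : PermModel G F, z ∈ₐ x ↔ P z.val) ↔ ∀ z : M, z ∈ₐ x.val ↔ P z :=
  ⟨fun h z => ⟨fun hz => (h ⟨z, HS.mem x.hs hz⟩).1 hz, fun hz => (h ⟨z, hP z hz⟩).2 hz⟩,
    fun h z => h z.val⟩

theorem isEmptySet_iff {x : PermModel G F} : IsEmptySet x ↔ x.val = emp := by
  rw [← ZFA.isEmptySet_iff]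
  exact and_congr_right fun _ => forall_mem (P := fun _ => False)

theorem isUPair_iff {p a b : PermModel G F} : IsUPair p a b ↔ p.val = upair a.val b.val := by
  rw [← ZFA.isUPair_iff]
  refine and_congr_right fun _ => ?_
  rw [← forall_mem_iff (P := fun z => z = a.val ∨ z = b.val)]
  · simp only [val_inj]
  · rintro z (rfl | rfl)
    exacts [a.hs, b.hs]

theorem isPair_iff {p a b : PermModel G F} : IsPair p a b ↔ p.val = pair a.val b.val := by
  simp only [IsPair, isUPair_iff, pair]
  constructor
  · rintro ⟨s, d, hs, hd, hp⟩
    rw [hp, hs, hd]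
  · intro h
    exact ⟨⟨_, HS.upair a.hs a.hs⟩, ⟨_, HS.upair a.hs b.hs⟩, rfl, rfl, h⟩

theorem isSucc_iff {s n : PermModel G F} : IsSucc s n ↔ s.val = ins n.val n.val := by
  rw [← ZFA.isSucc_iff]
  refine and_congr_right fun _ => ?_
  rw [← forall_mem_iff (P := fun z => z ∈ₐ n.val ∨ z = n.val)]
  · simp only [val_inj]; rfl
  · rintro z (hz | rfl)
    exacts [HS.mem n.hs hz, n.hs]

theorem isInductive_iff {w : PermModel G F} : IsInductive w ↔ IsInductive w.val := by
  rw [ZFA.isInductive_iff (w := w.val)]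
  simp only [IsInductive, isEmptySet_iff, isSucc_iff]
  refine and_congr_right fun _ => and_congr ?_ ?_
  · exact ⟨fun ⟨e, he, h⟩ => he ▸ h, fun h => ⟨⟨emp, hs_emp⟩, rfl, h⟩⟩
  · rw [← forall_mem (P := fun n => ins n n ∈ₐ w.val)]
    refine forall₂_congr fun n _ => ?_
    exact ⟨fun ⟨s, hs, h⟩ => hs ▸ h, fun h => ⟨⟨_, HS.ins n.hs n.hs⟩, rfl, h⟩⟩

theorem isNat_iff {n : PermModel G F} : IsNat n ↔ IsNat n.val := by
  constructor
  · intro h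
    refine mem_omega.1 (h ⟨omega, hs_omega⟩ (isInductive_iff.2 ?_))
    exact ZFA.isInductive_iff.2
      ⟨isSet_omega, mem_omega.2 isNat_emp, fun n hn => mem_omega.2 (mem_omega.1 hn).succ⟩
  · exact fun h w hw => h w.val (isInductive_iff.1 hw)

theorem app_iff {f a b : PermModel G F} : App f a b ↔ App f.val a.val b.val := by
  rw [ZFA.app_iff (f := f.val)]
  simp only [App, isPair_iff]
  exact ⟨fun ⟨p, hp, h⟩ => h ▸ hp, fun h => ⟨⟨_, HS.pair a.hs b.hs⟩, h, rfl⟩⟩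

theorem hs_of_app {f : PermModel G F} {a b : M} (h : App f.val a b) : HS G F a ∧ HS G F b :=
  (HS.mem f.hs (ZFA.app_iff.1 h)).of_pair

theorem isBij_iff {f x y : PermModel G F} : IsBij f x y ↔ IsBij f.val x.val y.val := by
  simp only [ZFA.isBij_iff]
  refine and_congr_right fun _ => and_congr ?_ (and_congr ?_ ?_)
  · rw [← forall_mem (P := fun p => ∃ a b, a ∈ₐ x.val ∧ b ∈ₐ y.val ∧ IsPair p a b)]
    refine forall₂_congr fun p _ => ⟨?_, ?_⟩
    · rintro ⟨a, b, ha, hb, h⟩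
      exact ⟨a.val, b.val, ha, hb, ZFA.isPair_iff.2 (isPair_iff.1 h)⟩
    · rintro ⟨a, b, ha, hb, h⟩
      exact ⟨⟨a, HS.mem x.hs ha⟩, ⟨b, HS.mem y.hs hb⟩, ha, hb, isPair_iff.2 (ZFA.isPair_iff.1 h)⟩
  · rw [← forall_mem (P := fun a => ∃! b, App f.val a b)]
    refine forall₂_congr fun a _ => ?_
    simp only [app_iff]
    constructor
    · rintro ⟨b, hb, h⟩
      exact ⟨b.val, hb, fun c hc => congrArg PermModel.val (h ⟨c, (hs_of_app hc).2⟩ hc)⟩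
    · rintro ⟨b, hb, h⟩
      exact ⟨⟨b, (hs_of_app hb).2⟩, hb, fun c hc => val_inj.1 (h c.val hc)⟩
  · rw [← forall_mem (P := fun b => ∃! a, App f.val a b)]
    refine forall₂_congr fun b _ => ?_
    simp only [app_iff]
    constructor
    · rintro ⟨a, ha, h⟩
      exact ⟨a.val, ha, fun c hc => congrArg PermModel.val (h ⟨c, (hs_of_app hc).1⟩ hc)⟩
    · rintro ⟨a, ha, h⟩
      exact ⟨⟨a, (hs_of_app ha).1⟩, ha, fun c hc => val_inj.1 (h c.val hc)⟩

/-- Finiteness is absolute: a bijection with a natural number is itself a finite set. -/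
theorem isFinite_iff {x : PermModel G F} : IsFinite x ↔ IsFinite x.val := by
  constructor
  · rintro ⟨n, f, hn, hf⟩
    exact ⟨n.val, f.val, isNat_iff.1 hn, isBij_iff.1 hf⟩
  · rintro ⟨n, f, hn, hf⟩
    have hN : HS G F n := hs_nat hn
    suffices h : HS G F f from ⟨⟨n, hN⟩, ⟨f, h⟩, isNat_iff.2 hn, isBij_iff.2 hf⟩
    have hpair : ∀ p, p ∈ₐ f → ∃ a b, a ∈ₐ x.val ∧ b ∈ₐ n ∧ p = pair a b := by
      intro p hp
      obtain ⟨a, b, ha, hb, h⟩ := hf.pairs p hp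
      exact ⟨a, b, ha, hb, ZFA.isPair_iff.1 h⟩
    have hfin : IsFinite (sep x.val fun a => ∃ b, App f a b) := by
      by_cases hx : IsSet x.val
      · exact IsFinite.subset ⟨n, f, hn, hf⟩ hx ⟨isSet_sep _ _, fun z hz => ((mem_sep _ _).1 hz).1⟩
      · rw [eq_emp (isSet_sep _ _) fun z hz => hx (isSet_of_mem ((mem_sep _ _).1 hz).1)]
        exact isFinite_emp
    have himg := hfin.img (isSet_sep _ _) fun a => pair a (app f a)
    refine hs_finite hf.isSet (himg.subset (isSet_img _ _) ⟨hf.isSet, fun p hp => ?_⟩) ?_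
    · obtain ⟨a, b, ha, -, rfl⟩ := hpair p hp
      have hab := ZFA.app_iff.2 hp
      rw [mem_img]
      exact ⟨a, (mem_sep _ _).2 ⟨ha, b, hab⟩, by rw [app_eq hab (hf.left a ha)]⟩
    · intro p hp
      obtain ⟨a, b, ha, hb, rfl⟩ := hpair p hp
      exact HS.pair (HS.mem x.hs ha) (HS.mem hN hb)

theorem isInter_iff {d x y : PermModel G F} : IsInter d x y ↔ d.val = inter x.val y.val := by
  rw [← ZFA.isInter_iff]
  exact and_congr_right fun _ => forall_mem_iff (P := fun z => z ∈ₐ x.val ∧ z ∈ₐ y.val)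
    fun z hz => HS.mem x.hs hz.1

theorem isDiff_iff {d x y : PermModel G F} : IsDiff d x y ↔ d.val = diff x.val y.val := by
  rw [← ZFA.isDiff_iff]
  exact and_congr_right fun _ => forall_mem_iff (P := fun z => z ∈ₐ x.val ∧ ¬ z ∈ₐ y.val)
    fun z hz => HS.mem x.hs hz.1

end PermModel

/-- The intersection of the elements of `s`, within `x`. -/
noncomputable def bInter (x s : M) : M := sep x fun z => ∀ u, u ∈ₐ s → z ∈ₐ u

@[simp] theorem isSet_bInter (x s : M) : IsSet (bInter x s) := isSet_sep _ _
@[simp] theorem mem_bInter {x s z : M} : z ∈ₐ bInter x s ↔ z ∈ₐ x ∧ ∀ u, u ∈ₐ s → z ∈ₐ u :=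
  mem_sep _ _

instance df_bInter {Γ : Type u} [c : Ctx M Γ] {A : Set M} (s t : Γ → M) [DF A s] [DF A t] :
    DF A fun p => bInter (s p) (t p) := by
  refine df_subst₂ s t ?_
  unfold bInter; infer_instance

theorem hasFIP_iff' {Φ x : M} : HasFIP Φ x ↔ IsSet x ∧ IsSet Φ ∧ (∀ u, u ∈ₐ Φ → IsSubset u x) ∧
    ∀ s, IsSubset s Φ → IsFinite s → ¬ IsFinite (bInter x s) := by
  rw [hasFIP_iff]
  refine and_congr_right fun _ => and_congr_right fun _ => and_congr_right fun _ =>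
    forall₃_congr fun s _ _ => ?_
  constructor
  · rintro ⟨i, hi, h, hf⟩
    rwa [ext_iff' (isSet_bInter _ _) hi fun z => mem_bInter.trans (h z).symm]
  · exact fun h => ⟨_, isSet_bInter x s, fun _ => mem_bInter, h⟩

theorem HS.bInter {x s : M} (hx : HS G F x) (hs : HS G F s) : HS G F (bInter x s) := by
  obtain ⟨K, hK, h1, h2⟩ := exists_fixes₂ hx hs
  exact hs_of_df hK (fun _ _ => inferInstance) fun z hz => hx.mem (mem_bInter.1 hz).1

theorem PermModel.hasFIP_iff {Φ x : PermModel G F} : HasFIP Φ x ↔ HasFIP Φ.val x.val := by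
  rw [ZFA.hasFIP_iff, hasFIP_iff']
  refine and_congr_right fun _ => and_congr_right fun hΦ => and_congr ?_ ?_
  · rw [← forall_mem (P := fun u => IsSubset u x.val)]
    exact forall₂_congr fun u _ => isSubset_iff
  · have hi : ∀ s i : PermModel G F, (∀ z : PermModel G F, z ∈ₐ i ↔ z ∈ₐ x ∧
        ∀ u : PermModel G F, u ∈ₐ s → z ∈ₐ u) ↔
        ∀ z : M, z ∈ₐ i.val ↔ z ∈ₐ x.val ∧ ∀ u : M, u ∈ₐ s.val → z ∈ₐ u := by
      intro s i
      rw [← forall_mem_iff (P := fun z => z ∈ₐ x.val ∧ ∀ u : M, u ∈ₐ s.val → z ∈ₐ u)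
        fun z hz => HS.mem x.hs hz.1]
      refine forall_congr' fun z => iff_congr Iff.rfl (and_congr Iff.rfl ?_)
      exact forall_mem (P := fun u => z.val ∈ₐ u)
    constructor
    · intro h s hs hf
      have hsN : HS G F s := hs_finite hs.1 hf fun z hz => HS.mem Φ.hs (hs.2 z hz)
      obtain ⟨i, hi1, hi2, hi3⟩ := h ⟨s, hsN⟩ (isSubset_iff.2 hs) (isFinite_iff.2 hf)
      rw [isFinite_iff] at hi3
      have hi4 : ∀ z : M, z ∈ₐ i.val ↔ z ∈ₐ x.val ∧ ∀ u : M, u ∈ₐ s → z ∈ₐ u := (hi _ _).1 hi2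
      rwa [← ext_iff' (isSet_bInter x.val s) (show IsSet i.val from hi1) fun z =>
        mem_bInter.trans (hi4 z).symm] at hi3
    · intro h s hs hf
      refine ⟨⟨bInter x.val s.val, HS.bInter x.hs s.hs⟩, isSet_bInter _ _,
        (hi _ _).2 fun _ => mem_bInter, ?_⟩
      exact isFinite_iff.not.2 <| h s.val (isSubset_iff.1 hs) (isFinite_iff.1 hf)

variable (G F) in
/-- In the permutation model, `Φ` is a filter on `x`. -/
structure IsFilterIn (Φ x : M) : Prop where
  isSet : IsSet Φ
  subset : ∀ u, u ∈ₐ Φ → IsSubset u x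
  univ_mem : x ∈ₐ Φ
  nonempty : ∀ u, u ∈ₐ Φ → ∃ z, z ∈ₐ u
  inter_mem : ∀ u v, u ∈ₐ Φ → v ∈ₐ Φ → inter u v ∈ₐ Φ
  upward : ∀ u v, u ∈ₐ Φ → HS G F v → IsSubset v x → (∀ z, z ∈ₐ u → z ∈ₐ v) → v ∈ₐ Φ

variable (G F) in
/-- In the permutation model, `U` is an ultrafilter on `x`. -/
structure IsUltrafilterIn (U x : M) : Prop where
  filter : IsFilterIn G F U x
  mem_or_diff_mem : ∀ y, HS G F y → IsSubset y x → y ∈ₐ U ∨ diff x y ∈ₐ U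

omit hS in
theorem isFilterIn_iff {Φ x : M} : IsFilterIn G F Φ x ↔
    IsSet Φ ∧ (∀ u, u ∈ₐ Φ → IsSubset u x) ∧ x ∈ₐ Φ ∧ (∀ u, u ∈ₐ Φ → ∃ z, z ∈ₐ u) ∧
    (∀ u v, u ∈ₐ Φ → v ∈ₐ Φ → inter u v ∈ₐ Φ) ∧
    ∀ u v, u ∈ₐ Φ → HS G F v → IsSubset v x → (∀ z, z ∈ₐ u → z ∈ₐ v) → v ∈ₐ Φ :=
  ⟨fun ⟨h1, h2, h3, h4, h5, h6⟩ => ⟨h1, h2, h3, h4, h5, h6⟩,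
    fun ⟨h1, h2, h3, h4, h5, h6⟩ => ⟨h1, h2, h3, h4, h5, h6⟩⟩

omit hS in
theorem isUltrafilterIn_iff {U x : M} : IsUltrafilterIn G F U x ↔ IsFilterIn G F U x ∧
    ∀ y, HS G F y → IsSubset y x → y ∈ₐ U ∨ diff x y ∈ₐ U :=
  ⟨fun ⟨h1, h2⟩ => ⟨h1, h2⟩, fun ⟨h1, h2⟩ => ⟨h1, h2⟩⟩

section Inst
variable {Γ : Type u} [c : Ctx M Γ] {A : Set M} (s t : Γ → M) [DF A s] [DF A t]
  (a b : M) [InPar A a] [InPar A b]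

instance dfn_isFilterIn : Dfn A fun p => IsFilterIn a b (s p) (t p) := by
  refine dfn_subst₂ s t ?_
  simp only [isFilterIn_iff]; infer_instance

instance dfn_isUltrafilterIn : Dfn A fun p => IsUltrafilterIn a b (s p) (t p) := by
  refine dfn_subst₂ s t ?_
  simp only [isUltrafilterIn_iff]; infer_instance
end Inst

theorem PermModel.isFilterOn_iff {Φ x : PermModel G F} :
    IsFilterOn Φ x ↔ IsFilterIn G F Φ.val x.val := by
  have hsub : (∀ u : PermModel G F, u ∈ₐ Φ → IsSubset u x) ↔ ∀ u, u ∈ₐ Φ.val → IsSubset u x.val := by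
    rw [← forall_mem (P := fun u => IsSubset u x.val)]
    exact forall₂_congr fun u _ => isSubset_iff
  constructor
  · intro h
    refine ⟨h.isSet, hsub.1 h.subset, h.univ_mem, fun u hu => ?_, fun u v hu hv => ?_,
      fun u v hu hv hvx huv => ?_⟩
    · obtain ⟨z, hz⟩ := h.nonempty ⟨u, HS.mem Φ.hs hu⟩ hu
      exact ⟨z.val, hz⟩
    · obtain ⟨w, hw, hwΦ⟩ := h.inter_mem ⟨u, HS.mem Φ.hs hu⟩ ⟨v, HS.mem Φ.hs hv⟩ hu hv
      exact (isInter_iff.1 hw) ▸ hwΦ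
    · exact h.upward ⟨u, HS.mem Φ.hs hu⟩ ⟨v, hv⟩ hu (isSubset_iff.2 hvx) fun z hz => huv z.val hz
  · rintro ⟨h1, h2, h3, h4, h5, h6⟩
    refine ⟨h1, hsub.2 h2, h3, fun u hu => ?_, fun u v hu hv => ?_, fun u v hu hvx huv => ?_⟩
    · obtain ⟨z, hz⟩ := h4 u.val hu
      exact ⟨⟨z, HS.mem u.hs hz⟩, hz⟩
    · exact ⟨⟨_, HS.inter u.hs v.hs⟩, isInter_iff.2 rfl, h5 u.val v.val hu hv⟩
    · exact h6 u.val v.val hu v.hs (isSubset_iff.1 hvx) fun z hz => huv ⟨z, HS.mem u.hs hz⟩ hz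

theorem PermModel.isUltrafilterOn_iff {U x : PermModel G F} :
    IsUltrafilterOn U x ↔ IsUltrafilterIn G F U.val x.val := by
  constructor
  · intro h
    refine ⟨isFilterOn_iff.1 h.toIsFilterOn, fun y hy hyx => ?_⟩
    rcases h.mem_or_diff_mem ⟨y, hy⟩ (isSubset_iff.2 hyx) with h | ⟨d, hd, h⟩
    · exact Or.inl h
    · exact Or.inr ((isDiff_iff.1 hd) ▸ h)
  · rintro ⟨h1, h2⟩
    refine ⟨isFilterOn_iff.2 h1, fun y hyx => ?_⟩
    rcases h2 y.val y.hs (isSubset_iff.1 hyx) with h | h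
    · exact Or.inl h
    · exact Or.inr ⟨⟨_, HS.diff x.hs y.hs⟩, isDiff_iff.2 rfl, h⟩

/-- `BPI` in the permutation model, as a statement about the universe. -/
theorem bpi_iff : BPI (PermModel G F) ↔ ∀ x Φ, HS G F x → HS G F Φ → IsSet x →
    IsFilterIn G F Φ x → ∃ U, HS G F U ∧ IsUltrafilterIn G F U x ∧ ∀ u, u ∈ₐ Φ → u ∈ₐ U := by
  constructor
  · intro h x Φ hx hΦ hxs hf
    obtain ⟨U, hU, hΦU⟩ := h ⟨x, hx⟩ ⟨Φ, hΦ⟩ hxs (PermModel.isFilterOn_iff.2 hf)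
    exact ⟨U.val, U.hs, PermModel.isUltrafilterOn_iff.1 hU,
      fun u hu => hΦU ⟨u, hΦ.mem hu⟩ hu⟩
  · intro h x Φ hxs hf
    obtain ⟨U, hUs, hU, hΦU⟩ := h x.val Φ.val x.hs Φ.hs hxs (PermModel.isFilterOn_iff.1 hf)
    exact ⟨⟨U, hUs⟩, PermModel.isUltrafilterOn_iff.2 hU, fun u hu => hΦU u.val hu⟩

/-- The filter extension property with finiteness and the finite intersection property evaluated in
the universe, which is equivalent by absoluteness. -/
theorem filterExtensionProperty_iff : FilterExtensionProperty G F ↔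
    ∃ B : M, IsSubset B F ∧ (∀ H, H ∈ₐ F → ∃ K, K ∈ₐ B ∧ IsSubset K H) ∧
      ∀ K, K ∈ₐ B → ∀ Φ x y, HS G F Φ → HS G F x → HS G F y → Fixes K Φ → Fixes K x →
        HasFIP Φ x → IsSubset y x → ∃ y', (y' = y ∨ y' = diff x y) ∧
          ∃ w, HS G F w ∧ (∀ z, z ∈ₐ w ↔ z ∈ₐ Φ ∨ ∃ π, π ∈ₐ K ∧ act π y' = z) ∧
            HasFIP w x := by
  refine exists_congr fun B => and_congr_right fun hB => and_congr_right fun _ =>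
    forall₂_congr fun K hK => ?_
  have hKG : ∀ π, π ∈ₐ K → π ∈ₐ G := fun π hπ => mem_of_mem_filter (hB.2 K hK) hπ
  have hact : ∀ {π x y : M}, π ∈ₐ K → (ActsTo π x y ↔ act π x = y) :=
    fun hπ => actsTo_iff_of_mem F (hKG _ hπ)
  constructor
  · intro h Φ x y hΦ hx hy h1 h2 hfip hyx
    obtain ⟨y', hy', w, hw, hw'⟩ := h ⟨Φ, hΦ⟩ ⟨x, hx⟩ ⟨y, hy⟩
      (fun π hπ => ⟨hKG π hπ, (hact hπ).2 (h1.out π hπ), (hact hπ).2 (h2.out π hπ)⟩)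
      (PermModel.hasFIP_iff.2 hfip) (PermModel.isSubset_iff.2 hyx)
    refine ⟨y'.val, hy'.imp (congrArg PermModel.val) PermModel.isDiff_iff.1, w.val, w.hs, fun z => ?_,
      PermModel.hasFIP_iff.1 hw'⟩
    refine (hw z).trans ?_
    exact or_congr Iff.rfl (exists_congr fun π => and_congr_right fun hπ => hact hπ)
  · intro h Φ x y hπ hfip hyx
    obtain ⟨y', hy', w, hwN, hw, hw'⟩ := h Φ.val x.val y.val Φ.hs x.hs y.hs
      ⟨fun π h => (hact h).1 (hπ π h).2.1⟩ ⟨fun π h => (hact h).1 (hπ π h).2.2⟩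
      (PermModel.hasFIP_iff.1 hfip) (PermModel.isSubset_iff.1 hyx)
    have hy'N : HS G F y' := by
      rcases hy' with rfl | rfl
      exacts [y.hs, HS.diff x.hs y.hs]
    refine ⟨⟨y', hy'N⟩, hy'.imp PermModel.val_inj.1 PermModel.isDiff_iff.2, ⟨w, hwN⟩, fun z => ?_,
      PermModel.hasFIP_iff.2 hw'⟩
    refine (hw z).trans (or_congr Iff.rfl (exists_congr fun π => and_congr_right fun hπ => ?_))
    exact (hact hπ).symm

end Abs

/-! ### The cumulative hierarchy and collection -/

section Level
variable {M : Type u} [AtomStr M] [hM : IsZFCA M]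

/-- The step of the recursion that defines the cumulative hierarchy. -/
noncomputable def levelStep (_z s : M) : M :=
  cup atoms (sep (pow (sUn s)) fun v => ∃ u, u ∈ₐ s ∧ IsSubset v u)

instance df_levelStep : DF Set.univ fun q : (Nil M × M) × M => levelStep q.1.2 q.2 := by
  unfold levelStep; infer_instance

/-- The level of the cumulative hierarchy above the set of atoms that is indexed by the rank of `z`.
The recursion `level z = A ∪ ⋃ {𝒫 (level w) | w ∈ z}` makes ordinals unnecessary. -/
noncomputable def level (z : M) : M := recFn levelStep z

instance df_level {Γ : Type u} [Ctx M Γ] (s : Γ → M) [DF Set.univ s] :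
    DF Set.univ fun p => level (s p) := df_recFn levelStep s

theorem mem_level {z v : M} :
    v ∈ₐ level z ↔ AtomStr.isAtom v ∨ ∃ w, w ∈ₐ z ∧ IsSubset v (level w) := by
  obtain ⟨s, hs, hm, h⟩ := recFn_eq levelStep z
  rw [level, h, levelStep, mem_cup, mem_atoms, mem_sep, mem_pow]
  refine or_congr Iff.rfl ?_
  constructor
  · rintro ⟨-, u, hu, hv⟩
    obtain ⟨w, hw, rfl⟩ := (hm u).1 hu
    exact ⟨w, hw, hv⟩
  · rintro ⟨w, hw, hv⟩
    have := (hm _).2 ⟨w, hw, rfl⟩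
    exact ⟨⟨hv.1, fun c hc => mem_sUn.2 ⟨_, this, hv.2 c hc⟩⟩, _, this, hv⟩

theorem isSet_level (z : M) : IsSet (level z) := by
  obtain ⟨s, hs, hm, h⟩ := recFn_eq levelStep z
  rw [level, h]
  exact isSet_cup _ _

theorem mem_level_of_mem (z : M) : ∀ v, v ∈ₐ z → v ∈ₐ level z := by
  refine mem_induction (P := fun z => ∀ v, v ∈ₐ z → v ∈ₐ level z) (fun z ih v hv => ?_) z
  rw [mem_level]
  by_cases ha : AtomStr.isAtom v
  · exact Or.inl ha
  · exact Or.inr ⟨v, hv, ha, ih v hv⟩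

/-- The levels are well-behaved: they are linearly ordered by inclusion, strictly smaller ones being
elements. -/
theorem level_subset_or_mem (x y : M) : IsSubset (level x) (level y) ∨ level y ∈ₐ level x := by
  refine mem_induction (P := fun x => ∀ y, IsSubset (level x) (level y) ∨ level y ∈ₐ level x)
    (fun x ih y => ?_) x y
  by_contra! hc
  refine hc.1 ⟨isSet_level x, fun v hv => ?_⟩
  rw [mem_level] at hv ⊢
  refine hv.imp_right fun ⟨x', hx', hvx⟩ => ?_
  by_contra! hy
  refine hc.2 (mem_level.2 (Or.inr ⟨x', hx', isSet_level y, fun c hcy => ?_⟩))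
  rw [mem_level] at hcy ⊢
  refine hcy.imp_right fun ⟨y', hy', hcy⟩ => ?_
  rcases ih x' hx' y' with h | h
  · exact absurd (hvx.trans h) (hy y' hy')
  · rcases mem_level.1 h with h | ⟨w, hw, h⟩
    · exact absurd h (isSet_level y')
    · exact ⟨w, hw, hcy.trans h⟩

/-- There is a least level among those that contain an element with the property `P`. -/
theorem exists_least_level {P : M → Prop} [h : Dfn Set.univ fun q : Nil M × M => P q.2]
    (hP : ∃ b, P b) : ∃ z, (∃ b, b ∈ₐ level z ∧ P b) ∧
      ∀ z', (∃ b, b ∈ₐ level z' ∧ P b) → IsSubset (level z) (level z') := by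
  have hd : ∀ {Γ : Type u} [Ctx M Γ] (t : Γ → M) [DF Set.univ t], Dfn Set.univ fun p => P (t p) :=
    fun t => h.comp₁ t
  by_contra! hc
  have key : ∀ x, ¬ ∃ z, (∃ b, b ∈ₐ level z ∧ P b) ∧ IsSubset (level z) (level x) := by
    refine mem_induction (P := fun x => ¬ ∃ z, (∃ b, b ∈ₐ level z ∧ P b) ∧
      IsSubset (level z) (level x)) fun x ih => ?_
    rintro ⟨z, hz, hzx⟩
    obtain ⟨z', hz', hn⟩ := hc z hz
    have h1 := hzx.2 _ ((level_subset_or_mem z z').resolve_left hn)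
    rcases mem_level.1 h1 with h1 | ⟨w, hw, h1⟩
    · exact isSet_level z' h1
    · exact ih w hw ⟨z', hz', h1⟩
  obtain ⟨b, hb⟩ := hP
  exact key (upair b b) ⟨upair b b, ⟨b, mem_level_of_mem _ _ (by simp), hb⟩,
    isSubset_refl (isSet_level _)⟩

/-- The collection schema, by Scott's trick. The collecting set is a union of levels of the
cumulative hierarchy. -/
theorem exists_collection (R : M → M → Prop)
    [h : Dfn Set.univ fun q : (Nil M × M) × M => R q.1.2 q.2] (x : M) :
    ∃ S, IsSet S ∧ (∀ b, b ∈ₐ S → ∃ z, b ∈ₐ level z ∧ IsSubset (level z) S) ∧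
      ∀ a, a ∈ₐ x → (∃ b, R a b) → ∃ b, b ∈ₐ S ∧ R a b := by
  have hd : ∀ {Γ : Type u} [Ctx M Γ] (s t : Γ → M) [DF Set.univ s] [DF Set.univ t],
    Dfn Set.univ fun p => R (s p) (t p) := fun s t => h.comp₂ s t
  have hr : ∀ a, (∃ b, R a b) → ∃ z, (∃ b, b ∈ₐ level z ∧ R a b) ∧
      theU (fun v => (∃ z, v = level z ∧ ∃ b, b ∈ₐ v ∧ R a b) ∧
        ∀ z, (∃ b, b ∈ₐ level z ∧ R a b) → IsSubset v (level z)) = level z := by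
    intro a ha
    obtain ⟨z, hz, hmin⟩ := exists_least_level ha
    refine ⟨z, hz, theU_eq ⟨⟨z, rfl, hz⟩, hmin⟩ ?_⟩
    rintro _ ⟨⟨z', rfl, hz'⟩, hmin'⟩
    exact (hmin' z hz).antisymm (hmin z' hz')
  refine ⟨sUn (img (sep x fun a => ∃ b, R a b) fun a =>
      theU fun v => (∃ z, v = level z ∧ ∃ b, b ∈ₐ v ∧ R a b) ∧
        ∀ z, (∃ b, b ∈ₐ level z ∧ R a b) → IsSubset v (level z)), isSet_sUn _, fun b hb => ?_,
    fun a ha hab => ?_⟩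
  · obtain ⟨v, hv, hb⟩ := mem_sUn.1 hb
    obtain ⟨a, ha, rfl⟩ := (mem_img _ _).1 hv
    obtain ⟨z, hz, he⟩ := hr a ((mem_sep _ _).1 ha).2
    rw [he] at hb hv
    exact ⟨z, hb, isSet_level z, fun c hc => mem_sUn.2 ⟨_, hv, hc⟩⟩
  · obtain ⟨z, ⟨b, hb, hab'⟩, he⟩ := hr a hab
    exact ⟨b, mem_sUn.2 ⟨level z, (mem_img _ _).2 ⟨a, (mem_sep _ _).2 ⟨ha, hab⟩, he⟩, hb⟩, hab'⟩

theorem act_mem_level {G π : M} (hG : IsPermGroup atoms G) (hπ : π ∈ₐ G) {z b : M}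
    (hb : b ∈ₐ level z) : act π b ∈ₐ level z := by
  have hp := hG.perm π hπ
  refine mem_induction (P := fun z => ∀ b, b ∈ₐ level z → act π b ∈ₐ level z)
    (fun z ih b hb => ?_) z b hb
  rw [mem_level] at hb ⊢
  rcases hb with hb | ⟨w, hw, hb⟩
  · exact Or.inl (isAtom_act_of_isAtom hp hb)
  · refine Or.inr ⟨w, hw, isSet_act hp hb.1, fun c hc => ?_⟩
    obtain ⟨d, hd, rfl⟩ := (mem_act hp).1 hc
    exact ih w hw d (hb.2 d hd)

end Level

/-! ### Filters in the permutation model -/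

section Filter
variable {M : Type u} [AtomStr M] [hM : IsZFCA M] {G F : M}

theorem IsFilterIn.isSet_base {Φ x : M} (h : IsFilterIn G F Φ x) : IsSet x := (h.subset x h.univ_mem).1

theorem IsFilterIn.bInter_mem {Φ x s : M} (h : IsFilterIn G F Φ x) (hs : IsSet s)
    (hf : IsFinite s) (hsΦ : ∀ u, u ∈ₐ s → u ∈ₐ Φ) : bInter x s ∈ₐ Φ := by
  refine finite_induction (P := fun s => (∀ u, u ∈ₐ s → u ∈ₐ Φ) → bInter x s ∈ₐ Φ) ?_ ?_ hs hf hsΦ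
  · intro _
    rw [ext_iff' (isSet_bInter _ _) h.isSet_base fun z => by simp]
    exact h.univ_mem
  · intro s u _ _ _ ih hs
    rw [ext_iff' (isSet_bInter _ _) (isSet_inter (bInter x s) u) fun z => ?_]
    · exact h.inter_mem _ _ (ih fun v hv => hs v (mem_ins.2 (Or.inl hv)))
        (hs u (mem_ins.2 (Or.inr rfl)))
    · simp only [mem_bInter, mem_ins, mem_inter]
      constructor
      · rintro ⟨h1, h2⟩
        exact ⟨⟨h1, fun v hv => h2 v (Or.inl hv)⟩, h2 u (Or.inr rfl)⟩
      · rintro ⟨⟨h1, h2⟩, h3⟩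
        refine ⟨h1, fun v hv => ?_⟩
        rcases hv with hv | rfl
        exacts [h2 v hv, h3]

/-! ### Simultaneous choice of ultrafilters -/

/-- The first component of a pair. -/
noncomputable def fst (p : M) : M := theU fun a => ∃ b, p = pair a b

/-- The second component of a pair. -/
noncomputable def snd (p : M) : M := theU fun b => ∃ a, p = pair a b

@[simp] theorem fst_pair (a b : M) : fst (pair a b) = a :=
  theU_eq ⟨b, rfl⟩ fun _ ⟨_, h⟩ => (pair_inj.1 h).1.symm

@[simp] theorem snd_pair (a b : M) : snd (pair a b) = b :=
  theU_eq ⟨a, rfl⟩ fun _ ⟨_, h⟩ => (pair_inj.1 h).2.symm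

/-- The finite partial functions `p` on `T` with `p(Φ) ∈ ⋃ Φ`, or at least `p(Φ) ∈ ⋃⋃ T`. -/
noncomputable def selectors (T : M) : M :=
  sep (pow (prod T (sUn (sUn T)))) fun p => IsFinite p ∧
    ∀ Φ a b, pair Φ a ∈ₐ p → pair Φ b ∈ₐ p → a = b

/-- The selectors `p` such that `p(Φ)` is defined and belongs to `u`. -/
noncomputable def selecting (T Φ u : M) : M :=
  sep (selectors T) fun p => ∃ a, a ∈ₐ u ∧ pair Φ a ∈ₐ p

/-- The selectors `p` such that `p(Φ) ∈ u` for all pairs `(Φ, u)` in `q`. -/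
noncomputable def selectingAll (T q : M) : M :=
  sep (selectors T) fun p => ∀ Φ u, pair Φ u ∈ₐ q → ∃ a, a ∈ₐ u ∧ pair Φ a ∈ₐ p

/-- `q` is a finite set of pairs `(Φ, u)` with `u ∈ Φ ∈ T`. -/
def IsDemand (T q : M) : Prop :=
  IsSet q ∧ IsFinite q ∧ ∀ c, c ∈ₐ q → ∃ Φ u, Φ ∈ₐ T ∧ u ∈ₐ Φ ∧ c = pair Φ u

variable (G F) in
/-- The filter, in the permutation model, of sets of selectors that is generated by the sets of the
selectors `p` with `p(Φ) ∈ u`, for `u ∈ Φ ∈ T`. -/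
noncomputable def selectorFilter (T : M) : M :=
  sep (pow (selectors T)) fun w => HS G F w ∧ ∃ q, IsDemand T q ∧ IsSubset (selectingAll T q) w

section Inst
variable {Γ : Type u} [c : Ctx M Γ] {A : Set M} (s t r : Γ → M) [DF A s] [DF A t] [DF A r]

instance df_fst : DF A fun p => fst (s p) := by
  refine df_subst₁ s ?_
  unfold fst; infer_instance

instance df_snd : DF A fun p => snd (s p) := by
  refine df_subst₁ s ?_
  unfold snd; infer_instance

instance df_selectors : DF A fun p => selectors (s p) := by
  refine df_subst₁ s ?_
  unfold selectors; infer_instance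

instance df_selecting [InPar A (a : M)] : DF A fun p => selecting a (s p) (t p) := by
  refine df_subst₂ s t ?_
  unfold selecting; infer_instance

instance df_selectingAll : DF A fun p => selectingAll (s p) (t p) := by
  refine df_subst₂ s t ?_
  unfold selectingAll; infer_instance

instance dfn_isDemand : Dfn A fun p => IsDemand (s p) (t p) := by
  refine dfn_subst₂ s t ?_
  unfold IsDemand; infer_instance

instance df_selectorFilter [InPar A G] [InPar A F] : DF A fun p => selectorFilter G F (s p) := by
  refine df_subst₁ s ?_
  unfold selectorFilter; infer_instance
end Inst

theorem mem_selectors {T p : M} : p ∈ₐ selectors T ↔ IsSubset p (prod T (sUn (sUn T))) ∧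
    IsFinite p ∧ ∀ Φ a b, pair Φ a ∈ₐ p → pair Φ b ∈ₐ p → a = b := by
  rw [selectors, mem_sep, mem_pow]

theorem mem_selecting {T Φ u p : M} :
    p ∈ₐ selecting T Φ u ↔ p ∈ₐ selectors T ∧ ∃ a, a ∈ₐ u ∧ pair Φ a ∈ₐ p := mem_sep _ _

theorem mem_selectingAll {T q p : M} : p ∈ₐ selectingAll T q ↔
    p ∈ₐ selectors T ∧ ∀ Φ u, pair Φ u ∈ₐ q → ∃ a, a ∈ₐ u ∧ pair Φ a ∈ₐ p := mem_sep _ _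

theorem mem_selectorFilter {T w : M} : w ∈ₐ selectorFilter G F T ↔ IsSubset w (selectors T) ∧
    HS G F w ∧ ∃ q, IsDemand T q ∧ IsSubset (selectingAll T q) w := by
  rw [selectorFilter, mem_sep, mem_pow]

/-- Finitely many demands can be met: by induction on the finite set of the filters concerned. -/
theorem exists_mem_selectingAll {T q : M} (hT : ∀ Φ, Φ ∈ₐ T → ∃ x, IsFilterIn G F Φ x)
    (hq : IsDemand T q) : ∃ p, p ∈ₐ selectingAll T q := by
  have key : ∃ p, p ∈ₐ selectors T ∧ (∀ Φ a, pair Φ a ∈ₐ p → Φ ∈ₐ img q fst) ∧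
      ∀ Φ, Φ ∈ₐ img q fst → Φ ∈ₐ T → ∃ a, pair Φ a ∈ₐ p ∧ ∀ u, pair Φ u ∈ₐ q → a ∈ₐ u := by
    refine finite_induction (P := fun d => ∃ p, p ∈ₐ selectors T ∧
      (∀ Φ a, pair Φ a ∈ₐ p → Φ ∈ₐ d) ∧
      ∀ Φ, Φ ∈ₐ d → Φ ∈ₐ T → ∃ a, pair Φ a ∈ₐ p ∧ ∀ u, pair Φ u ∈ₐ q → a ∈ₐ u) ?_ ?_
      (isSet_img q fst) (hq.2.1.img hq.1 fst)
    · refine ⟨emp, mem_selectors.2 ⟨⟨isSet_emp, fun z hz => absurd hz (not_mem_emp z)⟩,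
        isFinite_emp, fun Φ a b h => absurd h (not_mem_emp _)⟩, by simp, by simp⟩
    · rintro d Φ hd hdf hΦd ⟨p, hp, hpd, hpq⟩
      by_cases hΦ : Φ ∈ₐ T
      · obtain ⟨x, hx⟩ := hT Φ hΦ
        have hs := (hq.2.1.img hq.1 snd).subset (isSet_img _ _)
          (t := sep (img q snd) fun u => pair Φ u ∈ₐ q)
          ⟨isSet_sep _ _, fun z hz => ((mem_sep _ _).1 hz).1⟩
        have hsΦ : ∀ u, pair Φ u ∈ₐ q → u ∈ₐ Φ := by
          intro u hu
          obtain ⟨Φ', u', -, h', e⟩ := hq.2.2 _ hu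
          obtain ⟨rfl, rfl⟩ := pair_inj.1 e
          exact h'
        obtain ⟨a, ha⟩ := hx.nonempty _ (hx.bInter_mem (isSet_sep _ _) hs
          fun u hu => hsΦ u ((mem_sep _ _).1 hu).2)
        rw [mem_bInter] at ha
        rw [mem_selectors] at hp
        refine ⟨ins (pair Φ a) p, mem_selectors.2 ⟨⟨isSet_ins _ _, fun z hz => ?_⟩,
          hp.2.1.ins _, fun Ψ b c hb hc => ?_⟩, fun Ψ b hb => ?_, fun Ψ hΨ hΨT => ?_⟩
        · rcases mem_ins.1 hz with hz | rfl
          · exact hp.1.2 z hz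
          · exact pair_mem_prod.2 ⟨hΦ, mem_sUn.2 ⟨x, mem_sUn.2 ⟨Φ, hΦ, hx.univ_mem⟩, ha.1⟩⟩
        · simp only [mem_ins, pair_inj] at hb hc
          rcases hb with hb | ⟨rfl, rfl⟩
          · rcases hc with hc | ⟨rfl, rfl⟩
            · exact hp.2.2 Ψ b c hb hc
            · exact absurd (hpd _ _ hb) hΦd
          · rcases hc with hc | ⟨-, rfl⟩
            · exact absurd (hpd _ _ hc) hΦd
            · rfl
        · simp only [mem_ins, pair_inj] at hb ⊢
          exact hb.imp (hpd _ _) fun h => h.1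
        · rcases mem_ins.1 hΨ with h | rfl
          · obtain ⟨b, hb, hb'⟩ := hpq Ψ h hΨT
            exact ⟨b, mem_ins.2 (Or.inl hb), hb'⟩
          · refine ⟨a, mem_ins.2 (Or.inr rfl), fun u hu => ha.2 u ?_⟩
            exact (mem_sep _ _).2 ⟨(mem_img _ _).2 ⟨_, hu, snd_pair _ _⟩, hu⟩
      · refine ⟨p, hp, fun Ψ a h => mem_ins.2 (Or.inl (hpd Ψ a h)), fun Ψ hΨ hΨT => ?_⟩
        rcases mem_ins.1 hΨ with h | rfl
        · exact hpq Ψ h hΨT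
        · exact absurd hΨT hΦ
  obtain ⟨p, hp, -, h⟩ := key
  refine ⟨p, mem_selectingAll.2 ⟨hp, fun Φ u hu => ?_⟩⟩
  have hΦT : Φ ∈ₐ T := by
    obtain ⟨Φ', u', h', -, e⟩ := hq.2.2 _ hu
    obtain ⟨rfl, rfl⟩ := pair_inj.1 e
    exact h'
  obtain ⟨a, ha, hau⟩ := h Φ ((mem_img _ _).2 ⟨_, hu, fst_pair _ _⟩) hΦT
  exact ⟨a, hau u hu, ha⟩

variable [hS : PermSetting G F]

theorem HS.selectors {T : M} (hT : HS G F T) : HS G F (selectors T) := by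
  obtain ⟨K, hK, h⟩ := hT.fixes
  refine hs_of_df hK (fun _ _ => inferInstance) fun p hp => ?_
  rw [mem_selectors] at hp
  refine hs_finite hp.1.1 hp.2.1 fun c hc => ?_
  obtain ⟨Φ, a, hΦ, ha, rfl⟩ := mem_prod.1 (hp.1.2 c hc)
  obtain ⟨u, hu, ha⟩ := mem_sUn.1 ha
  obtain ⟨Ψ, hΨ, hu⟩ := mem_sUn.1 hu
  exact (hT.mem hΦ).pair (((hT.mem hΨ).mem hu).mem ha)

theorem HS.selecting {T Φ u : M} (hT : HS G F T) (hΦ : HS G F Φ) (hu : HS G F u) :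
    HS G F (selecting T Φ u) := by
  obtain ⟨K, hK, h, h1⟩ := exists_fixes₂ hT hΦ
  obtain ⟨L, hL, h2⟩ := hu.fixes
  obtain ⟨J, hJ, hJK, hJL⟩ := exists_mem_filter_subset G hK hL
  have := h.mono hJK
  have := h1.mono hJK
  have := h2.mono hJL
  exact hs_of_df hJ (fun _ _ => inferInstance) fun p hp => hT.selectors.mem (mem_selecting.1 hp).1

theorem isFilterIn_selectorFilter {T : M} (hT : HS G F T)
    (h : ∀ Φ, Φ ∈ₐ T → ∃ x, IsFilterIn G F Φ x) :
    HS G F (selectorFilter G F T) ∧ IsFilterIn G F (selectorFilter G F T) (selectors T) := by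
  refine ⟨?_, isSet_sep _ _, fun u hu => (mem_selectorFilter.1 hu).1, ?_, fun u hu => ?_,
    fun u v hu hv => ?_, fun u v hu hv hvx huv => ?_⟩
  · obtain ⟨K, hK, h⟩ := hT.fixes
    exact hs_of_df hK (fun _ _ => inferInstance) fun w hw => (mem_selectorFilter.1 hw).2.1
  · refine mem_selectorFilter.2 ⟨isSubset_refl (isSet_sep _ _), hT.selectors, emp,
      ⟨isSet_emp, isFinite_emp, by simp⟩, isSet_sep _ _, fun p hp => (mem_selectingAll.1 hp).1⟩
  · obtain ⟨-, -, q, hq, hqu⟩ := mem_selectorFilter.1 hu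
    obtain ⟨p, hp⟩ := exists_mem_selectingAll h hq
    exact ⟨p, hqu.2 p hp⟩
  · obtain ⟨hu1, hu2, q, hq, hqu⟩ := mem_selectorFilter.1 hu
    obtain ⟨hv1, hv2, r, hr, hrv⟩ := mem_selectorFilter.1 hv
    refine mem_selectorFilter.2 ⟨(inter_subset_left u v).trans hu1, hu2.inter hv2, cup q r,
      ⟨isSet_cup _ _, hq.2.1.cup hr.2.1 hq.1 hr.1, fun c hc => ?_⟩, isSet_sep _ _, fun p hp => ?_⟩
    · exact (mem_cup.1 hc).elim (hq.2.2 c) (hr.2.2 c)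
    · rw [mem_selectingAll] at hp
      refine mem_inter.2 ⟨hqu.2 p (mem_selectingAll.2 ⟨hp.1, fun Φ u hu => ?_⟩),
        hrv.2 p (mem_selectingAll.2 ⟨hp.1, fun Φ u hu => ?_⟩)⟩
      · exact hp.2 Φ u (mem_cup.2 (Or.inl hu))
      · exact hp.2 Φ u (mem_cup.2 (Or.inr hu))
  · obtain ⟨hu1, hu2, q, hq, hqu⟩ := mem_selectorFilter.1 hu
    exact mem_selectorFilter.2 ⟨hvx, hv, q, hq, hqu.1, fun z hz => huv z (hqu.2 z hz)⟩

theorem selecting_mem_selectorFilter {T Φ u : M} (hT : HS G F T) (hΦ : Φ ∈ₐ T) (hu : u ∈ₐ Φ) :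
    selecting T Φ u ∈ₐ selectorFilter G F T := by
  refine mem_selectorFilter.2 ⟨⟨isSet_sep _ _, fun p hp => (mem_selecting.1 hp).1⟩,
    hT.selecting (hT.mem hΦ) ((hT.mem hΦ).mem hu), ins (pair Φ u) emp,
    ⟨isSet_ins _ _, isFinite_emp.ins _, fun c hc => ?_⟩, isSet_sep _ _, fun p hp => ?_⟩
  · simp only [mem_ins, not_mem_emp, false_or] at hc
    exact ⟨Φ, u, hΦ, hu, hc⟩
  · rw [mem_selectingAll] at hp
    exact mem_selecting.2 ⟨hp.1, hp.2 Φ u (by simp)⟩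

variable (G F) in
/-- The ultrafilter on `x` that an ultrafilter `V` on the selectors chooses above `Φ`. -/
noncomputable def chosen (T V Φ x : M) : M :=
  sep (pow x) fun u => HS G F u ∧ selecting T Φ u ∈ₐ V

theorem mem_chosen {T V Φ x u : M} : u ∈ₐ chosen G F T V Φ x ↔
    IsSubset u x ∧ HS G F u ∧ selecting T Φ u ∈ₐ V := by
  rw [chosen, mem_sep, mem_pow]

/-- The complement clause uses that `p(Φ) ∈ x` for almost all selectors `p`, and the intersection
clause that selectors are functions. -/
theorem isUltrafilterIn_chosen {T V Φ x : M} (hT : HS G F T) (hx : HS G F x) (hΦ : Φ ∈ₐ T)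
    (hf : IsFilterIn G F Φ x) (hV : IsUltrafilterIn G F V (selectors T))
    (h : ∀ w, w ∈ₐ selectorFilter G F T → w ∈ₐ V) :
    IsUltrafilterIn G F (chosen G F T V Φ x) x ∧ ∀ u, u ∈ₐ Φ → u ∈ₐ chosen G F T V Φ x := by
  have hΦs := hT.mem hΦ
  have hsub : ∀ u, IsSubset (selecting T Φ u) (selectors T) := fun u =>
    ⟨isSet_sep _ _, fun p hp => (mem_selecting.1 hp).1⟩
  have hΦV : ∀ u, u ∈ₐ Φ → u ∈ₐ chosen G F T V Φ x := fun u hu =>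
    mem_chosen.2 ⟨hf.subset u hu, hΦs.mem hu, h _ (selecting_mem_selectorFilter hT hΦ hu)⟩
  have hxV := (mem_chosen.1 (hΦV x hf.univ_mem)).2.2
  refine ⟨⟨⟨isSet_sep _ _, fun u hu => (mem_chosen.1 hu).1, hΦV x hf.univ_mem, fun u hu => ?_,
    fun u v hu hv => ?_, fun u v hu hv hvx huv => ?_⟩, fun y hy hyx => ?_⟩, hΦV⟩
  · obtain ⟨p, hp⟩ := hV.filter.nonempty _ (mem_chosen.1 hu).2.2
    obtain ⟨-, a, ha, -⟩ := mem_selecting.1 hp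
    exact ⟨a, ha⟩
  · obtain ⟨hu1, hu2, hu3⟩ := mem_chosen.1 hu
    obtain ⟨hv1, hv2, hv3⟩ := mem_chosen.1 hv
    refine mem_chosen.2 ⟨(inter_subset_left u v).trans hu1, hu2.inter hv2,
      hV.filter.upward _ _ (hV.filter.inter_mem _ _ hu3 hv3) (hT.selecting hΦs (hu2.inter hv2))
        (hsub _) fun p hp => ?_⟩
    simp only [mem_inter, mem_selecting] at hp ⊢
    obtain ⟨⟨hp, a, ha, hpa⟩, -, b, hb, hpb⟩ := hp
    obtain rfl := (mem_selectors.1 hp).2.2 Φ a b hpa hpb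
    exact ⟨hp, a, ⟨ha, hb⟩, hpa⟩
  · obtain ⟨hu1, hu2, hu3⟩ := mem_chosen.1 hu
    refine mem_chosen.2 ⟨hvx, hv, hV.filter.upward _ _ hu3 (hT.selecting hΦs hv) (hsub _)
      fun p hp => ?_⟩
    rw [mem_selecting] at hp ⊢
    obtain ⟨hp, a, ha, hpa⟩ := hp
    exact ⟨hp, a, huv a ha, hpa⟩
  · have hd := hx.diff hy
    rcases hV.mem_or_diff_mem _ (hT.selecting hΦs hy) (hsub y) with h1 | h1
    · exact Or.inl (mem_chosen.2 ⟨hyx, hy, h1⟩)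
    · refine Or.inr (mem_chosen.2 ⟨diff_subset x y, hd, hV.filter.upward _ _
        (hV.filter.inter_mem _ _ hxV h1) (hT.selecting hΦs hd) (hsub _) fun p hp => ?_⟩)
      simp only [mem_inter, mem_diff, mem_selecting] at hp ⊢
      obtain ⟨⟨hp, a, ha, hpa⟩, -, hn⟩ := hp
      exact ⟨hp, a, ⟨ha, fun hay => hn ⟨hp, a, hay, hpa⟩⟩, hpa⟩

variable (G F) in
/-- Every filter of the permutation model that is fixed by `K` extends to an ultrafilter of the
permutation model that is fixed by `K`. -/
def IsGood (K : M) : Prop := ∀ Φ x, HS G F Φ → HS G F x → IsFilterIn G F Φ x → Fixes K Φ →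
  Fixes K x → ∃ U, HS G F U ∧ IsUltrafilterIn G F U x ∧ (∀ u, u ∈ₐ Φ → u ∈ₐ U) ∧ Fixes K U

instance dfn_isGood {Γ : Type u} [c : Ctx M Γ] {A : Set M} (s : Γ → M) [DF A s] [InPar A G]
    [InPar A F] : Dfn A fun p => IsGood G F (s p) := by
  refine dfn_subst₁ s ?_
  unfold IsGood; infer_instance

/-- If `BPI` holds in the permutation model, then the good groups form a base of the filter. The
groups that are not good have counterexamples in a set `T` of the permutation model. An ultrafilter
`V` on the selectors for `T` chooses ultrafilters above all elements of `T` at once, in a way that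
is preserved by the stabilizer of `V`, so that subgroups of this stabilizer are good. -/
theorem exists_isGood_subset (hbpi : BPI (PermModel G F)) {H : M} (hH : H ∈ₐ F) :
    ∃ K, K ∈ₐ F ∧ IsSubset K H ∧ IsGood G F K := by
  obtain ⟨S, hSs, hSl, hcol⟩ := exists_collection (fun K Φ => ∃ x, HS G F Φ ∧ HS G F x ∧
    IsFilterIn G F Φ x ∧ Fixes K Φ ∧ Fixes K x ∧
    ¬ ∃ U, HS G F U ∧ IsUltrafilterIn G F U x ∧ (∀ u, u ∈ₐ Φ → u ∈ₐ U) ∧ Fixes K U) F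
  let T := sep S fun Φ => HS G F Φ ∧ ∃ x, HS G F x ∧ IsFilterIn G F Φ x
  have mem_T : ∀ Φ, Φ ∈ₐ T ↔ Φ ∈ₐ S ∧ HS G F Φ ∧ ∃ x, HS G F x ∧ IsFilterIn G F Φ x :=
    fun Φ => mem_sep _ _
  have hTfix : Fixes G T := by
    refine ⟨fun π hπ => act_eq_self_of_forall_mem hS.group (isSet_sep _ _) ?_ hπ⟩
    intro π hπ Φ hΦ
    rw [mem_T] at hΦ ⊢
    refine ⟨?_, ((actAut hS.group hπ).dfn_iff
      (P := fun Φ => HS G F Φ ∧ ∃ x, HS G F x ∧ IsFilterIn G F Φ x) Φ).2 hΦ.2⟩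
    obtain ⟨z, hz, hzS⟩ := hSl Φ hΦ.1
    exact hzS.2 _ (act_mem_level hS.group hπ hz)
  have hT : HS G F T := hs_of_fixes hS.filter.top_mem hTfix fun Φ hΦ => ((mem_T Φ).1 hΦ).2.1
  obtain ⟨h1, h2⟩ := isFilterIn_selectorFilter hT fun Φ hΦ => by
    obtain ⟨-, -, x, -, hx⟩ := (mem_T Φ).1 hΦ
    exact ⟨x, hx⟩
  obtain ⟨V, hVs, hV, hVT⟩ := bpi_iff.1 hbpi _ _ hT.selectors h1 (isSet_sep _ _) h2
  obtain ⟨L, hL, hLV⟩ := hVs.fixes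
  obtain ⟨K, hK, hKH, hKL⟩ := exists_mem_filter_subset G hH hL
  refine ⟨K, hK, hKH, ?_⟩
  by_contra hbad
  obtain ⟨Φ, hΦS, x, hΦs, hxs, hf, hKΦ, hKx, hno⟩ := hcol K hK (by
    unfold IsGood at hbad
    push Not at hbad
    obtain ⟨Φ, x, a1, a2, a3, a4, a5, a6⟩ := hbad
    exact ⟨Φ, x, a1, a2, a3, a4, a5, fun ⟨U, b1, b2, b3, b4⟩ => a6 U b1 b2 b3 b4⟩)
  have hΦT : Φ ∈ₐ T := (mem_T Φ).2 ⟨hΦS, hΦs, x, hxs, hf⟩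
  obtain ⟨hU, hΦU⟩ := isUltrafilterIn_chosen hT hxs hΦT hf hV hVT
  have := hLV.mono hKL
  have : Fixes K T := hTfix.mono (hS.filter.subgroup K hK).2
  have hdf : ∀ π, ∀ hπ : π ∈ₐ K, DF (filterAut (G := G) hK hπ).fix
      fun _ : Nil M => chosen G F T V Φ x := by
    intro π hπ
    unfold chosen
    infer_instance
  exact hno ⟨_, hs_of_df hK hdf fun u hu => (mem_chosen.1 hu).2.1, hU, hΦU, Fixes.of_df G hK hdf⟩

end Filter

/-! ### Zorn's lemma for families of sets -/

section Zorn
variable {M : Type u} [AtomStr M] [hM : IsZFCA M]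

/-- Any two elements of `C` are comparable with respect to inclusion. -/
def IsChainSet (C : M) : Prop := ∀ a b, a ∈ₐ C → b ∈ₐ C → IsSubset a b ∨ IsSubset b a

instance dfn_isChainSet {Γ : Type u} [c : Ctx M Γ] {A : Set M} (s : Γ → M) [DF A s] :
    Dfn A fun p => IsChainSet (s p) := by
  refine dfn_subst₁ s ?_
  unfold IsChainSet; infer_instance

/-- The set `S` contains `a₀` and is closed under `g` and under unions of nonempty chains. -/
def IsTower (g : M → M) (a₀ S : M) : Prop := a₀ ∈ₐ S ∧ (∀ a, a ∈ₐ S → g a ∈ₐ S) ∧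
  ∀ C, IsSubset C S → (∃ a, a ∈ₐ C) → IsChainSet C → sUn C ∈ₐ S

/-- A family of sets that is closed under unions of nonempty chains does not admit a map `g` with
`a ⊊ g a` for all `a` (Bourbaki–Witt): the least tower would be a chain, and its union a fixed point
of `g`. -/
theorem exists_eq_self_of_isTower {P a₀ : M} {g : M → M}
    [hg : DF Set.univ fun q : Nil M × M => g q.2] (hs : ∀ a, a ∈ₐ P → IsSet a)
    (hP : IsTower g a₀ P) (hle : ∀ a, a ∈ₐ P → IsSubset a (g a)) : ∃ a, a ∈ₐ P ∧ g a = a := by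
  have hd : ∀ {Γ : Type u} [Ctx M Γ] (t : Γ → M) [DF Set.univ t], DF Set.univ fun p => g (t p) :=
    fun t => hg.comp₁ t
  have hdt : ∀ {Γ : Type u} [Ctx M Γ] (t : Γ → M) [DF Set.univ t],
      Dfn Set.univ fun p => IsTower g a₀ (t p) := by
    intro Γ _ t _
    refine dfn_subst₁ t ?_
    unfold IsTower
    infer_instance
  have mem_I : ∀ a, a ∈ₐ sep P (fun a => ∀ S, IsTower g a₀ S → a ∈ₐ S) ↔
    a ∈ₐ P ∧ ∀ S, IsTower g a₀ S → a ∈ₐ S := fun a => mem_sep _ _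
  have hIs : IsSet (sep P fun a => ∀ S, IsTower g a₀ S → a ∈ₐ S) := isSet_sep _ _
  generalize sep P (fun a => ∀ S, IsTower g a₀ S → a ∈ₐ S) = I at mem_I hIs
  have hIP : ∀ a, a ∈ₐ I → a ∈ₐ P := fun a ha => ((mem_I a).1 ha).1
  have hI : IsTower g a₀ I := by
    refine ⟨(mem_I _).2 ⟨hP.1, fun S hS => hS.1⟩, fun a ha => ?_, fun C hC hne hch => ?_⟩
    · rw [mem_I] at ha ⊢
      exact ⟨hP.2.1 a ha.1, fun S hS => hS.2.1 a (ha.2 S hS)⟩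
    · exact (mem_I _).2 ⟨hP.2.2 C ⟨hC.1, fun a ha => hIP a (hC.2 a ha)⟩ hne hch, fun S hS =>
        hS.2.2 C ⟨hC.1, fun a ha => ((mem_I a).1 (hC.2 a ha)).2 S hS⟩ hne hch⟩
  have ind : ∀ (Q : M → Prop) [Dfn Set.univ fun q : Nil M × M => Q q.2], Q a₀ →
      (∀ a, a ∈ₐ I → Q a → Q (g a)) →
      (∀ C, IsSubset C I → (∃ a, a ∈ₐ C) → IsChainSet C → (∀ a, a ∈ₐ C → Q a) → Q (sUn C)) →
      ∀ a, a ∈ₐ I → Q a := by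
    intro Q _ h0 h1 h2 a ha
    have mem_J : ∀ a, a ∈ₐ sep I Q ↔ a ∈ₐ I ∧ Q a := fun a => mem_sep _ _
    refine ((mem_J a).1 (((mem_I a).1 ha).2 (sep I Q) ⟨(mem_J _).2 ⟨hI.1, h0⟩, fun b hb => ?_,
      fun C hC hne hch => ?_⟩)).2
    · rw [mem_J] at hb ⊢
      exact ⟨hI.2.1 b hb.1, h1 b hb.1 hb.2⟩
    · have hCI : IsSubset C I := ⟨hC.1, fun b hb => ((mem_J b).1 (hC.2 b hb)).1⟩
      exact (mem_J _).2 ⟨hI.2.2 C hCI hne hch,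
        h2 C hCI hne hch fun b hb => ((mem_J b).1 (hC.2 b hb)).2⟩
  have sub_sUn : ∀ C b, b ∈ₐ C → IsSubset C I → IsSubset b (sUn C) := fun C b hb hC =>
    ⟨hs b (hIP b (hC.2 b hb)), fun z hz => mem_sUn.2 ⟨b, hb, hz⟩⟩
  have sUn_sub : ∀ C b : M, (∀ a, a ∈ₐ C → IsSubset a b) → IsSubset (sUn C) b := fun C b h =>
    ⟨isSet_sUn C, fun z hz => by
      obtain ⟨a, ha, hz⟩ := mem_sUn.1 hz
      exact (h a ha).2 z hz⟩
  have hmin : ∀ a, a ∈ₐ I → IsSubset a₀ a := by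
    refine ind _ (isSubset_refl (hs _ hP.1)) (fun a ha h => h.trans (hle a (hIP a ha))) ?_
    rintro C hC ⟨b, hb⟩ - h
    exact (h b hb).trans (sub_sUn C b hb hC)
  -- If nothing in the least tower lies strictly between `a` and `g a` from below, then every
  -- element of the tower lies below `a` or above `g a`.
  have hA : ∀ a, a ∈ₐ I → (∀ b, b ∈ₐ I → IsSubset b a → b ≠ a → IsSubset (g b) a) →
      ∀ b, b ∈ₐ I → IsSubset b a ∨ IsSubset (g a) b := by
    intro a ha he
    refine ind _ (Or.inl (hmin a ha)) (fun b hb h => ?_) fun C hC hne hch h => ?_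
    · rcases h with h | h
      · by_cases hba : b = a
        · exact Or.inr (hba ▸ isSubset_refl (hs _ (hP.2.1 b (hIP b hb))))
        · exact Or.inl (he b hb h hba)
      · exact Or.inr (h.trans (hle b (hIP b hb)))
    · by_cases hall : ∀ b, b ∈ₐ C → IsSubset b a
      · exact Or.inl (sUn_sub C a hall)
      · push Not at hall
        obtain ⟨b, hb, hba⟩ := hall
        exact Or.inr (((h b hb).resolve_left hba).trans (sub_sUn C b hb hC))
  have hB : ∀ a, a ∈ₐ I → ∀ b, b ∈ₐ I → IsSubset b a → b ≠ a → IsSubset (g b) a := by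
    refine ind _ (fun b hb h hn => absurd (h.antisymm (hmin b hb)) hn) (fun a ha ih b hb h hn => ?_)
      fun C hC hne hch ih b hb h hn => ?_
    · rcases hA a ha ih b hb with h' | h'
      · by_cases hba : b = a
        · exact hba ▸ isSubset_refl (hs _ (hP.2.1 b (hIP b hb)))
        · exact (ih b hb h' hba).trans (hle a (hIP a ha))
      · exact absurd (h.antisymm h') hn
    · by_cases hall : ∀ c, c ∈ₐ C → IsSubset (g c) b
      · exact absurd (h.antisymm
          (sUn_sub C b fun c hc => (hle c (hIP c (hC.2 c hc))).trans (hall c hc))) hn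
      · push Not at hall
        obtain ⟨c, hc, hcb⟩ := hall
        have hcI := hC.2 c hc
        have hbc := (hA c hcI (ih c hc) b hb).resolve_right hcb
        by_cases hbc' : b = c
        · subst hbc'
          exact (hA b hcI (ih b hc) _ (hI.2.2 C hC hne hch)).resolve_left
            fun h' => hn (h.antisymm h')
        · exact (ih c hc b hb hbc hbc').trans (sub_sUn C c hc hC)
  have hch : IsChainSet I := fun a b ha hb =>
    (hA a ha (hB a ha) b hb).symm.imp_left fun h => (hle a (hIP a ha)).trans h
  have hII : IsSubset I I := isSubset_refl hIs
  have hm := hI.2.2 I hII ⟨_, hI.1⟩ hch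
  exact ⟨sUn I, hIP _ hm, (sub_sUn I _ (hI.2.1 _ hm) hII).antisymm (hle _ (hIP _ hm))⟩

/-- Zorn's lemma, for a family of sets that is ordered by inclusion. -/
theorem exists_maximal {P a₀ : M} (h₀ : a₀ ∈ₐ P) (hs : ∀ a, a ∈ₐ P → IsSet a)
    (hP : ∀ C, IsSubset C P → (∃ a, a ∈ₐ C) → IsChainSet C → sUn C ∈ₐ P) :
    ∃ m, m ∈ₐ P ∧ ∀ a, a ∈ₐ P → IsSubset m a → a = m := by
  by_contra! hmax
  have mem_ups : ∀ a p, p ∈ₐ img (sep P fun b => IsSubset a b ∧ b ≠ a) (fun b => pair a b) ↔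
      ∃ b, (b ∈ₐ P ∧ IsSubset a b ∧ b ≠ a) ∧ pair a b = p := by
    intro a p
    rw [mem_img]
    simp only [mem_sep]
  obtain ⟨c, -, hc⟩ := hM.out.choose_spec.choice
    (img P fun a => img (sep P fun b => IsSubset a b ∧ b ≠ a) fun b => pair a b) (by
      intro y hy
      obtain ⟨a, ha, rfl⟩ := (mem_img _ _).1 hy
      obtain ⟨b, hb, hab, hn⟩ := hmax a ha
      exact ⟨_, (mem_ups a _).2 ⟨b, ⟨hb, hab, hn⟩, rfl⟩⟩) (by
      intro y y' hy hy' h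
      obtain ⟨a, ha, rfl⟩ := (mem_img _ _).1 hy
      obtain ⟨a', ha', rfl⟩ := (mem_img _ _).1 hy'
      obtain ⟨p, hp, hp'⟩ := h
      obtain ⟨b, -, rfl⟩ := (mem_ups a _).1 hp
      obtain ⟨b', -, h'⟩ := (mem_ups a' _).1 hp'
      rw [(pair_inj.1 h').1])
  have hg : ∀ a, a ∈ₐ P → ∃! b, (b ∈ₐ P ∧ IsSubset a b ∧ b ≠ a) ∧ pair a b ∈ₐ c := by
    intro a ha
    obtain ⟨p, ⟨hp, hpc⟩, hu⟩ := hc _ ((mem_img _ _).2 ⟨a, ha, rfl⟩)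
    obtain ⟨b, hb, rfl⟩ := (mem_ups a p).1 hp
    refine ⟨b, ⟨hb, hpc⟩, fun b' hb' => ?_⟩
    exact (pair_inj.1 (hu _ ⟨(mem_ups a _).2 ⟨b', hb'.1, rfl⟩, hb'.2⟩)).2
  obtain ⟨m, hm, he⟩ := exists_eq_self_of_isTower (P := P) (a₀ := a₀)
    (g := fun a => theU fun b => (b ∈ₐ P ∧ IsSubset a b ∧ b ≠ a) ∧ pair a b ∈ₐ c) hs
    ⟨h₀, fun a ha => (theU_spec (hg a ha)).1.1, hP⟩ fun a ha => (theU_spec (hg a ha)).1.2.1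
  exact (theU_spec (hg m hm)).1.2.2 he

end Zorn

/-! ### The filter extension property from the Boolean prime ideal theorem -/

section Main
variable {M : Type u} [AtomStr M] [hM : IsZFCA M] {G F : M} [hS : PermSetting G F]

theorem HasFIP.not_isFinite {Φ x s : M} (h : HasFIP Φ x) (hs : IsSubset s Φ) (hf : IsFinite s) :
    ¬ IsFinite (bInter x s) := (hasFIP_iff'.1 h).2.2.2 s hs hf

variable (G F) in
/-- The filter on `x`, in the permutation model, that is generated by `Φ` and the cofinite subsets
of `x`. -/
noncomputable def freeFilter (Φ x : M) : M := sep (pow x) fun u => HS G F u ∧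
  ∃ r, IsSubset r Φ ∧ IsFinite r ∧ IsFinite (diff (bInter x r) u)

theorem mem_freeFilter {Φ x u : M} : u ∈ₐ freeFilter G F Φ x ↔ IsSubset u x ∧ HS G F u ∧
    ∃ r, IsSubset r Φ ∧ IsFinite r ∧ IsFinite (diff (bInter x r) u) := by
  rw [freeFilter, mem_sep, mem_pow]

theorem isFilterIn_freeFilter {Φ x : M} (hx : HS G F x) (h : HasFIP Φ x) :
    IsFilterIn G F (freeFilter G F Φ x) x := by
  have hemp : IsSubset emp Φ := ⟨isSet_emp, fun z hz => absurd hz (not_mem_emp z)⟩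
  refine ⟨isSet_sep _ _, fun u hu => (mem_freeFilter.1 hu).1, ?_, fun u hu => ?_,
    fun u v hu hv => ?_, fun u v hu hv hvx huv => ?_⟩
  · refine mem_freeFilter.2 ⟨isSubset_refl h.isSet_base, hx, emp, hemp, isFinite_emp, ?_⟩
    rw [eq_emp (isSet_diff _ _) fun z hz => ?_]
    · exact isFinite_emp
    · simp only [mem_diff, mem_bInter] at hz
      exact hz.2 hz.1.1
  · obtain ⟨-, -, r, hr, hrf, hf⟩ := mem_freeFilter.1 hu
    by_contra! hn
    refine h.not_isFinite hr hrf ?_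
    rwa [ext_iff' (isSet_diff _ _) (isSet_bInter x r) fun z => ?_] at hf
    simp [hn]
  · obtain ⟨hux, hus, r, hr, hrf, hf⟩ := mem_freeFilter.1 hu
    obtain ⟨hvx, hvs, r', hr', hrf', hf'⟩ := mem_freeFilter.1 hv
    refine mem_freeFilter.2 ⟨(inter_subset_left u v).trans hux, hus.inter hvs, cup r r',
      ⟨isSet_cup _ _, fun z hz => (mem_cup.1 hz).elim (hr.2 z) (hr'.2 z)⟩,
      hrf.cup hrf' hr.1 hr'.1, ?_⟩
    refine (hf.cup hf' (isSet_diff _ _) (isSet_diff _ _)).subset (isSet_cup _ _)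
      ⟨isSet_diff _ _, fun z hz => ?_⟩
    simp only [mem_diff, mem_bInter, mem_inter, mem_cup] at hz ⊢
    by_cases hzu : z ∈ₐ u
    · exact Or.inr ⟨⟨hz.1.1, fun w hw => hz.1.2 w (Or.inr hw)⟩, fun hzv => hz.2 ⟨hzu, hzv⟩⟩
    · exact Or.inl ⟨⟨hz.1.1, fun w hw => hz.1.2 w (Or.inl hw)⟩, hzu⟩
  · obtain ⟨-, -, r, hr, hrf, hf⟩ := mem_freeFilter.1 hu
    refine mem_freeFilter.2 ⟨hvx, hv, r, hr, hrf,
      hf.subset (isSet_diff _ _) ⟨isSet_diff _ _, fun z hz => ?_⟩⟩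
    rw [mem_diff] at hz ⊢
    exact ⟨hz.1, fun hzu => hz.2 (huv z hzu)⟩

theorem subset_freeFilter {Φ x u : M} (hΦ : HS G F Φ) (h : HasFIP Φ x) (hu : u ∈ₐ Φ) :
    u ∈ₐ freeFilter G F Φ x := by
  refine mem_freeFilter.2 ⟨h.subset u hu, hΦ.mem hu, ins u emp,
    ⟨isSet_ins _ _, fun z hz => ?_⟩, isFinite_emp.ins u, ?_⟩
  · simp only [mem_ins, not_mem_emp, false_or] at hz
    rwa [hz]
  · rw [eq_emp (isSet_diff _ _) fun z hz => ?_]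
    · exact isFinite_emp
    · simp only [mem_diff, mem_bInter, mem_ins, not_mem_emp, false_or, forall_eq] at hz
      exact hz.2 hz.1.2

theorem diff_mem_freeFilter {Φ x f : M} (hx : HS G F x) (hf : HS G F f)
    (hfs : IsSet f) (hfin : IsFinite f) : diff x f ∈ₐ freeFilter G F Φ x := by
  refine mem_freeFilter.2 ⟨diff_subset x f, hx.diff hf, emp,
    ⟨isSet_emp, fun z hz => absurd hz (not_mem_emp z)⟩, isFinite_emp,
    hfin.subset hfs ⟨isSet_diff _ _, fun z hz => ?_⟩⟩
  simp only [mem_diff, mem_bInter] at hz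
  by_contra hzf
  exact hz.2 ⟨hz.1.1, hzf⟩

variable (G) in
include hS in
/-- `Φ ∪ Orb(y, K)` is fixed by `K` if `Φ` is. -/
theorem fixes_union_orbit {K Φ y w : M} (hK : K ∈ₐ F) (hΦ : Fixes K Φ) (hw : IsSet w)
    (h : ∀ z, z ∈ₐ w ↔ z ∈ₐ Φ ∨ ∃ π, π ∈ₐ K ∧ act π y = z) : Fixes K w := by
  have hg := group_of_mem G hK
  refine ⟨fun π hπ => act_eq_self_of_forall_mem hg hw (fun π hπ z hz => ?_) hπ⟩
  rw [h] at hz ⊢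
  rcases hz with hz | ⟨ρ, hρ, rfl⟩
  · refine Or.inl ?_
    rw [← hΦ.out π hπ]
    exact (act_mem_act hg hπ).2 hz
  · obtain ⟨τ, hτ, he⟩ := exists_act_mul hg hπ hρ
    exact Or.inr ⟨τ, hτ, he y⟩

/-- A good group has the property that is required of the elements of the base in the filter
extension property: a `K`-invariant ultrafilter above `Φ` and the cofinite sets contains the orbit
of one of `y` and `x ∖ y`. -/
theorem IsGood.extension {K Φ x y : M} (hK : K ∈ₐ F) (h : IsGood G F K) (hΦ : HS G F Φ)
    (hx : HS G F x) (hy : HS G F y) (hKΦ : Fixes K Φ) (hKx : Fixes K x) (hfip : HasFIP Φ x)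
    (hyx : IsSubset y x) : ∃ y', (y' = y ∨ y' = diff x y) ∧
      ∃ w, HS G F w ∧ (∀ z, z ∈ₐ w ↔ z ∈ₐ Φ ∨ ∃ π, π ∈ₐ K ∧ act π y' = z) ∧ HasFIP w x := by
  have hdf : ∀ π, ∀ hπ : π ∈ₐ K, DF (filterAut (G := G) hK hπ).fix
      fun _ : Nil M => freeFilter G F Φ x := by
    intro π hπ
    unfold freeFilter
    infer_instance
  have hs : HS G F (freeFilter G F Φ x) := hs_of_df hK hdf fun u hu => (mem_freeFilter.1 hu).2.1
  obtain ⟨U, hUs, hU, hsub, hKU⟩ := h _ x hs hx (isFilterIn_freeFilter hx hfip)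
    (Fixes.of_df G hK hdf) hKx
  obtain ⟨y', hy', hy'U⟩ : ∃ y', (y' = y ∨ y' = diff x y) ∧ y' ∈ₐ U := by
    rcases hU.mem_or_diff_mem y hy hyx with h | h
    exacts [⟨_, Or.inl rfl, h⟩, ⟨_, Or.inr rfl, h⟩]
  have hw : ∀ z, z ∈ₐ sep U (fun z => z ∈ₐ Φ ∨ ∃ π, π ∈ₐ K ∧ act π y' = z) ↔
      z ∈ₐ Φ ∨ ∃ π, π ∈ₐ K ∧ act π y' = z := by
    intro z
    rw [mem_sep, and_iff_right_iff_imp]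
    rintro (hz | ⟨π, hπ, rfl⟩)
    · exact hsub z (subset_freeFilter hΦ hfip hz)
    · rw [← hKU.out π hπ]
      exact (act_mem_act (group_of_mem G hK) hπ).2 hy'U
  have hwU : ∀ z, z ∈ₐ sep U (fun z => z ∈ₐ Φ ∨ ∃ π, π ∈ₐ K ∧ act π y' = z) → z ∈ₐ U :=
    fun z hz => ((mem_sep _ _).1 hz).1
  refine ⟨y', hy', _, hs_of_fixes hK (fixes_union_orbit G hK hKΦ (isSet_sep _ _) hw)
    fun z hz => hUs.mem (hwU z hz), hw, hasFIP_iff'.2 ⟨hfip.isSet_base, isSet_sep _ _,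
    fun u hu => hU.filter.subset u (hwU u hu), fun s hs hf hfin => ?_⟩⟩
  have h1 := hU.filter.bInter_mem hs.1 hf fun u hu => hwU u (hs.2 u hu)
  have h2 := hsub _ (diff_mem_freeFilter hx (hUs.mem h1) (isSet_bInter _ _) hfin)
  obtain ⟨z, hz⟩ := hU.filter.nonempty _ (hU.filter.inter_mem _ _ h1 h2)
  simp only [mem_inter, mem_diff] at hz
  exact hz.2.2 hz.1

theorem filterExtensionProperty_of_bpi (h : BPI (PermModel G F)) :
    FilterExtensionProperty G F := by
  have mem_B : ∀ K, K ∈ₐ sep F (fun K => IsGood G F K) ↔ K ∈ₐ F ∧ IsGood G F K :=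
    fun K => mem_sep _ _
  refine filterExtensionProperty_iff.2 ⟨sep F fun K => IsGood G F K,
    ⟨isSet_sep _ _, fun K hK => ((mem_B K).1 hK).1⟩, fun H hH => ?_,
    fun K hK Φ x y hΦ hx hy hKΦ hKx hfip hyx => ?_⟩
  · obtain ⟨K, hK, hKH, hgood⟩ := exists_isGood_subset h hH
    exact ⟨K, (mem_B K).2 ⟨hK, hgood⟩, hKH⟩
  · rw [mem_B] at hK
    exact hK.2.extension hK.1 hΦ hx hy hKΦ hKx hfip hyx

/-! ### The Boolean prime ideal theorem from the filter extension property -/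

/-- A filter with a finite element has a point in common to all its elements. -/
theorem IsFilterIn.exists_mem_of_isFinite {Φ x u : M} (h : IsFilterIn G F Φ x) (hu : u ∈ₐ Φ)
    (hf : IsFinite u) : ∃ a, a ∈ₐ x ∧ ∀ v, v ∈ₐ Φ → a ∈ₐ v := by
  by_contra! hn
  obtain ⟨v, hv, hvu⟩ : ∃ v, v ∈ₐ Φ ∧ ∀ z, z ∈ₐ u → ¬ z ∈ₐ v := by
    refine finite_induction (P := fun s => ∃ v, v ∈ₐ Φ ∧ ∀ z, z ∈ₐ s → ¬ z ∈ₐ v)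
      ⟨x, h.univ_mem, by simp⟩ ?_ (h.subset u hu).1 hf
    rintro s a - - - ⟨v, hv, hvs⟩
    by_cases ha : a ∈ₐ x
    · obtain ⟨w, hw, haw⟩ := hn a ha
      refine ⟨inter v w, h.inter_mem v w hv hw, fun z hz hzvw => ?_⟩
      rw [mem_inter] at hzvw
      rcases mem_ins.1 hz with hz | rfl
      exacts [hvs z hz hzvw.1, haw hzvw.2]
    · refine ⟨v, hv, fun z hz hzv => ?_⟩
      rcases mem_ins.1 hz with hz | rfl
      exacts [hvs z hz hzv, ha ((h.subset v hv).2 _ hzv)]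
  obtain ⟨z, hz⟩ := h.nonempty _ (h.inter_mem u v hu hv)
  rw [mem_inter] at hz
  exact hvu z hz.1 hz.2

/-- The principal ultrafilter at a point belongs to the permutation model. -/
theorem exists_principal_ultrafilter {Φ x a : M} (hx : HS G F x) (h : IsFilterIn G F Φ x)
    (hΦ : HS G F Φ) (ha : a ∈ₐ x) (haΦ : ∀ v, v ∈ₐ Φ → a ∈ₐ v) :
    ∃ U, HS G F U ∧ IsUltrafilterIn G F U x ∧ ∀ u, u ∈ₐ Φ → u ∈ₐ U := by
  have hm : ∀ u, u ∈ₐ sep (pow x) (fun u => HS G F u ∧ a ∈ₐ u) ↔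
    IsSubset u x ∧ HS G F u ∧ a ∈ₐ u := fun u => by rw [mem_sep, mem_pow]
  obtain ⟨K, hK, h1, h2⟩ := exists_fixes₂ hx (hx.mem ha)
  refine ⟨sep (pow x) fun u => HS G F u ∧ a ∈ₐ u,
    hs_of_df hK (fun _ _ => inferInstance) fun u hu => ((hm u).1 hu).2.1,
    ⟨⟨isSet_sep _ _, fun u hu => ((hm u).1 hu).1, (hm x).2 ⟨isSubset_refl h.isSet_base, hx, ha⟩,
      fun u hu => ⟨a, ((hm u).1 hu).2.2⟩, fun u v hu hv => ?_, fun u v hu hv hvx huv => ?_⟩,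
      fun y hy hyx => ?_⟩, fun u hu => (hm u).2 ⟨h.subset u hu, hΦ.mem hu, haΦ u hu⟩⟩
  · rw [hm] at hu hv ⊢
    exact ⟨(inter_subset_left u v).trans hu.1, hu.2.1.inter hv.2.1,
      mem_inter.2 ⟨hu.2.2, hv.2.2⟩⟩
  · exact (hm v).2 ⟨hvx, hv, huv a ((hm u).1 hu).2.2⟩
  · by_cases hay : a ∈ₐ y
    · exact Or.inl ((hm y).2 ⟨hyx, hy, hay⟩)
    · exact Or.inr ((hm _).2 ⟨diff_subset x y, hx.diff hy, mem_diff.2 ⟨ha, hay⟩⟩)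

/-- A family with the finite intersection property that contains each subset of `x` or its
complement is an ultrafilter. -/
theorem HasFIP.isUltrafilterIn {U x : M} (h : HasFIP U x) (hU : HS G F U) (hxU : x ∈ₐ U)
    (hult : ∀ y, HS G F y → IsSubset y x → y ∈ₐ U ∨ diff x y ∈ₐ U) : IsUltrafilterIn G F U x := by
  have key : ∀ u v w, u ∈ₐ U → v ∈ₐ U → w ∈ₐ U → ∃ z, z ∈ₐ u ∧ z ∈ₐ v ∧ z ∈ₐ w := by
    intro u v w hu hv hw
    by_contra! hn
    refine h.not_isFinite (s := ins u (ins v (ins w emp))) ⟨isSet_ins _ _, fun z hz => ?_⟩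
      (((isFinite_emp.ins w).ins v).ins u) ?_
    · simp only [mem_ins, not_mem_emp, false_or] at hz
      rcases hz with (rfl | rfl) | rfl <;> assumption
    · rw [eq_emp (isSet_bInter _ _) fun z hz => ?_]
      · exact isFinite_emp
      · simp only [mem_bInter, mem_ins, not_mem_emp, false_or] at hz
        exact hn z (hz.2 u (Or.inr rfl)) (hz.2 v (Or.inl (Or.inr rfl)))
          (hz.2 w (Or.inl (Or.inl rfl)))
  refine ⟨⟨h.isSet, h.subset, hxU, fun u hu => ?_, fun u v hu hv => ?_,
    fun u v hu hv hvx huv => ?_⟩, hult⟩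
  · obtain ⟨z, hz, -⟩ := key u u u hu hu hu
    exact ⟨z, hz⟩
  · refine (hult _ ((hU.mem hu).inter (hU.mem hv))
      ((inter_subset_left u v).trans (h.subset u hu))).resolve_right fun hd => ?_
    obtain ⟨z, hz1, hz2, hz3⟩ := key u v _ hu hv hd
    exact (mem_diff.1 hz3).2 (mem_inter.2 ⟨hz1, hz2⟩)
  · refine (hult v hv hvx).resolve_right fun hd => ?_
    obtain ⟨z, hz1, -, hz3⟩ := key u u _ hu hu hd
    exact (mem_diff.1 hz3).2 (huv z hz1)

/-- A finite subset of the union of a nonempty chain is included in one element of the chain. -/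
theorem HasFIP.sUn {x C : M} (hC : ∃ Ψ, Ψ ∈ₐ C) (h : ∀ Ψ, Ψ ∈ₐ C → HasFIP Ψ x)
    (hch : IsChainSet C) : HasFIP (sUn C) x := by
  obtain ⟨Ψ₀, hΨ₀⟩ := hC
  refine hasFIP_iff'.2 ⟨(h Ψ₀ hΨ₀).isSet_base, isSet_sUn C, fun u hu => ?_, fun s hs hf => ?_⟩
  · obtain ⟨Ψ, hΨ, hu⟩ := mem_sUn.1 hu
    exact (h Ψ hΨ).subset u hu
  · obtain ⟨Ψ, hΨ, hsΨ⟩ : ∃ Ψ, Ψ ∈ₐ C ∧ IsSubset s Ψ := by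
      refine finite_induction (P := fun s => IsSubset s (ZFA.sUn C) → ∃ Ψ, Ψ ∈ₐ C ∧ IsSubset s Ψ)
        ?_ ?_ hs.1 hf hs
      · exact fun _ => ⟨Ψ₀, hΨ₀, isSet_emp, fun z hz => absurd hz (not_mem_emp z)⟩
      · intro s u hss _ _ ih hs
        obtain ⟨Ψ, hΨ, hsΨ⟩ := ih ⟨hss, fun z hz => hs.2 z (mem_ins.2 (Or.inl hz))⟩
        obtain ⟨Ψ', hΨ', hu⟩ := mem_sUn.1 (hs.2 u (mem_ins.2 (Or.inr rfl)))
        rcases hch Ψ Ψ' hΨ hΨ' with hle | hle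
        · refine ⟨Ψ', hΨ', isSet_ins _ _, fun z hz => ?_⟩
          rcases mem_ins.1 hz with hz | rfl
          exacts [hle.2 z (hsΨ.2 z hz), hu]
        · refine ⟨Ψ, hΨ, isSet_ins _ _, fun z hz => ?_⟩
          rcases mem_ins.1 hz with hz | rfl
          exacts [hsΨ.2 z hz, hle.2 _ hu]
    exact (h Ψ hΨ).not_isFinite hsΨ hf

/-- A maximal `K`-invariant family with the finite intersection property above a given filter is an
ultrafilter, by the filter extension property. -/
theorem bpi_of_filterExtensionProperty (h : FilterExtensionProperty G F) :
    BPI (PermModel G F) := by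
  obtain ⟨B, hBF, hbase, hext⟩ := filterExtensionProperty_iff.1 h
  refine bpi_iff.2 fun x Φ hx hΦ hxs hfil => ?_
  by_cases hfin : ∃ u, u ∈ₐ Φ ∧ IsFinite u
  · obtain ⟨u, hu, hf⟩ := hfin
    obtain ⟨a, ha, haΦ⟩ := hfil.exists_mem_of_isFinite hu hf
    exact exists_principal_ultrafilter hx hfil hΦ ha haΦ
  obtain ⟨H, hH, hHx, hHΦ⟩ := exists_fixes₂ hx hΦ
  obtain ⟨K, hKB, hKH⟩ := hbase H hH
  have hK := hBF.2 K hKB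
  have hKx := hHx.mono hKH
  have hKΦ := hHΦ.mono hKH
  have mem_P : ∀ Ψ, Ψ ∈ₐ sep (pow (pow x)) (fun Ψ => HS G F Ψ ∧ Fixes K Ψ ∧ HasFIP Ψ x ∧
      IsSubset Φ Ψ) ↔ HS G F Ψ ∧ Fixes K Ψ ∧ HasFIP Ψ x ∧ IsSubset Φ Ψ := by
    intro Ψ
    rw [mem_sep, mem_pow, and_iff_right_iff_imp]
    exact fun h => ⟨h.2.2.1.isSet, fun u hu => mem_pow.2 (h.2.2.1.subset u hu)⟩
  obtain ⟨U, hU, hmax⟩ := exists_maximal (a₀ := Φ) ((mem_P Φ).2 ⟨hΦ, hKΦ,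
      hasFIP_iff'.2 ⟨hxs, hfil.isSet, hfil.subset, fun s hs hf hfs =>
        hfin ⟨_, hfil.bInter_mem hs.1 hf hs.2, hfs⟩⟩, isSubset_refl hfil.isSet⟩)
    (fun Ψ hΨ => ((mem_P Ψ).1 hΨ).2.2.1.isSet) (by
      rintro C hC ⟨Ψ₀, hΨ₀⟩ hch
      have hCP := fun Ψ hΨ => (mem_P Ψ).1 (hC.2 Ψ hΨ)
      have hfix : Fixes K (sUn C) := by
        refine ⟨fun π hπ => act_eq_self_of_forall_mem (group_of_mem G hK) (isSet_sUn C)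
          (fun π hπ z hz => ?_) hπ⟩
        obtain ⟨Ψ, hΨ, hz⟩ := mem_sUn.1 hz
        refine mem_sUn.2 ⟨Ψ, hΨ, ?_⟩
        rw [← (hCP Ψ hΨ).2.1.out π hπ]
        exact (act_mem_act (group_of_mem G hK) hπ).2 hz
      refine (mem_P _).2 ⟨hs_of_fixes hK hfix fun z hz => ?_, hfix,
        HasFIP.sUn ⟨Ψ₀, hΨ₀⟩ (fun Ψ hΨ => (hCP Ψ hΨ).2.2.1) hch, hfil.isSet,
        fun z hz => mem_sUn.2 ⟨Ψ₀, hΨ₀, (hCP Ψ₀ hΨ₀).2.2.2.2 z hz⟩⟩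
      obtain ⟨Ψ, hΨ, hz⟩ := mem_sUn.1 hz
      exact (hCP Ψ hΨ).1.mem hz)
  obtain ⟨hUs, hKU, hfip, hΦU⟩ := (mem_P U).1 hU
  refine ⟨U, hUs, hfip.isUltrafilterIn hUs (hΦU.2 x hfil.univ_mem) fun y hy hyx => ?_, hΦU.2⟩
  obtain ⟨y', hy', w, hws, hw, hwfip⟩ := hext K hKB U x y hUs hx hy hKU hKx hfip hyx
  have hUw : IsSubset U w := ⟨hfip.isSet, fun z hz => (hw z).2 (Or.inl hz)⟩
  have hwP := (mem_P w).2 ⟨hws, fixes_union_orbit G hK hKU hwfip.isSet hw, hwfip, hΦU.trans hUw⟩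
  have hy'U : y' ∈ₐ U := by
    rw [← hmax w hwP hUw, hw]
    obtain ⟨e, he, he'⟩ := exists_act_one (group_of_mem G hK)
    exact Or.inr ⟨e, he, he' y'⟩
  rcases hy' with rfl | rfl
  exacts [Or.inl hy'U, Or.inr hy'U]

end Main

end ZFA

theorem mainTheorem5 {M : Type u} [ZFA.AtomStr M] (A G F : M) (hM : ZFA.IsModelZFCA A)
    (hG : ZFA.IsPermGroup A G) (hF : ZFA.IsNormalFilter A G F) :
    ZFA.BPI (ZFA.PermModel G F) ↔ ZFA.FilterExtensionProperty G F := by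
  have : ZFA.IsZFCA M := ⟨A, hM⟩
  have hA : A = ZFA.atoms :=
    ZFA.ext_iff' hM.atoms_isSet ZFA.isSet_atoms fun z => (hM.mem_atoms z).trans ZFA.mem_atoms.symm
  subst hA
  have : ZFA.PermSetting G F := ⟨hG, hF⟩
  exact ⟨ZFA.filterExtensionProperty_of_bpi, ZFA.bpi_of_filterExtensionProperty⟩
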